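/- Let $d\ge 1$, let $0<\alpha=\beta\le 1$, and let $u_0\in\mathcal S(\mathbb R^d)$ be a (complex-valued) Schwartz function. Consider the time-fractional Schrödinger equation $$-i^{\beta}\,\partial_t^{\alpha}u+H_0u=0\ \text{ in }\mathbb R^d\times(0,\infty),\qquad u(\cdot,0)=u_0,\qquad H_0=-\Delta,\quad D(H_0)=H^2(\mathbb R^d),\quad i^\beta=e^{i\pi\beta/2},$$ where $\partial_t^\alpha u(t)=\frac1{\Gamma(1-\alpha)}\int_0^t\frac{u'(s)}{(t-s)^\alpha}\,ds$ is the Caputo derivative if $\alpha<1$ and $\partial_t^1=\partial_t$. A solution is a function $u\in L^1_{\rm loc}((0,\infty);D(H_0))\cap W^{1,1}_{\rm loc}((0,\infty);L^2(\mathbb R^d))$ (identified with its continuous representative $(0,\infty)\to L^2(\mathbb R^d)$) for which, for almost every $t>0$, the integral defining $\partial_t^\alpha u(t)$ converges absolutely in $L^2(\mathbb R^d)$ (no condition if $\alpha=1$) and the equation holds in $L^2(\mathbb R^d)$, and such that $\lim_{t\downarrow0}\|u(\cdot,t)-u_0\|=0$, with $\|\cdot\|$ the norm of $L^2(\mathbb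 R^d)$. Write $\hat u_0(\xi)=(2\pi)^{-d/2}\int_{\mathbb R^d}e^{-ix\cdot\xi}u_0(x)\,dx$. Then there is a unique solution $u$, its mean-square displacement $$D_2(u_0,t)=\int_{\mathbb R^d}|x|^2|u(x,t)|^2\,dx$$ is finite for every $t>0$, and $$D_2(u_0,t)=\frac{4}{\alpha^4}\,\bigl\||\xi|^{\frac{2-\alpha}{\alpha}}\hat u_0\bigr\|^2\,t^2+O(t),\qquad t\to\infty.$$ If $u_0\ne0$, the coefficient of $t^2$ is strictly positive, so the motion is ballistic. -/

import Mathlib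

open MeasureTheory Set Filter Topology Asymptotics
open scoped SchwartzMap Laplacian

noncomputable section

namespace TFSE

/-- The Euclidean space `ℝ^d`. -/
abbrev Space (d : ℕ) : Type := EuclideanSpace ℝ (Fin d)

/-- The complex Hilbert space `L²(ℝ^d)` for the Lebesgue measure. -/
abbrev L2 (d : ℕ) : Type := Lp ℂ 2 (volume : Measure (Space d))

/-- `f` belongs to the domain `D(H₀) = H²(ℝ^d)` of `H₀ = -Δ`, and `H₀ f = g`. The Laplacian is taken
in the sense of (tempered) distributions. -/
def FreeHamiltonian {d : ℕ} (f g : L2 d) : Prop :=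
  TemperedDistribution.MemSobolev 2 2 (Lp.toTemperedDistribution f) ∧
    -(Δ (Lp.toTemperedDistribution f)) = Lp.toTemperedDistribution g

/-- For a function of time with derivative `v`, its Caputo derivative of order `α ∈ (0, 1]` exists at
time `t` and equals `w`: for `α < 1` it is
`Γ(1 - α)⁻¹ ∫₀ᵗ (t - s)^(-α) v(s) ds`, where the integral has to converge absolutely;
for `α = 1` it is the usual derivative. -/
def HasCaputo {d : ℕ} (α : ℝ) (v : ℝ → L2 d) (t : ℝ) (w : L2 d) : Prop :=
  if α = 1 then v t = w
  else IntegrableOn (fun s : ℝ => ((t - s) ^ (-α) : ℝ) • v s) (Ioo 0 t) ∧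
    (Real.Gamma (1 - α))⁻¹ • (∫ s in Ioo 0 t, ((t - s) ^ (-α) : ℝ) • v s) = w

/-- `u` is a solution on `(0, ∞)` of `-i^β ∂_t^α u + H₀ u = 0`, `u(0) = u₀`, that is,
* `u ∈ L¹_loc(ℝ₊; D(H₀))`, where `w(t) = H₀ u(t)` for almost every `t > 0`;
* `u ∈ W^{1,1}_loc(ℝ₊; L²)` with derivative `v`, and `u` is the continuous representative;
* the equation holds in `L²(ℝ^d)` for almost every `t > 0`, with `i^β = exp(iπβ/2)`;
* `‖u(t) - u₀‖ → 0` as `t ↓ 0`. -/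
def IsSolution {d : ℕ} (α β : ℝ) (u₀ : L2 d) (u : ℝ → L2 d) : Prop :=
  ∃ v w : ℝ → L2 d,
    LocallyIntegrableOn u (Ioi 0) ∧
    LocallyIntegrableOn w (Ioi 0) ∧
    (∀ᵐ t : ℝ, 0 < t → FreeHamiltonian (u t) (w t)) ∧
    LocallyIntegrableOn v (Ioi 0) ∧
    (∀ s t : ℝ, 0 < s → s ≤ t → u t - u s = ∫ r in s..t, v r) ∧
    (∀ᵐ t : ℝ, 0 < t → ∃ c : L2 d, HasCaputo α v t c ∧ -(Complex.I ^ (β : ℂ)) • c + w t = 0) ∧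
    Tendsto (fun t : ℝ => ‖u t - u₀‖) (𝓝[>] 0) (𝓝 0)

/-- The unitary Fourier transform `(2π)^(-d/2) ∫ e^{-i x·ξ} f(x) dx`. -/
def fourier {d : ℕ} (f : Space d → ℂ) (ξ : Space d) : ℂ :=
  (((2 * Real.pi) ^ (-(d : ℝ) / 2) : ℝ) : ℂ) *
    ∫ x : Space d, Complex.exp (-Complex.I * ((inner ℝ x ξ : ℝ) : ℂ)) * f x

/-- `|x|² |f(x)|²` is integrable, i.e. `f` has a finite mean-square displacement. -/
def FiniteMSD {d : ℕ} (f : L2 d) : Prop :=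
  Integrable (fun x : Space d => ‖x‖ ^ 2 * ‖f x‖ ^ 2)

/-- The mean-square displacement `∫ |x|² |f(x)|² dx`. -/
def msd {d : ℕ} (f : L2 d) : ℝ := ∫ x : Space d, ‖x‖ ^ 2 * ‖f x‖ ^ 2

/-- The ballistic coefficient `(4 / α⁴) ‖ |ξ|^((2-α)/α) û₀ ‖²`. -/
def ballisticCoeff {d : ℕ} (α : ℝ) (u₀ : 𝓢(Space d, ℂ)) : ℝ :=
  4 / α ^ 4 * ∫ ξ : Space d, (‖ξ‖ ^ ((2 - α) / α) * ‖fourier u₀ ξ‖) ^ 2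

end TFSE

end

/-! The Fourier transform decouples the equation into scalar problems `∂_t^α y = (-i)^α λ y` with `λ
= |2πξ|²`. Their solution is `y(0)` times a Mittag-Leffler function of `τ = λ^{1/α} t`, namely
`E_α((-iτ)^α)`. The whole argument rests on the splitting `relax α τ = (1/α) e^{-iτ} + ∫₀^∞ kern α r
e^{-rτ} dr`. The first term is the residue of `e^{sτ} s^{α-1}/(s^α - (-i)^α)` at `s = -i`; the
second comes from the branch cut along the negative axis.

The splitting serves as the definition of `relax`. A contour integral
(`tendsto_integral_contourFun_jump`, `integral_kern_div`) computes the Stieltjes transform of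
`kern`, hence the Laplace transform of `relax`; uniqueness of Laplace transforms then gives the
Caputo equation (`relaxAbel_eq_relax`). Multiplying the transform of the datum by `relax α (freq α ξ
* t)` and inverting yields a solution (`isSolution_solution`). For uniqueness, the difference of two
solutions is cut off to `|ξ| ≤ R`, where `-Δ` is bounded; inverting the Abel operator leaves a
weakly singular Volterra inequality, which forces zero (`eq_zero_of_abel_eq`, `IsSolution.eqOn`).

By Plancherel the mean-square displacement is `(2π)^{-2}` times the squared norm of the gradient in
`ξ` of the transformed solution. Differentiating `(1/α) e^{-i freq t}` brings down `t ∇freq`, and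
the modulus of the result does not oscillate, so its square is exactly `t²` times a fixed density;
the factors `2/α` from `∇freq` and `1/α` from the residue make up `4/α⁴`.

All else must cost only `O(t)`. The derivative of the cut integral is `O(1/τ)`, so its share of the
gradient is `O(1/|ξ|)` uniformly in `t`. This is harmless against the main term, which carries a
spare `|ξ|`, but its square need not be integrable at the origin in low dimension. The second bound
`O(τ^{α-1})` gives `O(t^α |ξ|)`; multiplying the two bounds gives `O(t^α)`, which is `O(t)` for `t ≥
1` (`exists_norm_remGrad_le`, `exists_abs_norm_gradTerm_sq_sub_le`). -/

noncomputable section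

namespace TFSE

/-! ### Contour integrand in logarithmic coordinates and removal of its poles -/

section

/-- The phase `(-i)^α`. -/
def phase (α : ℝ) : ℂ := Complex.exp (-(Real.pi * α / 2 : ℝ) * Complex.I)

/-- The phase `(-i)^α e^{-iπα}`. -/
def lowerPhase (α : ℝ) : ℂ := Complex.exp (-(3 * Real.pi * α / 2 : ℝ) * Complex.I)

/-- The phase `(-i)^α e^{iπα}`. -/
def upperPhase (α : ℝ) : ℂ := Complex.exp ((Real.pi * α / 2 : ℝ) * Complex.I)

/-- The pole `-iπ/2` of `e^{αw} / (e^{αw} - (-i)^α)`. -/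
def poleLog : ℂ := -(Real.pi / 2 : ℝ) * Complex.I

lemma exp_poleLog : Complex.exp poleLog = -Complex.I := by
  have : poleLog = -((Real.pi : ℂ) / 2 * Complex.I) := by
    simp [poleLog]
  rw [this, Complex.exp_neg, Complex.exp_pi_div_two_mul_I, Complex.inv_I]

lemma exp_mul_poleLog (α : ℝ) : Complex.exp (α * poleLog) = phase α := by
  rw [phase, poleLog]; congr 1; push_cast; ring

/-- The periods of `e^{aw}` are the multiples of `2πi/a`, and `a ≤ 1` makes each nonzero one at
least `2π` long. This is what keeps `e^{αw} = (-i)^α` from having a second root in the strip. -/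
lemma eq_of_exp_eq_exp_of_strip {a : ℝ} (ha : 0 < a) (ha1 : a ≤ 1) {z w : ℂ}
    (hlow : -(2 * Real.pi) < w.im - z.im) (hup : w.im - z.im < 2 * Real.pi)
    (h : Complex.exp (a * w) = Complex.exp (a * z)) : w = z := by
  obtain ⟨n, hn⟩ := Complex.exp_eq_exp_iff_exists_int.1 h
  have him := congrArg Complex.im hn
  simp at him
  have hpi := Real.pi_pos
  have hn0 : n = 0 := by
    by_contra hne
    have h1 : (1 : ℝ) ≤ |(n : ℝ)| := by
      exact_mod_cast Int.one_le_abs hne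
    have h2 : a * (w.im - z.im) = n * (2 * Real.pi) := by linarith
    have h3 : |a * (w.im - z.im)| < 2 * Real.pi := by
      rw [abs_mul, abs_of_pos ha]
      have : |w.im - z.im| < 2 * Real.pi := abs_lt.2 ⟨hlow, hup⟩
      nlinarith [abs_nonneg (w.im - z.im)]
    rw [h2, abs_mul, abs_of_pos (by positivity : (0 : ℝ) < 2 * Real.pi)] at h3
    nlinarith
  rw [hn0] at hn
  have ha' : (a : ℂ) ≠ 0 := by exact_mod_cast ha.ne'
  simpa [ha'] using hn

/-- The integrand of the contour integral before the poles are removed. -/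
def contourFun (α σ : ℝ) (w : ℂ) : ℂ :=
  Complex.exp (α * w) / ((Complex.exp (α * w) - phase α) * (Complex.exp w - Complex.exp σ))

/-- The `2πi`-periodic function with a simple pole of residue one at the logarithms of `p`. -/
def periodicPole (p w : ℂ) : ℂ := Complex.exp w / (Complex.exp w - p)

/-- The residue of `contourFun` at `poleLog`. -/
def resLow (α σ : ℝ) : ℂ := 1 / (α * (-Complex.I - Complex.exp σ))

/-- The residue of `contourFun` at `σ`. -/
def resHigh (α σ : ℝ) : ℂ :=
  Complex.exp (α * σ) / ((Complex.exp (α * σ) - phase α) * Complex.exp σ)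

/-- Dividing out the zero at `z` leaves a function without zeros nearby, so every pole of the
integrand is simple and can be written as `1/(w - z)` times a holomorphic function. -/
lemma dslope_exp_ne_zero {a : ℝ} (ha : 0 < a) (ha1 : a ≤ 1) {z w : ℂ}
    (hlow : -(2 * Real.pi) < w.im - z.im) (hup : w.im - z.im < 2 * Real.pi) :
    dslope (fun v : ℂ => Complex.exp (a * v)) z w ≠ 0 := by
  have ha' : (a : ℂ) ≠ 0 := by exact_mod_cast ha.ne'
  by_cases hw : w = z
  · subst hw
    rw [dslope_same]
    have : HasDerivAt (fun v : ℂ => Complex.exp (a * v)) (Complex.exp (a * w) * (a * 1)) w :=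
      ((hasDerivAt_id w).const_mul (a : ℂ)).cexp
    rw [this.deriv]
    simp [ha', Complex.exp_ne_zero]
  · intro h0
    have h := sub_smul_dslope (fun v : ℂ => Complex.exp (a * v)) z w
    rw [h0, smul_zero] at h
    exact hw (eq_of_exp_eq_exp_of_strip ha ha1 hlow hup (sub_eq_zero.1 h.symm))

lemma dslope_exp_same (a : ℝ) (z : ℂ) :
    dslope (fun v : ℂ => Complex.exp (a * v)) z z = a * Complex.exp (a * z) := by
  rw [dslope_same]
  have : HasDerivAt (fun v : ℂ => Complex.exp (a * v)) (Complex.exp (a * z) * (a * 1)) z :=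
    ((hasDerivAt_id z).const_mul (a : ℂ)).cexp
  rw [this.deriv]
  ring

lemma differentiable_dslope_exp (a : ℝ) (z : ℂ) :
    Differentiable ℂ (dslope (fun v : ℂ => Complex.exp (a * v)) z) := by
  rw [← differentiableOn_univ, Complex.differentiableOn_dslope univ_mem, differentiableOn_univ]
  fun_prop

/-- The open strip `|Im w| < 3π/2`. -/
def strip : Set ℂ := {w | |w.im| < 3 * Real.pi / 2}

lemma mem_strip {w : ℂ} : w ∈ strip ↔ |w.im| < 3 * Real.pi / 2 := Iff.rfl

lemma isOpen_strip : IsOpen strip :=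
  isOpen_lt (continuous_abs.comp Complex.continuous_im) continuous_const

lemma poleLog_im : poleLog.im = -(Real.pi / 2) := by simp [poleLog]

lemma poleLog_re : poleLog.re = 0 := by simp [poleLog]

lemma poleLog_mem_strip : poleLog ∈ strip := by
  have := Real.pi_pos
  rw [mem_strip]; simp only [poleLog_im, abs_neg]
  rw [abs_of_pos (by positivity)]; linarith

lemma ofReal_mem_strip (σ : ℝ) : (σ : ℂ) ∈ strip := by
  have := Real.pi_pos
  rw [mem_strip]; simp only [Complex.ofReal_im, abs_zero]; positivity

/-- With `z = e^w` the integrand is `z^{α-1} dz / ((z^α - (-i)^α)(z - s))` on the slit plane, with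
simple poles at `z = -i` and `z = s = e^σ`. Subtracting `2πi`-periodic functions with the same
residues allows Cauchy's theorem to replace a residue computation. The half-width `3π/2` leaves room
around the closed rectangle `|Im w| ≤ π` and stops just at `3πi/2`, the next logarithm of `-i`. -/
theorem exists_pole_free_contourFun {α : ℝ} (hα : 0 < α) (hα1 : α ≤ 1) (σ : ℝ) :
    ∃ N : ℂ → ℂ, DifferentiableOn ℂ N strip ∧ ∀ w ∈ strip, w ≠ poleLog → w ≠ σ →
      N w = contourFun α σ w - resLow α σ * periodicPole (-Complex.I) w
        - resHigh α σ * periodicPole (Complex.exp σ) w := by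
  have hpi := Real.pi_pos
  set A : ℂ → ℂ := dslope (fun v : ℂ => Complex.exp (α * v)) poleLog with hA
  set B₀ : ℂ → ℂ := dslope (fun v : ℂ => Complex.exp ((1 : ℝ) * v)) poleLog with hB₀
  set B₁ : ℂ → ℂ := dslope (fun v : ℂ => Complex.exp ((1 : ℝ) * v)) (σ : ℂ) with hB₁
  have hA0 : ∀ w ∈ strip, A w ≠ 0 := fun w hw => by
    obtain ⟨h1, h2⟩ := abs_lt.1 (mem_strip.1 hw)
    exact dslope_exp_ne_zero hα hα1 (by rw [poleLog_im]; linarith) (by rw [poleLog_im]; linarith)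
  have hB₀0 : ∀ w ∈ strip, B₀ w ≠ 0 := fun w hw => by
    obtain ⟨h1, h2⟩ := abs_lt.1 (mem_strip.1 hw)
    exact dslope_exp_ne_zero one_pos le_rfl (by rw [poleLog_im]; linarith)
      (by rw [poleLog_im]; linarith)
  have hB₁0 : ∀ w ∈ strip, B₁ w ≠ 0 := fun w hw => by
    obtain ⟨h1, h2⟩ := abs_lt.1 (mem_strip.1 hw)
    exact dslope_exp_ne_zero one_pos le_rfl (by rw [Complex.ofReal_im]; linarith)
      (by rw [Complex.ofReal_im]; linarith)
  have eA : ∀ w, Complex.exp (α * w) - phase α = (w - poleLog) * A w := fun w => by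
    have := sub_smul_dslope (fun v : ℂ => Complex.exp (α * v)) poleLog w
    rw [← exp_mul_poleLog]; exact this.symm
  have eB₀ : ∀ w, Complex.exp w - -Complex.I = (w - poleLog) * B₀ w := fun w => by
    have := sub_smul_dslope (fun v : ℂ => Complex.exp ((1 : ℝ) * v)) poleLog w
    simp only [Complex.ofReal_one, one_mul, exp_poleLog] at this
    rw [← this]; simp [hB₀]
  have eB₁ : ∀ w, Complex.exp w - Complex.exp σ = (w - σ) * B₁ w := fun w => by
    have := sub_smul_dslope (fun v : ℂ => Complex.exp ((1 : ℝ) * v)) (σ : ℂ) w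
    simp only [Complex.ofReal_one, one_mul] at this
    rw [← this]; simp [hB₁]
  have dA : Differentiable ℂ A := differentiable_dslope_exp α _
  have dB₀ : Differentiable ℂ B₀ := differentiable_dslope_exp 1 _
  have dB₁ : Differentiable ℂ B₁ := differentiable_dslope_exp 1 _
  have hne : (σ : ℂ) ≠ poleLog := fun h => by
    have := congrArg Complex.im h
    rw [poleLog_im, Complex.ofReal_im] at this
    linarith
  have hα' : (α : ℂ) ≠ 0 := by exact_mod_cast hα.ne'
  -- `M` is the difference multiplied by `(w - poleLog)(w - σ)`. It is holomorphic, and the residues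
  -- are exactly the constants that make it vanish at both poles, so two successive `dslope`s divide
  -- the factors out again.
  set M : ℂ → ℂ := fun w => Complex.exp (α * w) / (A w * B₁ w)
    - resLow α σ * (Complex.exp w * (w - σ) / B₀ w)
    - resHigh α σ * (Complex.exp w * (w - poleLog) / B₁ w) with hM
  have dM : DifferentiableOn ℂ M strip := by
    refine ((DifferentiableOn.div (by fun_prop) (dA.mul dB₁).differentiableOn
      fun w hw => mul_ne_zero (hA0 w hw) (hB₁0 w hw)).sub
      ((DifferentiableOn.div (by fun_prop) dB₀.differentiableOn hB₀0).const_mul _)).sub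
      ((DifferentiableOn.div (by fun_prop) dB₁.differentiableOn hB₁0).const_mul _)
  have hlow : M poleLog = 0 := by
    have hAe : A poleLog = α * phase α := by rw [hA, dslope_exp_same, exp_mul_poleLog]
    have hBe : B₀ poleLog = -Complex.I := by
      rw [hB₀, dslope_exp_same]; simp [exp_poleLog]
    have hph : phase α ≠ 0 := Complex.exp_ne_zero _
    have hB := eB₁ poleLog
    rw [exp_poleLog] at hB
    have hBn := hB₁0 _ poleLog_mem_strip
    have hd : (-Complex.I - Complex.exp σ) ≠ 0 := by
      rw [hB]; exact mul_ne_zero (sub_ne_zero.2 hne.symm) hBn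
    simp only [hM, hAe, hBe, exp_mul_poleLog, exp_poleLog, sub_self, mul_zero, zero_div, sub_zero,
      resLow, hB]
    have := sub_ne_zero.2 hne.symm
    field_simp
    simp
  have hhigh : M σ = 0 := by
    have hBe : B₁ σ = Complex.exp σ := by
      rw [hB₁, dslope_exp_same]; simp
    have hAe := eA σ
    have hAn := hA0 _ (ofReal_mem_strip σ)
    have := sub_ne_zero.2 hne
    have := Complex.exp_ne_zero σ
    simp only [hM, hBe, sub_self, mul_zero, zero_div, sub_zero, resHigh, hAe]
    field_simp
    simp
  refine ⟨dslope (dslope M poleLog) σ, ?_, ?_⟩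
  · rw [Complex.differentiableOn_dslope (isOpen_strip.mem_nhds (ofReal_mem_strip σ)),
      Complex.differentiableOn_dslope (isOpen_strip.mem_nhds poleLog_mem_strip)]
    exact dM
  · intro w hw hw0 hw1
    have h0 := sub_ne_zero.2 hw0
    have h1 := sub_ne_zero.2 hw1
    have z1 : dslope M poleLog σ = 0 := by
      rw [dslope_of_ne _ hne, slope_def_field, hlow, hhigh]; simp
    have hAn := hA0 w hw
    have hBn := hB₀0 w hw
    have hCn := hB₁0 w hw
    rw [dslope_of_ne _ hw1, slope_def_field, z1, sub_zero, dslope_of_ne _ hw0, slope_def_field,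
      hlow, sub_zero, contourFun, periodicPole, periodicPole, eA, eB₀, eB₁]
    simp only [hM]
    field_simp
    try ring

end

/-! ### The spectral density as the jump across the cut -/

section

/-- The spectral density of the relaxation function. -/
def kern (α r : ℝ) : ℂ :=
  (lowerPhase α - upperPhase α) / (2 * Real.pi * Complex.I) * (r ^ (α - 1) : ℝ) /
    (((r ^ α : ℝ) - lowerPhase α) * ((r ^ α : ℝ) - upperPhase α))

lemma norm_phase (α : ℝ) : ‖phase α‖ = 1 := by
  rw [phase, ← Complex.ofReal_neg, Complex.norm_exp_ofReal_mul_I]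

lemma norm_lowerPhase (α : ℝ) : ‖lowerPhase α‖ = 1 := by
  rw [lowerPhase, ← Complex.ofReal_neg, Complex.norm_exp_ofReal_mul_I]

lemma norm_upperPhase (α : ℝ) : ‖upperPhase α‖ = 1 := by
  rw [upperPhase, Complex.norm_exp_ofReal_mul_I]

lemma exp_sub_pi (x : ℂ) : Complex.exp (x - Real.pi * Complex.I) = -Complex.exp x := by
  rw [Complex.exp_sub, Complex.exp_pi_mul_I, div_neg, div_one]

lemma exp_add_pi (x : ℂ) : Complex.exp (x + Real.pi * Complex.I) = -Complex.exp x := by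
  rw [Complex.exp_add, Complex.exp_pi_mul_I]; simp

/-- Since `|x - 1| ≤ |x - z|`, also `|z - 1| ≤ 2|x - z|`. Writing `1 + x = 2 + (x - 1)` and using
`|z - 1| ≤ 2` gives `4 + 2 = 6`. -/
lemma norm_sub_unit_ge {z : ℂ} (hz : ‖z‖ = 1) {x : ℝ} (hx : 0 ≤ x) :
    ‖z - 1‖ * (1 + x) ≤ 6 * ‖(x : ℂ) - z‖ := by
  have h1 : |x - 1| ≤ ‖(x : ℂ) - z‖ := by
    have := abs_norm_sub_norm_le (x : ℂ) z
    rwa [hz, Complex.norm_real, Real.norm_of_nonneg hx] at this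
  have h2 : ‖z - 1‖ ≤ ‖(x : ℂ) - z‖ + |x - 1| := by
    have : z - 1 = -((x : ℂ) - z) + ((x - 1 : ℝ) : ℂ) := by push_cast; ring
    rw [this]
    refine (norm_add_le _ _).trans ?_
    rw [norm_neg, Complex.norm_real, Real.norm_eq_abs]
  have h3 : ‖z - 1‖ ≤ 2 := by
    calc ‖z - 1‖ ≤ ‖z‖ + ‖(1 : ℂ)‖ := norm_sub_le _ _
      _ = 2 := by rw [hz]; norm_num
  have h4 := (abs_le.1 h1).2
  nlinarith [norm_nonneg (z - 1), norm_nonneg ((x : ℂ) - z)]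

lemma exp_neg_mul_I_ne_one {x : ℝ} (hx : 0 < x) (hx1 : x < 2 * Real.pi) :
    Complex.exp (x * Complex.I) ≠ 1 := by
  intro h
  obtain ⟨n, hn⟩ := Complex.exp_eq_one_iff.1 h
  have := congrArg Complex.im hn
  simp at this
  have h1 : (0 : ℝ) < n := by
    by_contra hneg
    nlinarith [Real.pi_pos]
  have h2 : (n : ℝ) < 1 := by
    by_contra hneg
    nlinarith [Real.pi_pos]
  have h1' : 0 < n := by exact_mod_cast h1
  have h2' : n < 1 := by exact_mod_cast h2
  omega

/-- The angles `πα/2` and `3πα/2` of the two phases lie strictly between `0` and `2π`, so the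
denominator of `kern` has no zero on the cut. -/
lemma upperPhase_ne_one {α : ℝ} (hα : 0 < α) (hα1 : α ≤ 1) : upperPhase α ≠ 1 := by
  have := Real.pi_pos
  exact exp_neg_mul_I_ne_one (by positivity) (by nlinarith)

lemma lowerPhase_ne_one {α : ℝ} (hα : 0 < α) (hα1 : α ≤ 1) : lowerPhase α ≠ 1 := by
  have := Real.pi_pos
  intro h
  refine exp_neg_mul_I_ne_one (x := 3 * Real.pi * α / 2) (by positivity) (by nlinarith) ?_
  rw [lowerPhase, neg_mul, Complex.exp_neg, inv_eq_one] at h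
  exact h

lemma ofReal_sub_ne_zero {z : ℂ} (hz : ‖z‖ = 1) (hz1 : z ≠ 1) {x : ℝ} (hx : 0 ≤ x) :
    (x : ℂ) - z ≠ 0 := by
  intro h
  have := norm_sub_unit_ge hz hx
  rw [h, norm_zero, mul_zero] at this
  have h2 : 0 < ‖z - 1‖ := norm_pos_iff.2 (sub_ne_zero.2 hz1)
  nlinarith

lemma contourFun_jump {α : ℝ} (hα : 0 < α) (hα1 : α ≤ 1) (σ x : ℝ) :
    contourFun α σ (x - Real.pi * Complex.I) - contourFun α σ (x + Real.pi * Complex.I) =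
      2 * Real.pi * Complex.I * (Real.exp x • (kern α (Real.exp x) / (Real.exp x + Real.exp σ))) := by
  have hpow : ((Real.exp x ^ α : ℝ) : ℂ) = Complex.exp (α * x) := by
    rw [← Real.exp_mul]; push_cast; rw [mul_comm]
  have hpow1 : ((Real.exp x ^ (α - 1) : ℝ) : ℂ) = Complex.exp (α * x) / Complex.exp x := by
    rw [Real.rpow_sub_one (Real.exp_pos x).ne', ← Real.exp_mul]; push_cast; rw [mul_comm]
  have h1 : Complex.exp (α * (x - Real.pi * Complex.I)) =
      Complex.exp (α * x) * Complex.exp (-(α * Real.pi * Complex.I)) := by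
    rw [← Complex.exp_add]; congr 1; ring
  have h2 : Complex.exp (α * (x + Real.pi * Complex.I)) =
      Complex.exp (α * x) / Complex.exp (-(α * Real.pi * Complex.I)) := by
    rw [← Complex.exp_sub]; congr 1; ring
  have hE : Complex.exp (-(α * Real.pi * Complex.I)) ≠ 0 := Complex.exp_ne_zero _
  -- Factoring the rotation `E = e^{-iπα}` out of the denominators turns `phase` into `upperPhase`
  -- on the edge `Im w = -π` and into `lowerPhase` on the edge `Im w = π`. Their difference is the
  -- numerator of `kern`.
  have hu : phase α = upperPhase α * Complex.exp (-(α * Real.pi * Complex.I)) := by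
    rw [phase, upperPhase, ← Complex.exp_add]; congr 1; push_cast; ring
  have hl : lowerPhase α = phase α * Complex.exp (-(α * Real.pi * Complex.I)) := by
    rw [phase, lowerPhase, ← Complex.exp_add]; congr 1; push_cast; ring
  set E := Complex.exp (-(α * Real.pi * Complex.I))
  have hu0 : Complex.exp (α * x) - upperPhase α ≠ 0 := by
    rw [← hpow]; exact ofReal_sub_ne_zero (norm_upperPhase α) (upperPhase_ne_one hα hα1) (by positivity)
  have hl0 : Complex.exp (α * x) - lowerPhase α ≠ 0 := by
    rw [← hpow]; exact ofReal_sub_ne_zero (norm_lowerPhase α) (lowerPhase_ne_one hα hα1) (by positivity)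
  have hs : Complex.exp x + Complex.exp σ ≠ 0 := by
    have : (0 : ℝ) < Real.exp x + Real.exp σ := by positivity
    exact_mod_cast this.ne'
  have hex := Complex.exp_ne_zero (x : ℂ)
  rw [contourFun, contourFun, exp_sub_pi, exp_add_pi, h1, h2, kern, hpow, hpow1, Complex.real_smul]
  push_cast
  have e1 : Complex.exp (α * x) * E - phase α = E * (Complex.exp (α * x) - upperPhase α) := by
    rw [hu]; ring
  have e2 : Complex.exp (α * x) / E - phase α = (Complex.exp (α * x) - lowerPhase α) / E := by
    rw [hl]; field_simp
  rw [e1, e2]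
  have e3 : -Complex.exp (x : ℂ) - Complex.exp σ = -(Complex.exp x + Complex.exp σ) := by ring
  rw [e3]
  have hpi : (Real.pi : ℂ) ≠ 0 := by exact_mod_cast Real.pi_ne_zero
  have hI := Complex.I_ne_zero
  field_simp
  ring

lemma periodicPole_sub_pi (p : ℂ) (x : ℂ) :
    periodicPole p (x - Real.pi * Complex.I) = periodicPole p (x + Real.pi * Complex.I) := by
  rw [periodicPole, periodicPole, exp_sub_pi, exp_add_pi]

lemma norm_periodicPole_le {p w : ℂ} (h : Real.exp w.re < ‖p‖) :
    ‖periodicPole p w‖ ≤ Real.exp w.re / (‖p‖ - Real.exp w.re) := by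
  rw [periodicPole, norm_div, Complex.norm_exp]
  have h1 : ‖p‖ - Real.exp w.re ≤ ‖Complex.exp w - p‖ := by
    have := norm_sub_norm_le p (Complex.exp w)
    rwa [Complex.norm_exp, norm_sub_rev] at this
  have : 0 < ‖p‖ - Real.exp w.re := by linarith
  gcongr

lemma norm_periodicPole_sub_one_le {p w : ℂ} (h : ‖p‖ < Real.exp w.re) :
    ‖periodicPole p w - 1‖ ≤ ‖p‖ / (Real.exp w.re - ‖p‖) := by
  have h1 : Real.exp w.re - ‖p‖ ≤ ‖Complex.exp w - p‖ := by
    have := norm_sub_norm_le (Complex.exp w) p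
    rwa [Complex.norm_exp] at this
  have h0 : 0 < Real.exp w.re - ‖p‖ := by linarith
  have hne : Complex.exp w - p ≠ 0 := norm_pos_iff.1 (h0.trans_le h1)
  have : periodicPole p w - 1 = p / (Complex.exp w - p) := by
    rw [periodicPole]; field_simp; ring
  rw [this, norm_div]
  gcongr

/-- In this form the bounds on `periodicPole` show the decay: like `e^{α Re w}` on the left and like
`e^{-Re w}` on the right. -/
lemma contourFun_eq (α σ : ℝ) (w : ℂ) : contourFun α σ w =
    periodicPole (phase α) (α * w) * (periodicPole (Complex.exp σ) w / Complex.exp w) := by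
  have := Complex.exp_ne_zero w
  rw [contourFun, periodicPole, periodicPole]
  field_simp

end

/-! ### The contour integral -/

section

lemma tendsto_exp_mul_atBot {a : ℝ} (ha : 0 < a) :
    Tendsto (fun X : ℝ => Real.exp (a * -X)) atTop (𝓝 0) :=
  Real.tendsto_exp_atBot.comp (tendsto_neg_atTop_atBot.const_mul_atBot ha)

lemma tendsto_exp_mul_atTop {a : ℝ} (ha : 0 < a) :
    Tendsto (fun X : ℝ => Real.exp (a * X)) atTop atTop :=
  Real.tendsto_exp_atTop.comp (tendsto_id.const_mul_atTop ha)

/-- As `Re w → ∞` the integrand decays while both periodic poles tend to `1`, so the pole-free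
function tends to minus the sum of the residues. The bound depends on `Re w` only, hence is uniform
along the vertical edge. -/
lemma exists_bound_right {α : ℝ} (hα : 0 < α) (σ : ℝ) :
    ∃ ε : ℝ → ℝ, Tendsto ε atTop (𝓝 0) ∧ ∀ᶠ X in atTop, ∀ w : ℂ, w.re = X →
      ‖contourFun α σ w - resLow α σ * periodicPole (-Complex.I) w
        - resHigh α σ * periodicPole (Complex.exp σ) w + (resLow α σ + resHigh α σ)‖ ≤ ε X := by
  have hs : ‖Complex.exp (σ : ℂ)‖ = Real.exp σ := by rw [Complex.norm_exp, Complex.ofReal_re]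
  have key : ∀ (a p : ℝ), 0 < a →
      Tendsto (fun X : ℝ => p / (Real.exp (a * X) - p)) atTop (𝓝 0) := fun a p ha =>
    tendsto_const_nhds.div_atTop (tendsto_atTop_add_const_right _ (-p) (tendsto_exp_mul_atTop ha))
  have kexp : Tendsto (fun X : ℝ => Real.exp (1 * -X)) atTop (𝓝 0) := tendsto_exp_mul_atBot one_pos
  refine ⟨fun X => (1 + 1 / (Real.exp (α * X) - 1)) *
      ((1 + Real.exp σ / (Real.exp (1 * X) - Real.exp σ)) * Real.exp (1 * -X)) +
      ‖resLow α σ‖ * (1 / (Real.exp (1 * X) - 1)) +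
      ‖resHigh α σ‖ * (Real.exp σ / (Real.exp (1 * X) - Real.exp σ)), ?_, ?_⟩
  · have h1 := key α 1 hα
    have h2 := key 1 (Real.exp σ) one_pos
    have h3 := key 1 1 one_pos
    have := (((h1.const_add 1).mul ((h2.const_add 1).mul kexp)).add
      (h3.const_mul ‖resLow α σ‖)).add (h2.const_mul ‖resHigh α σ‖)
    simpa using this
  · filter_upwards [eventually_gt_atTop 0, eventually_gt_atTop σ] with X hX hXσ w hw
    have n1 : ‖periodicPole (phase α) (α * w) - 1‖ ≤ 1 / (Real.exp (α * X) - 1) := by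
      have h := norm_periodicPole_sub_one_le (p := phase α) (w := α * w)
        (by rw [norm_phase, Complex.re_ofReal_mul, hw]; exact Real.one_lt_exp_iff.2 (by positivity))
      rwa [norm_phase, Complex.re_ofReal_mul, hw] at h
    have n2 : ‖periodicPole (Complex.exp σ) w - 1‖ ≤
        Real.exp σ / (Real.exp (1 * X) - Real.exp σ) := by
      have h := norm_periodicPole_sub_one_le (p := Complex.exp σ) (w := w)
        (by rw [hs, hw]; exact Real.exp_lt_exp.2 hXσ)
      rwa [hs, hw, ← one_mul X] at h
    have n3 : ‖periodicPole (-Complex.I) w - 1‖ ≤ 1 / (Real.exp (1 * X) - 1) := by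
      have h := norm_periodicPole_sub_one_le (p := -Complex.I) (w := w)
        (by rw [hw]; simpa using hX)
      rw [hw] at h
      simpa using h
    have one_add : ∀ {z : ℂ} {r : ℝ}, ‖z - 1‖ ≤ r → ‖z‖ ≤ 1 + r := fun {z r} h => by
      calc ‖z‖ = ‖1 + (z - 1)‖ := by congr 1; ring
        _ ≤ ‖(1 : ℂ)‖ + ‖z - 1‖ := norm_add_le _ _
        _ ≤ 1 + r := by rw [norm_one]; linarith
    have e : contourFun α σ w - resLow α σ * periodicPole (-Complex.I) w
        - resHigh α σ * periodicPole (Complex.exp σ) w + (resLow α σ + resHigh α σ) =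
        periodicPole (phase α) (α * w) * (periodicPole (Complex.exp σ) w / Complex.exp w)
        + -(resLow α σ * (periodicPole (-Complex.I) w - 1))
        + -(resHigh α σ * (periodicPole (Complex.exp σ) w - 1)) := by
      rw [contourFun_eq]; ring
    rw [e]
    refine (norm_add₃_le).trans ?_
    rw [norm_neg, norm_neg, norm_mul, norm_mul, norm_mul, norm_div, Complex.norm_exp w, hw,
      div_eq_mul_inv ‖periodicPole (Complex.exp σ) w‖, ← Real.exp_neg]
    have m1 := one_add n1
    have m2 := one_add n2
    have : 0 ≤ 1 + 1 / (Real.exp (α * X) - 1) := (norm_nonneg _).trans m1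
    have h2 : 0 ≤ 1 + Real.exp σ / (Real.exp (1 * X) - Real.exp σ) := (norm_nonneg _).trans m2
    gcongr
    rw [one_mul]

lemma exists_bound_left {α : ℝ} (hα : 0 < α) (σ : ℝ) :
    ∃ ε : ℝ → ℝ, Tendsto ε atTop (𝓝 0) ∧ ∀ᶠ X in atTop, ∀ w : ℂ, w.re = -X →
      ‖contourFun α σ w - resLow α σ * periodicPole (-Complex.I) w
        - resHigh α σ * periodicPole (Complex.exp σ) w‖ ≤ ε X := by
  have hs : ‖Complex.exp (σ : ℂ)‖ = Real.exp σ := by rw [Complex.norm_exp, Complex.ofReal_re]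
  have key : ∀ (a p : ℝ), 0 < a → 0 < p →
      Tendsto (fun X : ℝ => Real.exp (a * -X) / (p - Real.exp (a * -X))) atTop (𝓝 0) :=
      fun a p ha hp => by
    have h := tendsto_exp_mul_atBot ha
    simpa [Pi.div_def] using h.div (h.const_sub p) (by simpa using hp.ne')
  have key2 : ∀ (p : ℝ), 0 < p →
      Tendsto (fun X : ℝ => 1 / (p - Real.exp (1 * -X))) atTop (𝓝 (1 / p)) := fun p hp => by
    have h := tendsto_exp_mul_atBot one_pos
    simpa [Pi.div_def] using
      (tendsto_const_nhds (x := (1 : ℝ))).div (h.const_sub p) (by simpa using hp.ne')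
  refine ⟨fun X => (Real.exp (α * -X) / (1 - Real.exp (α * -X))) *
      (1 / (Real.exp σ - Real.exp (1 * -X))) +
      ‖resLow α σ‖ * (Real.exp (1 * -X) / (1 - Real.exp (1 * -X))) +
      ‖resHigh α σ‖ * (Real.exp (1 * -X) / (Real.exp σ - Real.exp (1 * -X))), ?_, ?_⟩
  · have := (((key α 1 hα one_pos).mul (key2 _ (Real.exp_pos σ))).add
      ((key 1 1 one_pos one_pos).const_mul ‖resLow α σ‖)).add
      ((key 1 _ one_pos (Real.exp_pos σ)).const_mul ‖resHigh α σ‖)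
    simpa using this
  · filter_upwards [eventually_gt_atTop 0, eventually_gt_atTop (-σ)] with X hX hXσ w hw
    have n1 : ‖periodicPole (phase α) (α * w)‖ ≤ Real.exp (α * -X) / (1 - Real.exp (α * -X)) := by
      have h := norm_periodicPole_le (p := phase α) (w := α * w)
        (by rw [norm_phase, Complex.re_ofReal_mul, hw]; exact Real.exp_lt_one_iff.2 (by nlinarith))
      rwa [norm_phase, Complex.re_ofReal_mul, hw] at h
    have n2 : ‖periodicPole (Complex.exp σ) w‖ ≤
        Real.exp (1 * -X) / (Real.exp σ - Real.exp (1 * -X)) := by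
      have h := norm_periodicPole_le (p := Complex.exp σ) (w := w)
        (by rw [hs, hw]; exact Real.exp_lt_exp.2 (by linarith))
      rwa [hs, hw, ← one_mul (-X)] at h
    have n3 : ‖periodicPole (-Complex.I) w‖ ≤ Real.exp (1 * -X) / (1 - Real.exp (1 * -X)) := by
      have h := norm_periodicPole_le (p := -Complex.I) (w := w)
        (by rw [hw]; simpa using hX)
      rw [hw] at h
      simpa using h
    have n4 : ‖periodicPole (Complex.exp σ) w / Complex.exp w‖ ≤
        1 / (Real.exp σ - Real.exp (1 * -X)) := by
      rw [norm_div, Complex.norm_exp w, hw, div_le_iff₀ (Real.exp_pos _)]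
      rw [one_mul] at n2 ⊢
      calc _ ≤ _ := n2
        _ = _ := by ring
    rw [contourFun_eq]
    refine (norm_sub_le _ _).trans (add_le_add ((norm_sub_le _ _).trans (add_le_add ?_ ?_)) ?_)
    · rw [norm_mul]
      have : 0 ≤ Real.exp (α * -X) / (1 - Real.exp (α * -X)) := (norm_nonneg _).trans n1
      gcongr
    · rw [norm_mul]; gcongr
    · rw [norm_mul]; gcongr

/-- Cauchy's theorem for the pole-free function on `[-X, X] × [-π, π]`. The horizontal edges see
only the jump, the left edge disappears in the limit, and the right edge, of length `2π`, supplies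
the residues. -/
theorem tendsto_integral_contourFun_jump {α : ℝ} (hα : 0 < α) (hα1 : α ≤ 1) (σ : ℝ) :
    Tendsto (fun X : ℝ => ∫ x in -X..X, (contourFun α σ (x - Real.pi * Complex.I) -
      contourFun α σ (x + Real.pi * Complex.I))) atTop
      (𝓝 (2 * Real.pi * Complex.I * (resLow α σ + resHigh α σ))) := by
  obtain ⟨N, hN, hNe⟩ := exists_pole_free_contourFun hα hα1 σ
  obtain ⟨ε, hε, hεb⟩ := exists_bound_right hα σ
  obtain ⟨δ, hδ, hδb⟩ := exists_bound_left hα σ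
  have hpi := Real.pi_pos
  have hmem : ∀ x y : ℝ, |y| ≤ Real.pi → ((x : ℂ) + y * Complex.I) ∈ strip := fun x y hy => by
    rw [mem_strip]; simp; linarith
  have hre : ∀ x y : ℝ, ((x : ℂ) + y * Complex.I).re = x := fun x y => by simp
  have him : ∀ x y : ℝ, ((x : ℂ) + y * Complex.I).im = y := fun x y => by simp
  have hne : ∀ x y : ℝ, (|y| = Real.pi ∨ (x ≠ 0 ∧ x ≠ σ)) →
      ((x : ℂ) + y * Complex.I) ≠ poleLog ∧ ((x : ℂ) + y * Complex.I) ≠ σ := fun x y h => by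
    constructor
    · intro he
      have h1 := congrArg Complex.re he
      have h2 := congrArg Complex.im he
      rw [hre, poleLog_re] at h1
      rw [him, poleLog_im] at h2
      rcases h with h | h
      · rw [h2, abs_neg, abs_of_pos (by positivity)] at h; linarith
      · exact h.1 h1
    · intro he
      have h1 := congrArg Complex.re he
      have h2 := congrArg Complex.im he
      rw [hre, Complex.ofReal_re] at h1
      rw [him, Complex.ofReal_im] at h2
      rcases h with h | h
      · rw [h2, abs_zero] at h; linarith
      · exact h.2 h1
  have hcontx : ∀ y : ℝ, |y| ≤ Real.pi →
      Continuous fun x : ℝ => N ((x : ℂ) + y * Complex.I) := fun y hy =>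
    hN.continuousOn.comp_continuous (by fun_prop) fun x => hmem x y hy
  have hpiabs : |Real.pi| ≤ Real.pi := (abs_of_pos hpi).le
  have hnpiabs : |-Real.pi| ≤ Real.pi := by rw [abs_neg]; exact hpiabs
  -- The subtracted poles are `2πi`-periodic and cancel between the two horizontal edges.
  have hjump : ∀ x : ℝ, contourFun α σ (x - Real.pi * Complex.I) -
      contourFun α σ (x + Real.pi * Complex.I) =
      N ((x : ℂ) + (-Real.pi : ℝ) * Complex.I) - N ((x : ℂ) + (Real.pi : ℝ) * Complex.I) := by
    intro x
    obtain ⟨a1, a2⟩ := hne x (-Real.pi) (Or.inl (by rw [abs_neg, abs_of_pos hpi]))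
    obtain ⟨b1, b2⟩ := hne x Real.pi (Or.inl (abs_of_pos hpi))
    rw [hNe _ (hmem x _ hnpiabs) a1 a2, hNe _ (hmem x _ hpiabs) b1 b2]
    have : (x : ℂ) + (-Real.pi : ℝ) * Complex.I = x - Real.pi * Complex.I := by push_cast; ring
    rw [this, periodicPole_sub_pi, periodicPole_sub_pi]
    ring
  have hrect : ∀ X : ℝ, ∫ x in -X..X, (contourFun α σ (x - Real.pi * Complex.I) -
      contourFun α σ (x + Real.pi * Complex.I)) =
      Complex.I * (∫ y in -Real.pi..Real.pi, N (((-X : ℝ) : ℂ) + y * Complex.I)) -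
      Complex.I * (∫ y in -Real.pi..Real.pi, N ((X : ℂ) + y * Complex.I)) := by
    intro X
    have hsub : (uIcc (-X) X ×ℂ uIcc (-Real.pi) Real.pi) ⊆ strip := by
      intro w hw
      have := (Complex.mem_reProdIm.1 hw).2
      rw [uIcc_of_le (by linarith)] at this
      rw [mem_strip]
      have := abs_le.2 this
      linarith
    have h := Complex.integral_boundary_rect_eq_zero_of_differentiableOn N
      ⟨-X, -Real.pi⟩ ⟨X, Real.pi⟩ (hN.mono hsub)
    simp only [smul_eq_mul] at h
    simp_rw [hjump]
    rw [intervalIntegral.integral_sub ((hcontx _ hnpiabs).intervalIntegrable _ _)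
      ((hcontx _ hpiabs).intervalIntegrable _ _)]
    linear_combination h
  simp_rw [hrect]
  have hleft : Tendsto (fun X : ℝ => ∫ y in -Real.pi..Real.pi, N (((-X : ℝ) : ℂ) + y * Complex.I))
      atTop (𝓝 0) := by
    have hb : Tendsto (fun X => δ X * |Real.pi - -Real.pi|) atTop (𝓝 0) := by
      simpa using hδ.mul_const |Real.pi - -Real.pi|
    refine squeeze_zero_norm' ?_ hb
    filter_upwards [hδb, eventually_gt_atTop 0, eventually_gt_atTop (-σ)] with X hX hX0 hXσ
    refine intervalIntegral.norm_integral_le_of_norm_le_const fun y hy => ?_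
    rw [uIoc_of_le (by linarith)] at hy
    obtain ⟨a1, a2⟩ := hne (-X) y (Or.inr ⟨by linarith, by linarith⟩)
    rw [hNe _ (hmem _ y (abs_le.2 ⟨hy.1.le, hy.2⟩)) a1 a2]
    exact hX _ (hre _ _)
  have hright : Tendsto (fun X : ℝ => ∫ y in -Real.pi..Real.pi, N ((X : ℂ) + y * Complex.I))
      atTop (𝓝 (-(2 * Real.pi * (resLow α σ + resHigh α σ)))) := by
    rw [← tendsto_sub_nhds_zero_iff]
    have hb : Tendsto (fun X => ε X * |Real.pi - -Real.pi|) atTop (𝓝 0) := by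
      simpa using hε.mul_const |Real.pi - -Real.pi|
    refine squeeze_zero_norm' ?_ hb
    filter_upwards [hεb, eventually_gt_atTop 0, eventually_gt_atTop σ] with X hX hX0 hXσ
    have hcy : IntervalIntegrable (fun y : ℝ => N ((X : ℂ) + y * Complex.I)) volume
        (-Real.pi) Real.pi := by
      refine ContinuousOn.intervalIntegrable (hN.continuousOn.comp (by fun_prop) fun y hy => ?_)
      rw [uIcc_of_le (by linarith)] at hy
      exact hmem _ y (abs_le.2 hy)
    have e : (∫ y in -Real.pi..Real.pi, N ((X : ℂ) + y * Complex.I)) -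
        -(2 * Real.pi * (resLow α σ + resHigh α σ)) =
        ∫ y in -Real.pi..Real.pi, (N ((X : ℂ) + y * Complex.I) + (resLow α σ + resHigh α σ)) := by
      rw [intervalIntegral.integral_add hcy (by simp), intervalIntegral.integral_const,
        Complex.real_smul]
      push_cast; ring
    rw [e]
    refine intervalIntegral.norm_integral_le_of_norm_le_const fun y hy => ?_
    rw [uIoc_of_le (by linarith)] at hy
    obtain ⟨a1, a2⟩ := hne X y (Or.inr ⟨by linarith, by linarith⟩)
    rw [hNe _ (hmem _ y (abs_le.2 ⟨hy.1.le, hy.2⟩)) a1 a2]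
    exact hX _ (hre _ _)
  have := (hleft.const_mul Complex.I).sub (hright.const_mul Complex.I)
  convert this using 2
  ring

end

/-! ### Bounds on the density, the Stieltjes transform and the relaxation function -/

section

lemma exists_norm_kern_le {α : ℝ} (hα : 0 < α) (hα1 : α ≤ 1) :
    ∃ C : ℝ, 0 < C ∧ ∀ r : ℝ, 0 < r → ‖kern α r‖ ≤ C * (r ^ (α - 1) / (1 + r ^ α) ^ 2) := by
  have hl : 0 < ‖lowerPhase α - 1‖ := norm_pos_iff.2 (sub_ne_zero.2 (lowerPhase_ne_one hα hα1))
  have hu : 0 < ‖upperPhase α - 1‖ := norm_pos_iff.2 (sub_ne_zero.2 (upperPhase_ne_one hα hα1))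
  set c := ‖(lowerPhase α - upperPhase α) / (2 * Real.pi * Complex.I)‖ with hc
  refine ⟨(c + 1) * (36 / (‖lowerPhase α - 1‖ * ‖upperPhase α - 1‖)), by positivity,
    fun r hr => ?_⟩
  have hra : 0 < r ^ α := Real.rpow_pos_of_pos hr _
  have hra1 : 0 < r ^ (α - 1) := Real.rpow_pos_of_pos hr _
  have h1 := norm_sub_unit_ge (norm_lowerPhase α) hra.le
  have h2 := norm_sub_unit_ge (norm_upperPhase α) hra.le
  have h3 : 0 < ‖((r ^ α : ℝ) : ℂ) - lowerPhase α‖ :=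
    norm_pos_iff.2 (ofReal_sub_ne_zero (norm_lowerPhase α) (lowerPhase_ne_one hα hα1) hra.le)
  have h4 : 0 < ‖((r ^ α : ℝ) : ℂ) - upperPhase α‖ :=
    norm_pos_iff.2 (ofReal_sub_ne_zero (norm_upperPhase α) (upperPhase_ne_one hα hα1) hra.le)
  rw [kern, norm_div, norm_mul, norm_mul, ← hc, Complex.norm_real, Real.norm_of_nonneg hra1.le,
    div_le_iff₀ (by positivity)]
  have h5 := mul_le_mul h1 h2 (by positivity) (by positivity)
  have h6 : 1 ≤ 36 / (‖lowerPhase α - 1‖ * ‖upperPhase α - 1‖) / (1 + r ^ α) ^ 2 *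
      (‖((r ^ α : ℝ) : ℂ) - lowerPhase α‖ * ‖((r ^ α : ℝ) : ℂ) - upperPhase α‖) := by
    rw [div_div, div_mul_eq_mul_div, one_le_div (by positivity)]
    linarith
  calc c * r ^ (α - 1) ≤ (c + 1) * r ^ (α - 1) * 1 := by
        rw [mul_one]; gcongr; linarith
    _ ≤ (c + 1) * r ^ (α - 1) * _ := mul_le_mul_of_nonneg_left h6 (by positivity)
    _ = _ := by ring

lemma kern_one (r : ℝ) : kern 1 r = 0 := by
  have : lowerPhase 1 = upperPhase 1 := by
    rw [lowerPhase, upperPhase, Complex.exp_eq_exp_iff_exists_int]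
    exact ⟨-1, by push_cast; ring⟩
  rw [kern, this]; simp

lemma continuousOn_kern {α : ℝ} (hα : 0 < α) (hα1 : α ≤ 1) : ContinuousOn (kern α) (Ioi 0) := by
  have hp : ∀ a : ℝ, ContinuousOn (fun r : ℝ => ((r ^ a : ℝ) : ℂ)) (Ioi 0) := fun a =>
    Complex.continuous_ofReal.comp_continuousOn
      (continuousOn_id.rpow_const fun x hx => Or.inl (ne_of_gt hx))
  refine ((continuousOn_const.mul (hp _)).div
    (((hp _).sub continuousOn_const).mul ((hp _).sub continuousOn_const)) fun r hr => ?_)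
  have hra : (0 : ℝ) ≤ r ^ α := Real.rpow_nonneg (le_of_lt hr) _
  exact mul_ne_zero (ofReal_sub_ne_zero (norm_lowerPhase α) (lowerPhase_ne_one hα hα1) hra)
    (ofReal_sub_ne_zero (norm_upperPhase α) (upperPhase_ne_one hα hα1) hra)

/-- The density is `O(r^{α-1})` at the origin and `O(r^{-α-1})` at infinity. -/
lemma integrableOn_kern {α : ℝ} (hα : 0 < α) (hα1 : α ≤ 1) : IntegrableOn (kern α) (Ioi 0) := by
  obtain ⟨C, hC, hCb⟩ := exists_norm_kern_le hα hα1
  rw [← Ioc_union_Ioi_eq_Ioi (zero_le_one (α := ℝ)), integrableOn_union]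
  constructor
  · have h1 : IntegrableOn (fun r : ℝ => C * r ^ (α - 1)) (Ioc 0 1) := by
      refine Integrable.const_mul ?_ C
      rw [← IntegrableOn, ← intervalIntegrable_iff_integrableOn_Ioc_of_le zero_le_one]
      exact intervalIntegral.intervalIntegrable_rpow' (by linarith)
    refine Integrable.mono' h1 (((continuousOn_kern hα hα1).mono
      Ioc_subset_Ioi_self).aestronglyMeasurable measurableSet_Ioc) ?_
    refine (ae_restrict_iff' measurableSet_Ioc).2 (ae_of_all _ fun r hr => (hCb r hr.1).trans ?_)
    have := Real.rpow_pos_of_pos hr.1 α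
    have h' := Real.rpow_pos_of_pos hr.1 (α - 1)
    gcongr
    exact div_le_self h'.le (one_le_pow₀ (by linarith))
  · have h1 : IntegrableOn (fun r : ℝ => C * r ^ (-α - 1)) (Ioi 1) :=
      (integrableOn_Ioi_rpow_of_lt (by linarith) one_pos).const_mul C
    refine Integrable.mono' h1 (((continuousOn_kern hα hα1).mono
      (Ioi_subset_Ioi zero_le_one)).aestronglyMeasurable measurableSet_Ioi) ?_
    refine (ae_restrict_iff' measurableSet_Ioi).2 (ae_of_all _ fun r hr => ?_)
    have hr0 : (0 : ℝ) < r := one_pos.trans hr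
    refine (hCb r hr0).trans ?_
    have := Real.rpow_pos_of_pos hr0 α
    have h' := Real.rpow_pos_of_pos hr0 (α - 1)
    have e : r ^ (-α - 1) = r ^ (α - 1) / (r ^ α) ^ 2 := by
      rw [← Real.rpow_natCast, ← Real.rpow_mul hr0.le, ← Real.rpow_sub hr0]; congr 1; push_cast; ring
    rw [e]
    gcongr
    linarith

/-- The Stieltjes representation of `s^{α-1} / (s^α - (-i)^α)`, with its pole split off. -/
theorem integral_kern_div {α : ℝ} (hα : 0 < α) (hα1 : α ≤ 1) {s : ℝ} (hs : 0 < s) :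
    (∫ r in Ioi (0 : ℝ), kern α r / (r + s)) =
      1 / (α * (-Complex.I - s)) + (s ^ (α - 1) : ℝ) / ((s ^ α : ℝ) - phase α) := by
  set σ := Real.log s with hσ
  have hes : Real.exp σ = s := Real.exp_log hs
  set G : ℝ → ℂ := fun r => kern α r / (r + s) with hG
  have hGi : IntegrableOn G (Ioi 0) := by
    have hk := integrableOn_kern hα hα1
    refine Integrable.mono' (g := fun r => ‖kern α r‖ * s⁻¹) (hk.norm.mul_const _) ?_ ?_
    · refine ContinuousOn.aestronglyMeasurable ?_ measurableSet_Ioi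
      refine (continuousOn_kern hα hα1).div (by fun_prop) fun r hr => ?_
      have : (0 : ℝ) < r + s := add_pos hr hs
      exact_mod_cast this.ne'
    · refine (ae_restrict_iff' measurableSet_Ioi).2 (ae_of_all _ fun r hr => ?_)
      have hr0 : (0 : ℝ) < r := hr
      have e : ‖(r : ℂ) + s‖ = r + s := by
        rw [← Complex.ofReal_add, Complex.norm_real, Real.norm_of_nonneg (by linarith)]
      rw [hG, norm_div, e, div_eq_mul_inv]
      gcongr
      linarith
  -- The substitution `r = e^x` returns to the logarithmic coordinate, where the integral is the
  -- limit of the jump integrals over `[-X, X]`.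
  have himg : Real.exp '' univ = Ioi 0 := by rw [image_univ, Real.range_exp]
  have hd : ∀ x ∈ (univ : Set ℝ), HasDerivWithinAt Real.exp (Real.exp x) univ x :=
    fun x _ => (Real.hasDerivAt_exp x).hasDerivWithinAt
  have hint : Integrable fun x : ℝ => Real.exp x • G (Real.exp x) := by
    have := (integrableOn_image_iff_integrableOn_abs_deriv_smul MeasurableSet.univ hd
      Real.exp_injective.injOn G).1 (by rwa [himg])
    simpa [Real.abs_exp] using this
  have heq : (∫ r in Ioi (0 : ℝ), G r) = ∫ x : ℝ, Real.exp x • G (Real.exp x) := by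
    have := integral_image_eq_integral_abs_deriv_smul MeasurableSet.univ hd
      Real.exp_injective.injOn G
    rw [himg] at this
    simpa [Real.abs_exp] using this
  have hlim := intervalIntegral_tendsto_integral hint tendsto_neg_atTop_atBot tendsto_id
  have hlim2 := tendsto_integral_contourFun_jump hα hα1 σ
  simp_rw [contourFun_jump hα hα1, intervalIntegral.integral_const_mul, hes] at hlim2
  have := tendsto_nhds_unique hlim2 (hlim.const_mul (2 * Real.pi * Complex.I))
  have h2 : (2 * Real.pi * Complex.I : ℂ) ≠ 0 := Complex.two_pi_I_ne_zero
  have h3 := mul_left_cancel₀ h2 this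
  rw [heq, ← h3, resLow, resHigh]
  have e1 : Complex.exp (σ : ℂ) = s := by rw [← Complex.ofReal_exp, hes]
  have e2 : Complex.exp (α * σ : ℂ) = (s ^ α : ℝ) := by
    rw [← hes, ← Real.exp_mul]; push_cast; rw [mul_comm]
  rw [e1, e2, Real.rpow_sub_one hs.ne', Complex.ofReal_div]
  congr 1
  rw [div_div, mul_comm]

/-- The relaxation function, the Mittag-Leffler function `E_α((-iτ)^α)` for `τ ≥ 0`. -/
def relax (α τ : ℝ) : ℂ :=
  1 / α * Complex.exp (-(τ * Complex.I)) + ∫ r in Ioi (0 : ℝ), kern α r * Real.exp (-(r * τ))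

/-- Minus the derivative of the non-oscillating part of `relax`. -/
def relaxRem (α τ : ℝ) : ℂ := ∫ r in Ioi (0 : ℝ), r * kern α r * Real.exp (-(r * τ))

/-- The derivative of `relax`. -/
def relaxDeriv (α τ : ℝ) : ℂ :=
  -(Complex.I / α) * Complex.exp (-(τ * Complex.I)) - relaxRem α τ

lemma aestronglyMeasurable_kern {α : ℝ} (hα : 0 < α) (hα1 : α ≤ 1) :
    AEStronglyMeasurable (kern α) (volume.restrict (Ioi 0)) :=
  (continuousOn_kern hα hα1).aestronglyMeasurable measurableSet_Ioi

lemma norm_kern_mul_exp_le (α : ℝ) {r τ : ℝ} (hr : 0 ≤ r) (hτ : 0 ≤ τ) :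
    ‖kern α r * Real.exp (-(r * τ))‖ ≤ ‖kern α r‖ := by
  rw [norm_mul, Complex.norm_real, Real.norm_of_nonneg (Real.exp_pos _).le]
  exact mul_le_of_le_one_right (norm_nonneg _) (Real.exp_le_one_iff.2 (by nlinarith))

lemma mul_exp_neg_le {r τ : ℝ} (hτ : 0 < τ) : r * Real.exp (-(r * τ)) ≤ τ⁻¹ := by
  have h := Real.add_one_le_exp (r * τ)
  rw [Real.exp_neg, ← div_eq_mul_inv, div_le_iff₀ (Real.exp_pos _)]
  have : r = τ⁻¹ * (r * τ) := by field_simp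
  calc r = τ⁻¹ * (r * τ) := this
    _ ≤ _ := by gcongr; linarith

lemma norm_mul_kern_mul_exp_le (α : ℝ) {r τ : ℝ} (hr : 0 ≤ r) (hτ : 0 < τ) :
    ‖r * kern α r * Real.exp (-(r * τ))‖ ≤ ‖kern α r‖ * τ⁻¹ := by
  rw [norm_mul, norm_mul, Complex.norm_real, Complex.norm_real, Real.norm_of_nonneg hr,
    Real.norm_of_nonneg (Real.exp_pos _).le]
  have := mul_exp_neg_le (r := r) hτ
  calc r * ‖kern α r‖ * Real.exp (-(r * τ)) = ‖kern α r‖ * (r * Real.exp (-(r * τ))) := by ring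
    _ ≤ _ := by gcongr

lemma norm_exp_neg_mul_I (τ : ℝ) : ‖Complex.exp (-(τ * Complex.I))‖ = 1 := by
  rw [← neg_mul, ← Complex.ofReal_neg, Complex.norm_exp_ofReal_mul_I]

lemma continuousOn_relax {α : ℝ} (hα : 0 < α) (hα1 : α ≤ 1) : ContinuousOn (relax α) (Ici 0) := by
  refine ContinuousOn.add (by fun_prop) ?_
  refine continuousOn_of_dominated (bound := fun r => ‖kern α r‖) (fun τ _ => ?_) (fun τ hτ => ?_)
    (integrableOn_kern hα hα1).norm ?_
  · exact (aestronglyMeasurable_kern hα hα1).mul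
      (Continuous.aestronglyMeasurable (by fun_prop))
  · exact (ae_restrict_iff' measurableSet_Ioi).2
      (ae_of_all _ fun r hr => norm_kern_mul_exp_le α (le_of_lt hr) hτ)
  · exact ae_of_all _ fun r => by fun_prop

lemma exists_norm_relax_le {α : ℝ} (hα : 0 < α) (hα1 : α ≤ 1) :
    ∃ C : ℝ, 0 < C ∧ ∀ τ : ℝ, 0 ≤ τ → ‖relax α τ‖ ≤ C := by
  refine ⟨1 / α + ∫ r in Ioi (0 : ℝ), ‖kern α r‖, ?_, fun τ hτ => ?_⟩
  · have : 0 ≤ ∫ r in Ioi (0 : ℝ), ‖kern α r‖ := integral_nonneg fun _ => norm_nonneg _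
    positivity
  · refine (norm_add_le _ _).trans (add_le_add ?_ ?_)
    · rw [norm_mul, norm_exp_neg_mul_I, mul_one, norm_div, norm_one, Complex.norm_real,
        Real.norm_of_nonneg hα.le]
    · refine norm_integral_le_of_norm_le (integrableOn_kern hα hα1).norm ?_
      exact (ae_restrict_iff' measurableSet_Ioi).2
        (ae_of_all _ fun r hr => norm_kern_mul_exp_le α (le_of_lt hr) hτ)

lemma hasDerivAt_relax {α : ℝ} (hα : 0 < α) (hα1 : α ≤ 1) {τ : ℝ} (hτ : 0 < τ) :
    HasDerivAt (relax α) (relaxDeriv α τ) τ := by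
  have h1 : HasDerivAt (fun τ : ℝ => 1 / (α : ℂ) * Complex.exp (-(τ * Complex.I)))
      (-(Complex.I / α) * Complex.exp (-(τ * Complex.I))) τ := by
    have := (((Complex.ofRealCLM.hasDerivAt (x := τ)).mul_const Complex.I).neg.cexp).const_mul
      (1 / (α : ℂ))
    refine this.congr_deriv ?_
    simp; ring
  have h2 := hasDerivAt_integral_of_dominated_loc_of_deriv_le (μ := volume.restrict (Ioi (0 : ℝ)))
    (F := fun τ r => kern α r * Real.exp (-(r * τ)))
    (F' := fun τ r => -(r * kern α r * Real.exp (-(r * τ)))) (x₀ := τ)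
    -- Since `r e^{-rt} ≤ 1/t`, the extra factor `r` costs at most `2/τ` for `t > τ/2`, and `kern`
    -- alone is integrable.
    (s := Ioi (τ / 2)) (bound := fun r => ‖kern α r‖ * (τ / 2)⁻¹) (Ioi_mem_nhds (by linarith))
    (Eventually.of_forall fun t => (aestronglyMeasurable_kern hα hα1).mul
      (Continuous.aestronglyMeasurable (by fun_prop)))
    ?_ ?_ ?_ ((integrableOn_kern hα hα1).norm.mul_const _) ?_
  · have := h1.add h2.2
    refine this.congr_deriv ?_
    rw [relaxDeriv, relaxRem, integral_neg, sub_eq_add_neg]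
  · refine Integrable.mono (integrableOn_kern hα hα1) ((aestronglyMeasurable_kern hα hα1).mul
      (Continuous.aestronglyMeasurable (by fun_prop))) ?_
    exact (ae_restrict_iff' measurableSet_Ioi).2
        (ae_of_all _ fun r hr => norm_kern_mul_exp_le α (le_of_lt hr) hτ.le)
  · refine AEStronglyMeasurable.neg (AEStronglyMeasurable.mul (AEStronglyMeasurable.mul
      (Continuous.aestronglyMeasurable (by fun_prop)) (aestronglyMeasurable_kern hα hα1))
      (Continuous.aestronglyMeasurable (by fun_prop)))
  · refine (ae_restrict_iff' measurableSet_Ioi).2 (ae_of_all _ fun r hr t ht => ?_)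
    have ht' : τ / 2 < t := ht
    rw [norm_neg]
    refine (norm_mul_kern_mul_exp_le α (le_of_lt hr) (by linarith : 0 < t)).trans ?_
    gcongr
  · refine ae_of_all _ fun r t _ => ?_
    have := ((((hasDerivAt_id t).const_mul r).neg.exp).ofReal_comp).const_mul (kern α r)
    refine this.congr_deriv ?_
    simp; ring

/-- The bound `1/τ` uses only `r e^{-rτ} ≤ 1/τ`. The bound `τ^{α-1}` uses `r |kern α r| ≤ C r^{-α}`
and a Gamma integral; it is better for small `τ`. For `α = 1` the density vanishes and `Γ(1 - α)` is
unavailable, hence the separate case. -/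
lemma exists_norm_relaxRem_le {α : ℝ} (hα : 0 < α) (hα1 : α ≤ 1) :
    ∃ C : ℝ, 0 < C ∧ ∀ τ : ℝ, 0 < τ →
      ‖relaxRem α τ‖ ≤ C * τ⁻¹ ∧ ‖relaxRem α τ‖ ≤ C * τ ^ (α - 1) := by
  have hA : ∀ τ : ℝ, 0 < τ → ‖relaxRem α τ‖ ≤ (∫ r in Ioi (0 : ℝ), ‖kern α r‖) * τ⁻¹ := by
    intro τ hτ
    rw [← integral_mul_const]
    refine norm_integral_le_of_norm_le ((integrableOn_kern hα hα1).norm.mul_const _) ?_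
    exact (ae_restrict_iff' measurableSet_Ioi).2
      (ae_of_all _ fun r hr => norm_mul_kern_mul_exp_le α (le_of_lt hr) hτ)
  have hA0 : 0 ≤ ∫ r in Ioi (0 : ℝ), ‖kern α r‖ := integral_nonneg fun _ => norm_nonneg _
  rcases hα1.lt_or_eq with hlt | rfl
  · obtain ⟨C, hC, hCb⟩ := exists_norm_kern_le hα hα1
    have hG : 0 < Real.Gamma (1 - α) := Real.Gamma_pos_of_pos (by linarith)
    refine ⟨(∫ r in Ioi (0 : ℝ), ‖kern α r‖) + C * Real.Gamma (1 - α), by positivity,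
      fun τ hτ => ⟨(hA τ hτ).trans ?_, ?_⟩⟩
    · gcongr
      have : 0 < C * Real.Gamma (1 - α) := by positivity
      linarith
    · have hint := Real.integral_rpow_mul_exp_neg_mul_Ioi (a := 1 - α) (by linarith) hτ
      have hI : IntegrableOn (fun r : ℝ => r ^ (1 - α - 1) * Real.exp (-(τ * r))) (Ioi 0) := by
        -- The Bochner integral of a non-integrable function is `0`, whereas the Gamma formula gives
        -- a positive value.
        by_contra hcon
        rw [integral_undef hcon] at hint
        have : 0 < (1 / τ) ^ (1 - α) * Real.Gamma (1 - α) := by positivity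
        linarith
      have hb : ‖relaxRem α τ‖ ≤
          ∫ r in Ioi (0 : ℝ), C * (r ^ (1 - α - 1) * Real.exp (-(τ * r))) := by
        refine norm_integral_le_of_norm_le (hI.const_mul C) ?_
        refine (ae_restrict_iff' measurableSet_Ioi).2 (ae_of_all _ fun r hr => ?_)
        have hr0 : (0 : ℝ) < r := hr
        have hra := Real.rpow_pos_of_pos hr0 α
        have hra1 := Real.rpow_pos_of_pos hr0 (α - 1)
        rw [norm_mul, norm_mul, Complex.norm_real, Complex.norm_real, Real.norm_of_nonneg hr0.le,
          Real.norm_of_nonneg (Real.exp_pos _).le, mul_comm r τ, ← mul_assoc]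
        refine mul_le_mul_of_nonneg_right ?_ (Real.exp_pos _).le
        have e : r ^ (1 - α - 1) = r * (r ^ (α - 1) / (r ^ α) ^ 2) := by
          rw [Real.rpow_sub_one hr0.ne' α, ← Real.rpow_natCast, ← Real.rpow_mul hr0.le]
          have : r ^ (1 - α - 1) = r ^ α / r ^ (α * (2 : ℕ)) := by
            rw [← Real.rpow_sub hr0]; congr 1; push_cast; ring
          rw [this]; field_simp
        calc r * ‖kern α r‖ ≤ r * (C * (r ^ (α - 1) / (1 + r ^ α) ^ 2)) := by
              gcongr; exact hCb r hr0
          _ = C * (r * (r ^ (α - 1) / (1 + r ^ α) ^ 2)) := by ring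
          _ ≤ C * r ^ (1 - α - 1) := by
              rw [e]; gcongr; linarith
      rw [integral_const_mul, hint] at hb
      refine hb.trans ?_
      have e : (1 / τ) ^ (1 - α) = τ ^ (α - 1) := by
        rw [one_div, Real.inv_rpow hτ.le, ← Real.rpow_neg hτ.le]; congr 1; ring
      rw [e]
      have := Real.rpow_pos_of_pos hτ (α - 1)
      nlinarith [mul_nonneg hA0 this.le]
  · refine ⟨1, one_pos, fun τ hτ => ?_⟩
    have : relaxRem 1 τ = 0 := by simp [relaxRem, kern_one]
    rw [this, norm_zero]
    constructor <;> positivity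

/-- Multiplying the Stieltjes formula by `s` and letting `s → ∞` gives the total mass of `kern` on
the left and `-1/α + 1` on the right. -/
lemma relax_zero {α : ℝ} (hα : 0 < α) (hα1 : α ≤ 1) : relax α 0 = 1 := by
  have hk := integrableOn_kern hα hα1
  have hα' : (α : ℂ) ≠ 0 := by exact_mod_cast hα.ne'
  have h1 : Tendsto (fun s : ℝ => ∫ r in Ioi (0 : ℝ), kern α r * ((s / (r + s) : ℝ) : ℂ)) atTop
      (𝓝 (∫ r in Ioi (0 : ℝ), kern α r * ((1 : ℝ) : ℂ))) := by
    refine tendsto_integral_filter_of_dominated_convergence (fun r => ‖kern α r‖) ?_ ?_ hk.norm ?_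
    · exact Eventually.of_forall fun s => (aestronglyMeasurable_kern hα hα1).mul
        (Measurable.aestronglyMeasurable (by fun_prop))
    · filter_upwards [eventually_gt_atTop 0] with s hs
      refine (ae_restrict_iff' measurableSet_Ioi).2 (ae_of_all _ fun r hr => ?_)
      have hr0 : (0 : ℝ) < r := hr
      rw [norm_mul, Complex.norm_real, Real.norm_of_nonneg (by positivity)]
      exact mul_le_of_le_one_right (norm_nonneg _) ((div_le_one (by positivity)).2 (by linarith))
    · refine (ae_restrict_iff' measurableSet_Ioi).2 (ae_of_all _ fun r hr => ?_)
      refine Tendsto.const_mul _ ((Complex.continuous_ofReal.tendsto _).comp ?_)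
      have : Tendsto (fun s : ℝ => 1 - r / (r + s)) atTop (𝓝 (1 - 0)) :=
        (tendsto_const_nhds.div_atTop (tendsto_atTop_add_const_left _ r tendsto_id)).const_sub 1
      rw [sub_zero] at this
      refine this.congr' ?_
      filter_upwards [eventually_gt_atTop 0] with s hs
      have hr0 : (0 : ℝ) < r := hr
      field_simp; ring
  have hinv : Tendsto (fun s : ℝ => (s : ℂ)⁻¹) atTop (𝓝 0) := by
    have := (Complex.continuous_ofReal.tendsto 0).comp tendsto_inv_atTop_zero
    simpa [Function.comp_def] using this
  have hinv2 : Tendsto (fun s : ℝ => ((s ^ α : ℝ) : ℂ)⁻¹) atTop (𝓝 0) := by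
    have := (Complex.continuous_ofReal.tendsto 0).comp
      (tendsto_inv_atTop_zero.comp (tendsto_rpow_atTop hα))
    simpa [Function.comp_def] using this
  have h2 : Tendsto (fun s : ℝ => 1 / (α * (-Complex.I * (s : ℂ)⁻¹ - 1)) +
      1 / (1 - phase α * ((s ^ α : ℝ) : ℂ)⁻¹)) atTop
      (𝓝 (1 / (α * (-Complex.I * 0 - 1)) + 1 / (1 - phase α * 0))) := by
    refine Tendsto.add (Tendsto.div tendsto_const_nhds
      (((hinv.const_mul _).sub_const 1).const_mul _) (by simpa using hα'))
      (Tendsto.div tendsto_const_nhds ((hinv2.const_mul _).const_sub 1) (by simp))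
  have h3 : (fun s : ℝ => ∫ r in Ioi (0 : ℝ), kern α r * ((s / (r + s) : ℝ) : ℂ)) =ᶠ[atTop]
      (fun s : ℝ => 1 / (α * (-Complex.I * (s : ℂ)⁻¹ - 1)) +
      1 / (1 - phase α * ((s ^ α : ℝ) : ℂ)⁻¹)) := by
    filter_upwards [eventually_gt_atTop 1] with s hs
    have hs0 : 0 < s := by linarith
    have hsc : (s : ℂ) ≠ 0 := by exact_mod_cast hs0.ne'
    have hsa : ((s ^ α : ℝ) : ℂ) ≠ 0 := by
      exact_mod_cast (Real.rpow_pos_of_pos hs0 α).ne'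
    have := integral_kern_div hα hα1 hs0
    calc (∫ r in Ioi (0 : ℝ), kern α r * ((s / (r + s) : ℝ) : ℂ))
        = s * ∫ r in Ioi (0 : ℝ), kern α r / (r + s) := by
          rw [← integral_const_mul]
          congr 1; ext r; push_cast; ring
      _ = _ := by
          rw [this, mul_add, Real.rpow_sub_one hs0.ne', Complex.ofReal_div]
          congr 1
          · have : -Complex.I * (s : ℂ)⁻¹ - 1 = (-Complex.I - s) / s := by field_simp
            rw [this]; field_simp
          · have : 1 - phase α * ((s ^ α : ℝ) : ℂ)⁻¹ = ((s ^ α : ℝ) - phase α) / (s ^ α : ℝ) := by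
              field_simp
            rw [this]; field_simp
  have h4 := tendsto_nhds_unique (h1.congr' h3) h2
  simp only [Complex.ofReal_one, mul_one] at h4
  rw [relax]
  simp only [Complex.ofReal_zero, zero_mul, neg_zero, Complex.exp_zero, mul_zero, Real.exp_zero,
    Complex.ofReal_one, mul_one]
  rw [h4]
  simp

end

/-! ### Uniqueness of Laplace transforms and integrability of power kernels -/

section

/-- With `x = e^{-t}` the hypothesis says that all moments vanish, and Weierstrass approximation
passes from polynomials to continuous functions on `[0, 1]`. The weight `e^{-t}` is kept aside
because `h` itself need not be integrable and only positive `s` are allowed. -/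
lemma integral_comp_exp_neg_eq_zero {h : ℝ → ℂ}
    (hi : IntegrableOn (fun t => (Real.exp (-t) : ℂ) * h t) (Ioi 0))
    (hz : ∀ s : ℝ, 0 < s → ∫ t in Ioi (0 : ℝ), (Real.exp (-(s * t)) : ℂ) * h t = 0)
    {F : ℝ → ℝ} (hF : ContinuousOn F (Icc 0 1)) :
    ∫ t in Ioi (0 : ℝ), (F (Real.exp (-t)) : ℂ) * ((Real.exp (-t) : ℂ) * h t) = 0 := by
  set k : ℝ → ℂ := fun t => (Real.exp (-t) : ℂ) * h t with hk
  have hmem : ∀ t ∈ Ioi (0 : ℝ), Real.exp (-t) ∈ Icc (0 : ℝ) 1 := fun t ht =>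
    ⟨(Real.exp_pos _).le, Real.exp_le_one_iff.2 (by simpa using le_of_lt ht)⟩
  have hmeas : ∀ G : ℝ → ℝ, ContinuousOn G (Icc 0 1) →
      IntegrableOn (fun t => (G (Real.exp (-t)) : ℂ) * k t) (Ioi 0) := fun G hG => by
    obtain ⟨C, hC⟩ := isCompact_Icc.exists_bound_of_continuousOn hG
    refine Integrable.bdd_mul (c := C) hi ?_ ?_
    · refine ContinuousOn.aestronglyMeasurable ?_ measurableSet_Ioi
      exact Complex.continuous_ofReal.comp_continuousOn (hG.comp (by fun_prop) hmem)
    · refine (ae_restrict_iff' measurableSet_Ioi).2 (ae_of_all _ fun t ht => ?_)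
      rw [Complex.norm_real]; exact hC _ (hmem t ht)
  have hpow : ∀ n : ℕ, ∫ t in Ioi (0 : ℝ), ((Real.exp (-t) ^ n : ℝ) : ℂ) * k t = 0 := fun n => by
    rw [← hz (n + 1) (by positivity)]
    congr 1; ext t
    rw [hk]; simp only
    rw [← mul_assoc, ← Complex.ofReal_mul, ← Real.exp_nat_mul, ← Real.exp_add]
    congr 3; ring
  have hpoly : ∀ p : Polynomial ℝ,
      ∫ t in Ioi (0 : ℝ), ((p.eval (Real.exp (-t)) : ℝ) : ℂ) * k t = 0 := fun p => by
    induction p using Polynomial.induction_on' with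
    | add p q hp hq =>
      simp_rw [Polynomial.eval_add, Complex.ofReal_add, add_mul]
      rw [integral_add (hmeas (fun x => p.eval x) p.continuous.continuousOn)
        (hmeas (fun x => q.eval x) q.continuous.continuousOn), hp, hq, add_zero]
    | monomial n a =>
      simp_rw [Polynomial.eval_monomial, Complex.ofReal_mul, mul_assoc]
      rw [integral_const_mul, hpow, mul_zero]
  set M := ∫ t in Ioi (0 : ℝ), ‖k t‖ with hM
  have hM0 : 0 ≤ M := integral_nonneg fun _ => norm_nonneg _
  refine norm_le_zero_iff.1 (le_of_forall_pos_le_add fun ε hε => ?_)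
  obtain ⟨p, hp⟩ := exists_polynomial_near_of_continuousOn 0 1 F hF (ε / (M + 1)) (by positivity)
  have e : ∫ t in Ioi (0 : ℝ), (F (Real.exp (-t)) : ℂ) * k t =
      ∫ t in Ioi (0 : ℝ), ((F (Real.exp (-t)) - p.eval (Real.exp (-t)) : ℝ) : ℂ) * k t := by
    simp_rw [Complex.ofReal_sub, sub_mul]
    rw [integral_sub (hmeas F hF) (hmeas (fun x => p.eval x) p.continuous.continuousOn), hpoly,
      sub_zero]
  rw [e]
  have : ‖∫ t in Ioi (0 : ℝ), ((F (Real.exp (-t)) - p.eval (Real.exp (-t)) : ℝ) : ℂ) * k t‖ ≤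
      ∫ t in Ioi (0 : ℝ), ε / (M + 1) * ‖k t‖ := by
    refine norm_integral_le_of_norm_le (hi.norm.const_mul _) ?_
    refine (ae_restrict_iff' measurableSet_Ioi).2 (ae_of_all _ fun t ht => ?_)
    rw [norm_mul, Complex.norm_real]
    gcongr
    have := (hp _ (hmem t ht)).le
    rwa [abs_sub_comm] at this
  rw [integral_const_mul, ← hM] at this
  refine this.trans ?_
  rw [zero_add, div_mul_eq_mul_div, div_le_iff₀ (by positivity)]
  nlinarith

/-- A continuous function on `(0, ∞)` whose Laplace transform vanishes is zero. -/
theorem eq_zero_of_laplace_eq_zero {h : ℝ → ℂ} (hc : ContinuousOn h (Ioi 0))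
    (hi : IntegrableOn (fun t => (Real.exp (-t) : ℂ) * h t) (Ioi 0))
    (hz : ∀ s : ℝ, 0 < s → ∫ t in Ioi (0 : ℝ), (Real.exp (-(s * t)) : ℂ) * h t = 0) :
    ∀ t : ℝ, 0 < t → h t = 0 := by
  have hae : ∀ᵐ t : ℝ, t ∈ Ioi (0 : ℝ) → h t = 0 := by
    refine isOpen_Ioi.ae_eq_zero_of_integral_contDiff_smul_eq_zero
      (hc.locallyIntegrableOn measurableSet_Ioi) fun g hg hgc hgs => ?_
    have hg0 : ∀ t, t ∉ Ioi (0 : ℝ) → g t = 0 := fun t ht =>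
      image_eq_zero_of_notMem_tsupport fun hmem => ht (hgs hmem)
    have hext : (∫ t : ℝ, g t • h t) = ∫ t in Ioi (0 : ℝ), g t • h t := by
      rw [setIntegral_eq_integral_of_forall_compl_eq_zero]
      intro t ht; rw [hg0 t ht, zero_smul]
    obtain ⟨R, hR⟩ := hgc.isCompact.bddAbove
    -- This `F` turns `F(e^{-t}) e^{-t}` into the test function `g(t)`. It vanishes near `x = 0`
    -- because the support of `g` is bounded above; at `x = 0` itself division by zero gives the
    -- right value.
    have hF : ContinuousOn (fun x : ℝ => g (-Real.log x) / x) (Icc 0 1) := by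
      intro x hx
      rcases hx.1.eq_or_lt with h0 | h0
      · subst h0
        have hev : (fun x : ℝ => g (-Real.log x) / x) =ᶠ[𝓝 0] fun _ => 0 := by
          have hneg : ∀ᶠ x : ℝ in 𝓝[≠] 0, R < -Real.log x :=
            (tendsto_neg_atBot_atTop.comp Real.tendsto_log_nhdsNE_zero).eventually_gt_atTop R
          have hnear := eventually_nhdsWithin_iff.1 hneg
          filter_upwards [hnear] with x hx
          by_cases hx0 : x = 0
          · simp [hx0]
          · have hlt := hx hx0
            rw [image_eq_zero_of_notMem_tsupport fun hmem => absurd (hR hmem) (not_le.2 hlt),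
              zero_div]
        exact (continuousAt_const.congr hev.symm).continuousWithinAt
      · refine ContinuousAt.continuousWithinAt (ContinuousAt.div ?_ continuousAt_id h0.ne')
        exact hg.continuous.continuousAt.comp (Real.continuousAt_log h0.ne').neg
    have := integral_comp_exp_neg_eq_zero hi hz hF
    rw [hext, ← this]
    refine setIntegral_congr_fun measurableSet_Ioi fun t _ => ?_
    have he : ((Real.exp (-t) : ℝ) : ℂ) ≠ 0 := by exact_mod_cast (Real.exp_pos _).ne'
    simp only [Real.log_exp, neg_neg, Complex.real_smul, Complex.ofReal_div]
    field_simp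
  have hzero : EqOn h (fun _ => 0) (Ioi 0) := by
    refine Measure.eqOn_of_ae_eq (μ := volume)
      ((ae_restrict_iff' measurableSet_Ioi).2 hae) hc continuousOn_const ?_
    rw [interior_Ioi]; exact subset_closure
  exact fun t ht => hzero ht

lemma integrableOn_rpow_mul_exp {a s : ℝ} (ha : -1 < a) (hs : 0 < s) :
    IntegrableOn (fun t : ℝ => t ^ a * Real.exp (-(s * t))) (Ioi 0) := by
  have := integrableOn_rpow_mul_exp_neg_mul_rpow ha one_pos hs
  simpa using this

lemma integrableOn_Ioo_rpow {a t : ℝ} (ha : -1 < a) (ht : 0 ≤ t) :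
    IntegrableOn (fun s : ℝ => s ^ a) (Ioo 0 t) := by
  have := intervalIntegral.intervalIntegrable_rpow' (a := 0) (b := t) ha
  rw [intervalIntegrable_iff_integrableOn_Ioc_of_le ht] at this
  exact this.mono_set Ioo_subset_Ioc_self

lemma integrableOn_Ioo_sub_rpow {a t : ℝ} (ha : -1 < a) (ht : 0 ≤ t) :
    IntegrableOn (fun s : ℝ => (t - s) ^ a) (Ioo 0 t) := by
  have := (intervalIntegral.intervalIntegrable_rpow' (a := 0) (b := t) ha).comp_sub_left t
  rw [sub_zero, sub_self] at this
  have := this.symm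
  rw [intervalIntegrable_iff_integrableOn_Ioc_of_le ht] at this
  exact this.mono_set Ioo_subset_Ioc_self

/-- On each half of the interval one of the two factors is at most its value at the midpoint. -/
lemma integrableOn_Ioo_sub_rpow_mul_rpow {a b t : ℝ} (ha : -1 < a) (ha0 : a ≤ 0) (hb : -1 < b)
    (hb0 : b ≤ 0) (ht : 0 < t) :
    IntegrableOn (fun s : ℝ => (t - s) ^ a * s ^ b) (Ioo 0 t) := by
  refine Integrable.mono' (g := fun s => (t / 2) ^ a * s ^ b + (t / 2) ^ b * (t - s) ^ a)
    (((integrableOn_Ioo_rpow hb ht.le).const_mul _).add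
      ((integrableOn_Ioo_sub_rpow ha ht.le).const_mul _))
    (Measurable.aestronglyMeasurable (by fun_prop)) ?_
  refine (ae_restrict_iff' measurableSet_Ioo).2 (ae_of_all _ fun s hs => ?_)
  have h1 : 0 < s := hs.1
  have h2 : 0 < t - s := sub_pos.2 hs.2
  have p1 := Real.rpow_pos_of_pos h1 b
  have p2 := Real.rpow_pos_of_pos h2 a
  have p3 : 0 < (t / 2) ^ a := by positivity
  have p4 : 0 < (t / 2) ^ b := by positivity
  rw [Real.norm_of_nonneg (by positivity)]
  rcases le_total s (t / 2) with h | h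
  · have := Real.rpow_le_rpow_of_nonpos (by positivity : 0 < t / 2) (by linarith : t / 2 ≤ t - s) ha0
    nlinarith [mul_le_mul_of_nonneg_right this p1.le]
  · have := Real.rpow_le_rpow_of_nonpos (by positivity : 0 < t / 2) h hb0
    nlinarith [mul_le_mul_of_nonneg_right this p2.le]

end

/-! ### Laplace transforms of the relaxation function and of its derivative -/

section

lemma continuousOn_relaxRem {α : ℝ} (hα : 0 < α) (hα1 : α ≤ 1) :
    ContinuousOn (relaxRem α) (Ioi 0) := by
  intro τ hτ
  have hτ0 : (0 : ℝ) < τ := hτ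
  refine ContinuousAt.continuousWithinAt ?_
  refine continuousAt_of_dominated (bound := fun r => ‖kern α r‖ * (τ / 2)⁻¹) ?_ ?_
    ((integrableOn_kern hα hα1).norm.mul_const _) ?_
  · exact Eventually.of_forall fun t => AEStronglyMeasurable.mul (AEStronglyMeasurable.mul
      (Continuous.aestronglyMeasurable (by fun_prop)) (aestronglyMeasurable_kern hα hα1))
      (Continuous.aestronglyMeasurable (by fun_prop))
  · filter_upwards [Ioi_mem_nhds (by linarith : τ / 2 < τ)] with t ht
    have ht' : τ / 2 < t := ht
    refine (ae_restrict_iff' measurableSet_Ioi).2 (ae_of_all _ fun r hr => ?_)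
    refine (norm_mul_kern_mul_exp_le α (le_of_lt hr) (by linarith : 0 < t)).trans ?_
    gcongr
  · exact ae_of_all _ fun r => by fun_prop

lemma continuousOn_relaxDeriv {α : ℝ} (hα : 0 < α) (hα1 : α ≤ 1) :
    ContinuousOn (relaxDeriv α) (Ioi 0) :=
  ContinuousOn.sub (by fun_prop) (continuousOn_relaxRem hα hα1)

lemma exists_norm_relaxDeriv_le {α : ℝ} (hα : 0 < α) (hα1 : α ≤ 1) :
    ∃ C : ℝ, 0 < C ∧ ∀ τ : ℝ, 0 < τ → ‖relaxDeriv α τ‖ ≤ C * (1 + τ ^ (α - 1)) := by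
  obtain ⟨C, hC, hCb⟩ := exists_norm_relaxRem_le hα hα1
  refine ⟨1 / α + C, by positivity, fun τ hτ => ?_⟩
  have h := (hCb τ hτ).2
  have hp := Real.rpow_pos_of_pos hτ (α - 1)
  have h1 : ‖-(Complex.I / α) * Complex.exp (-(τ * Complex.I))‖ = 1 / α := by
    rw [norm_mul, norm_exp_neg_mul_I, mul_one, norm_neg, norm_div, Complex.norm_I,
      Complex.norm_real, Real.norm_of_nonneg hα.le]
  have h2 : 0 < 1 / α := by positivity
  refine (norm_sub_le _ _).trans ?_
  rw [h1]
  nlinarith [mul_pos h2 hp]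

lemma integrableOn_exp_mul_relax {α : ℝ} (hα : 0 < α) (hα1 : α ≤ 1) {s : ℝ} (hs : 0 < s) :
    IntegrableOn (fun t => (Real.exp (-(s * t)) : ℂ) * relax α t) (Ioi 0) := by
  obtain ⟨C, hC, hCb⟩ := exists_norm_relax_le hα hα1
  refine Integrable.mul_bdd (c := C) ?_ ?_ ?_
  · have := integrableOn_rpow_mul_exp (a := 0) (by norm_num) hs
    simp only [Real.rpow_zero, one_mul] at this
    exact this.ofReal
  · exact ((continuousOn_relax hα hα1).mono Ioi_subset_Ici_self).aestronglyMeasurable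
      measurableSet_Ioi
  · exact (ae_restrict_iff' measurableSet_Ioi).2 (ae_of_all _ fun t ht => hCb t (le_of_lt ht))

lemma integrableOn_exp_mul_relaxDeriv {α : ℝ} (hα : 0 < α) (hα1 : α ≤ 1) {s : ℝ} (hs : 0 < s) :
    IntegrableOn (fun t => (Real.exp (-(s * t)) : ℂ) * relaxDeriv α t) (Ioi 0) := by
  obtain ⟨C, hC, hCb⟩ := exists_norm_relaxDeriv_le hα hα1
  have h0 := integrableOn_rpow_mul_exp (a := 0) (by norm_num) hs
  have h1 := integrableOn_rpow_mul_exp (a := α - 1) (by linarith) hs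
  refine Integrable.mono' ((h0.add h1).const_mul C) ?_ ?_
  · exact (Continuous.aestronglyMeasurable (by fun_prop)).mul
      ((continuousOn_relaxDeriv hα hα1).aestronglyMeasurable measurableSet_Ioi)
  · refine (ae_restrict_iff' measurableSet_Ioi).2 (ae_of_all _ fun t ht => ?_)
    rw [norm_mul, Complex.norm_real, Real.norm_of_nonneg (Real.exp_pos _).le]
    have := mul_le_mul_of_nonneg_left (hCb t ht) (Real.exp_pos (-(s * t))).le
    simp only [Pi.add_apply, Real.rpow_zero]
    linarith

lemma ofReal_exp_mul_exp (s t : ℝ) : (Real.exp (-(s * t)) : ℂ) * Complex.exp (-(t * Complex.I)) =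
    Complex.exp (-(s + Complex.I) * t) := by
  rw [Complex.ofReal_exp, ← Complex.exp_add]; congr 1; push_cast; ring

/-- Fubini turns the cut integral into the Stieltjes transform of `kern`. The pole split off there,
`1/(α(-i - s))`, cancels the transform `1/(α(s + i))` of the oscillating part. -/
lemma laplace_relax {α : ℝ} (hα : 0 < α) (hα1 : α ≤ 1) {s : ℝ} (hs : 0 < s) :
    ∫ t in Ioi (0 : ℝ), (Real.exp (-(s * t)) : ℂ) * relax α t =
      (s ^ (α - 1) : ℝ) / ((s ^ α : ℝ) - phase α) := by
  have hre : (-((s : ℂ) + Complex.I)).re < 0 := by simpa using hs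
  have h1 : ∫ t in Ioi (0 : ℝ), Complex.exp (-(s + Complex.I) * t) = 1 / (s + Complex.I) := by
    rw [integral_exp_mul_complex_Ioi hre 0, Complex.ofReal_zero, mul_zero, Complex.exp_zero,
      neg_div_neg_eq]
  have i1 : IntegrableOn (fun t : ℝ => Complex.exp (-(s + Complex.I) * t)) (Ioi 0) :=
    integrableOn_exp_mul_complex_Ioi hre 0
  have hexp : IntegrableOn (fun t : ℝ => Real.exp (-(s * t))) (Ioi 0) := by
    have := integrableOn_rpow_mul_exp (a := 0) (by norm_num) hs
    simpa only [Real.rpow_zero, one_mul] using this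
  have hprod : Integrable (Function.uncurry fun (t r : ℝ) =>
      (Real.exp (-(s * t)) : ℂ) * (kern α r * Real.exp (-(r * t))))
      ((volume.restrict (Ioi 0)).prod (volume.restrict (Ioi 0))) := by
    have hb := Integrable.mul_prod hexp (integrableOn_kern hα hα1).norm
    refine Integrable.mono' hb ?_ ?_
    · refine AEStronglyMeasurable.mul (Continuous.aestronglyMeasurable (by fun_prop)) ?_
      refine AEStronglyMeasurable.mul ?_ (Continuous.aestronglyMeasurable (by fun_prop))
      exact (aestronglyMeasurable_kern hα hα1).comp_snd
    · rw [Measure.prod_restrict]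
      refine (ae_restrict_iff' (measurableSet_Ioi.prod measurableSet_Ioi)).2
        (ae_of_all _ fun p hp => ?_)
      simp only [Function.uncurry]
      rw [norm_mul, Complex.norm_real, Real.norm_of_nonneg (Real.exp_pos _).le]
      gcongr
      exact norm_kern_mul_exp_le α (le_of_lt hp.2) (le_of_lt hp.1)
  have hinner : ∀ r ∈ Ioi (0 : ℝ), ∫ t in Ioi (0 : ℝ),
      (Real.exp (-(s * t)) : ℂ) * (kern α r * Real.exp (-(r * t))) = kern α r / (r + s) := by
    intro r hr
    have hr0 : (0 : ℝ) < r := hr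
    have e : ∀ t : ℝ, (Real.exp (-(s * t)) : ℂ) * (kern α r * Real.exp (-(r * t))) =
        kern α r * Complex.exp (-((r + s : ℝ) : ℂ) * t) := fun t => by
      rw [mul_left_comm, Complex.ofReal_exp, Complex.ofReal_exp, ← Complex.exp_add]
      congr 2; push_cast; ring
    simp_rw [e]
    have hre2 : (-((r + s : ℝ) : ℂ)).re < 0 := by
      rw [Complex.neg_re, Complex.ofReal_re]; linarith
    rw [integral_const_mul, integral_exp_mul_complex_Ioi hre2 0, Complex.ofReal_zero, mul_zero,
      Complex.exp_zero, neg_div_neg_eq, mul_one_div, Complex.ofReal_add]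
  have h2 : ∫ t in Ioi (0 : ℝ), (Real.exp (-(s * t)) : ℂ) *
      (∫ r in Ioi (0 : ℝ), kern α r * Real.exp (-(r * t))) =
      ∫ r in Ioi (0 : ℝ), kern α r / (r + s) := by
    simp_rw [← integral_const_mul]
    rw [integral_integral_swap hprod]
    exact setIntegral_congr_fun measurableSet_Ioi hinner
  have i2 : IntegrableOn (fun t : ℝ => (Real.exp (-(s * t)) : ℂ) *
      (∫ r in Ioi (0 : ℝ), kern α r * Real.exp (-(r * t)))) (Ioi 0) := by
    simp_rw [← integral_const_mul]
    exact hprod.integral_prod_left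
  have hsplit : ∀ t : ℝ, (Real.exp (-(s * t)) : ℂ) * relax α t =
      1 / α * Complex.exp (-(s + Complex.I) * t) + (Real.exp (-(s * t)) : ℂ) *
      (∫ r in Ioi (0 : ℝ), kern α r * Real.exp (-(r * t))) := fun t => by
    rw [relax, ← ofReal_exp_mul_exp]; ring
  simp_rw [hsplit]
  rw [integral_add (i1.const_mul _) i2, integral_const_mul, h1, h2, integral_kern_div hα hα1 hs]
  have hα' : (α : ℂ) ≠ 0 := by exact_mod_cast hα.ne'
  have hsi : (s : ℂ) + Complex.I ≠ 0 := fun h => by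
    have := congrArg Complex.im h; simp at this
  have e : (-Complex.I - s : ℂ) = -(s + Complex.I) := by ring
  rw [e]
  field_simp
  ring

/-- Integration by parts with boundary value `relax α 0 = 1` gives `s · s^{α-1}/(s^α - phase) - 1`.
-/
lemma laplace_relaxDeriv {α : ℝ} (hα : 0 < α) (hα1 : α ≤ 1) {s : ℝ} (hs : 0 < s)
    (hph : ((s ^ α : ℝ) : ℂ) - phase α ≠ 0) :
    ∫ t in Ioi (0 : ℝ), (Real.exp (-(s * t)) : ℂ) * relaxDeriv α t =
      phase α / ((s ^ α : ℝ) - phase α) := by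
  have hu : ∀ t : ℝ, HasDerivAt (fun t : ℝ => (Real.exp (-(s * t)) : ℂ))
      (-s * (Real.exp (-(s * t)) : ℂ)) t := fun t => by
    refine ((((hasDerivAt_id t).const_mul s).neg.exp).ofReal_comp).congr_deriv ?_
    simp; ring
  have i0 := integrableOn_exp_mul_relax hα hα1 hs
  have h := integral_Ioi_mul_deriv_eq_deriv_mul (a := 0) (a' := 1) (b' := 0)
    (u := fun t : ℝ => (Real.exp (-(s * t)) : ℂ)) (v := relax α)
    (fun t _ => hu t) (fun t ht => hasDerivAt_relax hα hα1 ht)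
    (integrableOn_exp_mul_relaxDeriv hα hα1 hs) ?_ ?_ ?_
  · rw [h]
    simp_rw [mul_assoc]
    rw [integral_const_mul, laplace_relax hα hα1 hs, Real.rpow_sub_one hs.ne']
    have hs' : (s : ℂ) ≠ 0 := by exact_mod_cast hs.ne'
    push_cast at hph ⊢
    field_simp
    ring
  · have := i0.const_mul (-(s : ℂ))
    refine this.congr (ae_of_all _ fun t => ?_)
    simp [mul_assoc]
  · have h1 : Tendsto (relax α) (𝓝[>] 0) (𝓝 1) := by
      rw [← relax_zero hα hα1]
      exact ((continuousOn_relax hα hα1) 0 self_mem_Ici).mono_left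
        (nhdsWithin_mono _ Ioi_subset_Ici_self)
    have h2 : Tendsto (fun t : ℝ => (Real.exp (-(s * t)) : ℂ)) (𝓝[>] 0) (𝓝 1) := by
      have : Continuous fun t : ℝ => (Real.exp (-(s * t)) : ℂ) := by fun_prop
      have := this.tendsto 0
      simp only [mul_zero, neg_zero, Real.exp_zero, Complex.ofReal_one] at this
      exact this.mono_left nhdsWithin_le_nhds
    have h3 := h2.mul h1
    rw [mul_one] at h3
    exact h3
  · obtain ⟨C, hC, hCb⟩ := exists_norm_relax_le hα hα1
    have hb : Tendsto (fun t : ℝ => Real.exp (s * -t) * C) atTop (𝓝 0) := by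
      simpa using (tendsto_exp_mul_atBot hs).mul_const C
    refine squeeze_zero_norm' ?_ hb
    filter_upwards [eventually_gt_atTop 0] with t ht
    rw [Pi.mul_apply, norm_mul, Complex.norm_real, Real.norm_of_nonneg (Real.exp_pos _).le, mul_neg]
    gcongr
    exact hCb t ht.le

end

/-! ### The Abel equation for the relaxation function -/

section

lemma phase_ne_one {α : ℝ} (hα : 0 < α) (hα1 : α ≤ 1) : phase α ≠ 1 := by
  have := Real.pi_pos
  intro h
  refine exp_neg_mul_I_ne_one (x := Real.pi * α / 2) (by positivity) (by nlinarith) ?_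
  rw [phase, neg_mul, Complex.exp_neg, inv_eq_one] at h
  exact h

/-- The unnormalized Caputo derivative of `relax`. -/
def relaxAbel (α τ : ℝ) : ℂ := ∫ σ in Ioo 0 τ, ((τ - σ) ^ (-α) : ℝ) • relaxDeriv α σ

lemma relaxAbel_eq {α : ℝ} {τ : ℝ} (hτ : 0 < τ) :
    relaxAbel α τ = (τ ^ (1 - α) : ℝ) •
      ∫ x in Ioo (0 : ℝ) 1, ((1 - x) ^ (-α) : ℝ) • relaxDeriv α (τ * x) := by
  have h := intervalIntegral.integral_comp_mul_left (a := 0) (b := 1)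
    (fun σ => ((τ - σ) ^ (-α) : ℝ) • relaxDeriv α σ) hτ.ne'
  rw [mul_zero, mul_one, intervalIntegral.integral_of_le zero_le_one,
    intervalIntegral.integral_of_le hτ.le, integral_Ioc_eq_integral_Ioo,
    integral_Ioc_eq_integral_Ioo] at h
  have h2 : relaxAbel α τ = τ • ∫ x in Ioo (0 : ℝ) 1,
      ((τ - τ * x) ^ (-α) : ℝ) • relaxDeriv α (τ * x) := by
    rw [h, smul_smul, mul_inv_cancel₀ hτ.ne', one_smul, relaxAbel]
  have h3 : ∫ x in Ioo (0 : ℝ) 1, ((τ - τ * x) ^ (-α) : ℝ) • relaxDeriv α (τ * x) =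
      (τ ^ (-α) : ℝ) • ∫ x in Ioo (0 : ℝ) 1, ((1 - x) ^ (-α) : ℝ) • relaxDeriv α (τ * x) := by
    rw [← integral_smul]
    refine setIntegral_congr_fun measurableSet_Ioo fun x hx => ?_
    have : τ - τ * x = τ * (1 - x) := by ring
    simp only [smul_smul]
    rw [this, Real.mul_rpow hτ.le (by linarith [hx.2])]
  rw [h2, h3, smul_smul]
  congr 1
  rw [show 1 - α = 1 + -α by ring, Real.rpow_add hτ, Real.rpow_one]

/-- Rescaling to `(0, 1)` frees both the domain and the singularity from `τ`, so dominated
convergence applies. Continuity is what upgrades equality of Laplace transforms to equality at every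
point. -/
lemma continuousOn_relaxAbel {α : ℝ} (hα : 0 < α) (hα1 : α < 1) :
    ContinuousOn (relaxAbel α) (Ioi 0) := by
  obtain ⟨C, hC, hCb⟩ := exists_norm_relaxDeriv_le hα hα1.le
  have key : ContinuousOn (fun τ : ℝ => (τ ^ (1 - α) : ℝ) •
      ∫ x in Ioo (0 : ℝ) 1, ((1 - x) ^ (-α) : ℝ) • relaxDeriv α (τ * x)) (Ioi 0) := by
    intro τ hτ
    have hτ0 : (0 : ℝ) < τ := hτ
    refine ContinuousAt.continuousWithinAt (ContinuousAt.smul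
      (Real.continuousAt_rpow_const _ _ (Or.inl hτ0.ne')) ?_)
    refine continuousAt_of_dominated (bound := fun x => C * ((1 - x) ^ (-α) * x ^ (0 : ℝ)) +
      C * (τ / 2) ^ (α - 1) * ((1 - x) ^ (-α) * x ^ (α - 1))) ?_ ?_ ?_ ?_
    · filter_upwards [Ioi_mem_nhds hτ0] with t ht
      have hm : Measurable fun x : ℝ => (1 - x) ^ (-α) := by fun_prop
      refine hm.aestronglyMeasurable.smul ?_
      refine ContinuousOn.aestronglyMeasurable ?_ measurableSet_Ioo
      exact (continuousOn_relaxDeriv hα hα1.le).comp (by fun_prop) fun x hx =>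
        mul_pos (mem_Ioi.1 ht) hx.1
    · filter_upwards [Ioi_mem_nhds (by linarith : τ / 2 < τ)] with t ht
      have ht' : τ / 2 < t := ht
      refine (ae_restrict_iff' measurableSet_Ioo).2 (ae_of_all _ fun x hx => ?_)
      have hx0 : 0 < x := hx.1
      have hx1 : 0 < 1 - x := sub_pos.2 hx.2
      have htx : 0 < t * x := mul_pos (by linarith) hx0
      have p1 := Real.rpow_pos_of_pos hx1 (-α)
      have p2 := Real.rpow_pos_of_pos hx0 (α - 1)
      rw [norm_smul, Real.norm_of_nonneg p1.le, Real.rpow_zero]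
      have h1 := hCb _ htx
      have h2 : (t * x) ^ (α - 1) ≤ (τ / 2) ^ (α - 1) * x ^ (α - 1) := by
        rw [Real.mul_rpow (by linarith) hx0.le]
        exact mul_le_mul_of_nonneg_right
          (Real.rpow_le_rpow_of_nonpos (by positivity) ht'.le (by linarith)) p2.le
      calc (1 - x) ^ (-α) * ‖relaxDeriv α (t * x)‖
          ≤ (1 - x) ^ (-α) * (C * (1 + (τ / 2) ^ (α - 1) * x ^ (α - 1))) := by
            gcongr; exact h1.trans (by gcongr)
        _ = _ := by ring
    · exact ((integrableOn_Ioo_sub_rpow_mul_rpow (by linarith) (by linarith) (by norm_num) le_rfl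
        one_pos).const_mul _).add ((integrableOn_Ioo_sub_rpow_mul_rpow (by linarith) (by linarith)
        (by linarith) (by linarith) one_pos).const_mul _)
    · refine (ae_restrict_iff' measurableSet_Ioo).2 (ae_of_all _ fun x hx => ?_)
      refine ContinuousAt.fun_const_smul ?_ _
      exact ((continuousOn_relaxDeriv hα hα1.le).continuousAt
        (Ioi_mem_nhds (mul_pos hτ0 hx.1))).comp (f := fun t : ℝ => t * x) (by fun_prop)
  exact key.congr fun τ hτ => relaxAbel_eq hτ

/-- The exponential distributes over the convolution. Both damped factors are integrable on the
half-line, so the integral of their convolution is the product of two Laplace transforms. -/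
lemma exp_mul_relaxAbel (α s τ : ℝ) (hτ : 0 < τ) :
    (Real.exp (-(s * τ)) : ℂ) * relaxAbel α τ = ∫ σ in (0 : ℝ)..τ,
      ContinuousLinearMap.mul ℝ ℂ ((Real.exp (-(s * σ)) : ℂ) * relaxDeriv α σ)
        (((τ - σ) ^ (-α) * Real.exp (-(s * (τ - σ))) : ℝ) : ℂ) := by
  rw [intervalIntegral.integral_of_le hτ.le, integral_Ioc_eq_integral_Ioo, relaxAbel,
    ← integral_const_mul]
  refine setIntegral_congr_fun measurableSet_Ioo fun σ _ => ?_
  have : Real.exp (-(s * τ)) = Real.exp (-(s * σ)) * Real.exp (-(s * (τ - σ))) := by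
    rw [← Real.exp_add]; congr 1; ring
  simp only [ContinuousLinearMap.mul_apply', Complex.real_smul]
  rw [this]; push_cast; ring

/-- The Abel integral equation satisfied by the relaxation function. -/
theorem relaxAbel_eq_relax {α : ℝ} (hα : 0 < α) (hα1 : α < 1) {τ : ℝ} (hτ : 0 < τ) :
    relaxAbel α τ = Real.Gamma (1 - α) * (phase α * relax α τ) := by
  have hi1 : ∀ s : ℝ, 0 < s →
      IntegrableOn (fun t : ℝ => ((t ^ (-α) * Real.exp (-(s * t)) : ℝ) : ℂ)) (Ioi 0) :=
    fun s hs => (integrableOn_rpow_mul_exp (by linarith) hs).ofReal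
  have hA : ∀ s : ℝ, 0 < s →
      IntegrableOn (fun t => (Real.exp (-(s * t)) : ℂ) * relaxAbel α t) (Ioi 0) := fun s hs => by
    have := integrable_posConvolution (integrableOn_exp_mul_relaxDeriv hα hα1.le hs) (hi1 s hs)
      (ContinuousLinearMap.mul ℝ ℂ) (ν := volume) (μ := volume)
    refine this.integrableOn.congr_fun (s := Ioi 0) (fun t ht => ?_) measurableSet_Ioi
    rw [posConvolution, indicator_of_mem ht]
    exact (exp_mul_relaxAbel α s t ht).symm
  -- The power `t^{-α}` contributes `Γ(1 - α) s^{α-1}`; the product is `Γ(1 - α) phase` times the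
  -- transform of `relax`.
  have hLA : ∀ s : ℝ, 0 < s → ∫ t in Ioi (0 : ℝ), (Real.exp (-(s * t)) : ℂ) * relaxAbel α t =
      (phase α / ((s ^ α : ℝ) - phase α)) * ((s ^ (α - 1) * Real.Gamma (1 - α) : ℝ) : ℂ) := by
    intro s hs
    have hph : ((s ^ α : ℝ) : ℂ) - phase α ≠ 0 :=
      ofReal_sub_ne_zero (norm_phase α) (phase_ne_one hα hα1.le) (Real.rpow_nonneg hs.le _)
    have h := integral_posConvolution (integrableOn_exp_mul_relaxDeriv hα hα1.le hs) (hi1 s hs)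
      (ContinuousLinearMap.mul ℝ ℂ) (ν := volume) (μ := volume)
    rw [laplace_relaxDeriv hα hα1.le hs hph] at h
    have hG := Real.integral_rpow_mul_exp_neg_mul_Ioi (a := 1 - α) (by linarith) hs
    rw [show 1 - α - 1 = -α by ring] at hG
    have e : (1 / s) ^ (1 - α) = s ^ (α - 1) := by
      rw [one_div, Real.inv_rpow hs.le, ← Real.rpow_neg hs.le]; congr 1; ring
    have hG2 : ∫ t in Ioi (0 : ℝ), ((t ^ (-α) * Real.exp (-(s * t)) : ℝ) : ℂ) =
        ((s ^ (α - 1) * Real.Gamma (1 - α) : ℝ) : ℂ) := by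
      rw [← e, ← hG]; exact integral_ofReal
    rw [hG2] at h
    rw [ContinuousLinearMap.mul_apply'] at h
    rw [← h]
    exact setIntegral_congr_fun measurableSet_Ioi fun t ht => exp_mul_relaxAbel α s t ht
  have hc : ContinuousOn (fun t => relaxAbel α t - Real.Gamma (1 - α) * (phase α * relax α t))
      (Ioi 0) :=
    (continuousOn_relaxAbel hα hα1).sub (continuousOn_const.mul (continuousOn_const.mul
      ((continuousOn_relax hα hα1.le).mono Ioi_subset_Ici_self)))
  have e : ∀ s t : ℝ, (Real.exp (-(s * t)) : ℂ) *
      (relaxAbel α t - Real.Gamma (1 - α) * (phase α * relax α t)) =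
      (Real.exp (-(s * t)) : ℂ) * relaxAbel α t - Real.Gamma (1 - α) * phase α *
        ((Real.exp (-(s * t)) : ℂ) * relax α t) := fun s t => by ring
  refine sub_eq_zero.1 (eq_zero_of_laplace_eq_zero hc ?_ (fun s hs => ?_) τ hτ)
  · have := (hA 1 one_pos).sub ((integrableOn_exp_mul_relax hα hα1.le one_pos).const_mul
      (Real.Gamma (1 - α) * phase α : ℂ))
    refine this.congr (ae_of_all _ fun t => ?_)
    have h := e 1 t
    rw [one_mul] at h
    simp only [Pi.sub_apply, one_mul]
    exact h.symm
  · simp_rw [e]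
    rw [integral_sub (hA s hs) ((integrableOn_exp_mul_relax hα hα1.le hs).const_mul _),
      integral_const_mul, hLA s hs, laplace_relax hα hα1.le hs]
    push_cast
    ring

end

/-! ### The free Hamiltonian and directional derivatives as Fourier multipliers -/

section

open scoped FourierTransform LineDeriv

lemma locallyIntegrable_L2 {d : ℕ} (f : L2 d) : LocallyIntegrable f (volume : Measure (Space d)) :=
  (Lp.memLp f).locallyIntegrable (by norm_num)

lemma smulLeftCLM_toTemperedDistribution_iff {d : ℕ} {m : Space d → ℂ} (hm : m.HasTemperateGrowth)
    (f g : L2 d) :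
    TemperedDistribution.smulLeftCLM ℂ m (Lp.toTemperedDistribution f) =
      Lp.toTemperedDistribution g ↔ (g : Space d → ℂ) =ᵐ[volume] fun x => m x * f x := by
  have hmc : Continuous m := hm.1.continuous
  constructor
  · intro h
    refine ae_eq_of_integral_contDiff_smul_eq (locallyIntegrable_L2 g) ?_ ?_
    · rw [← locallyIntegrableOn_univ]
      exact (locallyIntegrable_L2 f).locallyIntegrableOn univ |>.continuousOn_mul
        hmc.continuousOn isOpen_univ.isLocallyClosed
    · intro φ hφ hφc
      have hφ₁ : HasCompactSupport (Complex.ofRealCLM ∘ φ) := hφc.comp_left rfl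
      have hφ₂ : ContDiff ℝ ((⊤ : ℕ∞) : WithTop ℕ∞) (Complex.ofRealCLM ∘ φ) := by fun_prop
      have := congrArg (fun T => T (hφ₁.toSchwartzMap hφ₂)) h
      simp only [TemperedDistribution.smulLeftCLM_apply_apply, Lp.toTemperedDistribution_apply,
        SchwartzMap.smulLeftCLM_apply_apply hm] at this
      simp only [HasCompactSupport.toSchwartzMap_toFun, Function.comp_apply, smul_eq_mul,
        Complex.ofRealCLM_apply] at this
      simp only [Complex.real_smul]
      rw [← this]
      congr 1; ext x; ring
  · intro h
    ext φ
    simp only [TemperedDistribution.smulLeftCLM_apply_apply, Lp.toTemperedDistribution_apply,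
      SchwartzMap.smulLeftCLM_apply_apply hm]
    refine integral_congr_ae ?_
    filter_upwards [h] with x hx
    rw [hx]; simp only [smul_eq_mul]; ring

/-- The Fourier symbol of `-Δ` for the kernel `e^{-2πi x·ξ}`. -/
def symbol {d : ℕ} (ξ : Space d) : ℝ := (2 * Real.pi * ‖ξ‖) ^ 2

lemma hasTemperateGrowth_symbol {d : ℕ} :
    (fun ξ : Space d => (symbol ξ : ℂ)).HasTemperateGrowth := by
  have : (fun ξ : Space d => (symbol ξ : ℂ)) =
      fun ξ => ((2 * Real.pi) ^ 2 : ℂ) * (Complex.ofReal (‖ξ‖ ^ 2)) := by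
    ext ξ; simp [symbol, mul_pow]
  rw [this]; fun_prop

lemma fourier_neg_laplacian {d : ℕ} (f : L2 d) :
    𝓕 (-(Δ (Lp.toTemperedDistribution f))) =
      TemperedDistribution.smulLeftCLM ℂ (fun ξ : Space d => (symbol ξ : ℂ))
        (Lp.toTemperedDistribution (𝓕 f)) := by
  have h1 : (fun ξ : Space d => Complex.ofReal (‖ξ‖ ^ 2)).HasTemperateGrowth := by fun_prop
  have h2 : (fun ξ : Space d => (symbol ξ : ℂ)) =
      ((2 * Real.pi) ^ 2 : ℂ) • (fun ξ : Space d => Complex.ofReal (‖ξ‖ ^ 2)) := by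
    ext ξ; simp [symbol, mul_pow]
  rw [TemperedDistribution.laplacian_eq_fourierMultiplierCLM, h2,
    TemperedDistribution.smulLeftCLM_smul h1, ← Lp.fourier_toTemperedDistribution_eq,
    TemperedDistribution.fourierMultiplierCLM_apply, neg_smul, neg_neg, ← Complex.coe_smul,
    FourierTransform.fourier_smul, FourierTransform.fourier_fourierInv_eq]
  simp

theorem freeHamiltonian_iff {d : ℕ} (f g : L2 d) : FreeHamiltonian f g ↔
    (𝓕 g : L2 d) =ᵐ[volume] fun ξ => (symbol ξ : ℂ) * (𝓕 f : L2 d) ξ := by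
  have key : -(Δ (Lp.toTemperedDistribution f)) = Lp.toTemperedDistribution g ↔
      (𝓕 g : L2 d) =ᵐ[volume] fun ξ => (symbol ξ : ℂ) * (𝓕 f : L2 d) ξ := by
    rw [← smulLeftCLM_toTemperedDistribution_iff hasTemperateGrowth_symbol, ← fourier_neg_laplacian,
      ← Lp.fourier_toTemperedDistribution_eq]
    refine ⟨fun h => by rw [h], fun h => ?_⟩
    have := congrArg (fun T => 𝓕⁻ T) h
    simpa using this
  rw [FreeHamiltonian, key]
  refine ⟨fun h => h.2, fun h => ⟨?_, h⟩⟩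
  rw [TemperedDistribution.memSobolev_iff_exists_smulLeftCLM_fourier]
  -- Membership in `H²` is automatic: this `L²` function is `(1 + |ξ|²)` times the transform of `f`.
  refine ⟨𝓕 f + (((2 * Real.pi) ^ 2)⁻¹ : ℂ) • 𝓕 g, ?_⟩
  rw [Lp.fourier_toTemperedDistribution_eq, smulLeftCLM_toTemperedDistribution_iff (by fun_prop)]
  filter_upwards [h, Lp.coeFn_add (𝓕 f : L2 d) ((((2 * Real.pi) ^ 2)⁻¹ : ℂ) • 𝓕 g),
    Lp.coeFn_smul (((2 * Real.pi) ^ 2)⁻¹ : ℂ) (𝓕 g : L2 d)] with ξ h1 h2 h3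
  rw [h2, Pi.add_apply, h3, Pi.smul_apply, h1, smul_eq_mul, symbol]
  have : (2 / 2 : ℝ) = 1 := by norm_num
  rw [this, Real.rpow_one]
  have hpi : (Real.pi : ℂ) ≠ 0 := by exact_mod_cast Real.pi_ne_zero
  push_cast
  field_simp

/-- The inverse transform turns a derivative in frequency into multiplication by a coordinate; this
converts the second moment in `x` into a norm of a gradient in `ξ`. -/
lemma fourierInv_lineDeriv_ae {d : ℕ} {f f' : L2 d} {m : Space d}
    (h : ∂_{m} (Lp.toTemperedDistribution f) = Lp.toTemperedDistribution f') :
    (𝓕⁻ f' : L2 d) =ᵐ[volume]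
      fun x => (-(2 * Real.pi * Complex.I) * (inner ℝ x m : ℝ)) * (𝓕⁻ f : L2 d) x := by
  have h1 : (fun x : Space d => ((inner ℝ x m : ℝ) : ℂ)).HasTemperateGrowth := by fun_prop
  have h2 := TemperedDistribution.fourierInv_lineDerivOp_eq (Lp.toTemperedDistribution f) m
  rw [h, Lp.fourierInv_toTemperedDistribution_eq, Lp.fourierInv_toTemperedDistribution_eq]
    at h2
  have h3 := congrArg (fun T => T (Lp.toTemperedDistribution (𝓕⁻ f : L2 d)))
    (TemperedDistribution.smulLeftCLM_smul (F := ℂ) h1 (-(2 * Real.pi * Complex.I)))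
  exact (smulLeftCLM_toTemperedDistribution_iff
    (m := fun x => -(2 * Real.pi * Complex.I) * (inner ℝ x m : ℝ)) (by fun_prop) _ _).1
    (h3.trans h2.symm)

end

/-! ### Inversion of the Abel operator and a weakly singular Gronwall inequality -/

section

/-- The Beta integral `∫₀¹ (1 - x)^{α-1} x^{-α} dx`. -/
def betaConst (α : ℝ) : ℝ := ∫ x in Ioo (0 : ℝ) 1, (1 - x) ^ (α - 1) * x ^ (-α)

lemma betaConst_pos {α : ℝ} (hα : 0 < α) (hα1 : α < 1) : 0 < betaConst α := by
  have hi := integrableOn_Ioo_sub_rpow_mul_rpow (a := α - 1) (b := -α) (t := 1) (by linarith)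
    (by linarith) (by linarith) (by linarith) one_pos
  have hpos : ∀ x ∈ Ioo (0 : ℝ) 1, 0 < (1 - x) ^ (α - 1) * x ^ (-α) := fun x hx =>
    mul_pos (Real.rpow_pos_of_pos (sub_pos.2 hx.2) _) (Real.rpow_pos_of_pos hx.1 _)
  rw [betaConst, setIntegral_pos_iff_support_of_nonneg_ae
    ((ae_restrict_iff' measurableSet_Ioo).2 (ae_of_all _ fun x hx => (hpos x hx).le)) hi]
  have : Ioo (0 : ℝ) 1 ⊆ Function.support (fun x : ℝ => (1 - x) ^ (α - 1) * x ^ (-α)) ∩ Ioo 0 1 :=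
    fun x hx => ⟨(hpos x hx).ne', hx⟩
  refine lt_of_lt_of_le ?_ (measure_mono this)
  simp

/-- The exponents add up to `-1`, so the length `t - r` scales out completely and the value does not
depend on the interval. -/
lemma integral_Ioo_beta {α r t : ℝ} (hrt : r < t) :
    ∫ s in Ioo r t, (t - s) ^ (α - 1) * (s - r) ^ (-α) = betaConst α := by
  have hL : 0 < t - r := sub_pos.2 hrt
  have h := intervalIntegral.integral_comp_mul_add (a := 0) (b := 1)
    (fun s => (t - s) ^ (α - 1) * (s - r) ^ (-α)) hL.ne' r
  rw [mul_zero, mul_one, zero_add, sub_add_cancel, intervalIntegral.integral_of_le zero_le_one,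
    intervalIntegral.integral_of_le hrt.le, integral_Ioc_eq_integral_Ioo,
    integral_Ioc_eq_integral_Ioo] at h
  have h2 : ∫ s in Ioo r t, (t - s) ^ (α - 1) * (s - r) ^ (-α) = (t - r) *
      ∫ x in Ioo (0 : ℝ) 1, (t - ((t - r) * x + r)) ^ (α - 1) * ((t - r) * x + r - r) ^ (-α) := by
    rw [h, smul_eq_mul, ← mul_assoc, mul_inv_cancel₀ hL.ne', one_mul]
  rw [h2, betaConst, ← integral_const_mul]
  refine setIntegral_congr_fun measurableSet_Ioo fun x hx => ?_
  have e1 : t - ((t - r) * x + r) = (t - r) * (1 - x) := by ring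
  have e2 : (t - r) * x + r - r = (t - r) * x := by ring
  simp only [e1, e2]
  rw [Real.mul_rpow hL.le (by linarith [hx.2]), Real.mul_rpow hL.le hx.1.le,
    Real.rpow_sub_one hL.ne', Real.rpow_neg hL.le]
  have := Real.rpow_pos_of_pos hL α
  field_simp

lemma integrableOn_Ioo_beta {α r t : ℝ} (hα : 0 < α) (hα1 : α < 1) (hrt : r < t) :
    IntegrableOn (fun s => (t - s) ^ (α - 1) * (s - r) ^ (-α)) (Ioo r t) := by
  by_contra hcon
  have h := integral_Ioo_beta (α := α) hrt
  rw [integral_undef hcon] at h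
  exact (betaConst_pos hα hα1).ne h

variable {E : Type*} [NormedAddCommGroup E] [NormedSpace ℝ E]

/-- Fractional integration inverts the Abel integral operator of order `1 - α`. -/
lemma integral_abel_inverse [CompleteSpace E] {α : ℝ} (hα : 0 < α) (hα1 : α < 1) {t : ℝ}
    {v : ℝ → E} (hv : IntegrableOn v (Ioo 0 t)) :
    ∫ s in Ioo 0 t, ((t - s) ^ (α - 1) : ℝ) • ∫ r in Ioo 0 s, ((s - r) ^ (-α) : ℝ) • v r =
      betaConst α • ∫ r in Ioo 0 t, v r := by
  -- Fubini on the triangle `r < s < t`, where the inner integral over `s` is the Beta constant.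
  set S : Set (ℝ × ℝ) := {p | p.2 < p.1} with hS
  have hSm : MeasurableSet S := measurableSet_lt measurable_snd measurable_fst
  set Φ : ℝ × ℝ → E := S.indicator fun p => ((t - p.1) ^ (α - 1) * (p.1 - p.2) ^ (-α)) • v p.2
    with hΦ
  set μ : Measure ℝ := volume.restrict (Ioo 0 t) with hμ
  have hk : Measurable fun p : ℝ × ℝ => (t - p.1) ^ (α - 1) * (p.1 - p.2) ^ (-α) := by fun_prop
  have hΦm : AEStronglyMeasurable Φ (μ.prod μ) :=
    (hk.aestronglyMeasurable.smul hv.aestronglyMeasurable.comp_snd).indicator hSm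
  have hsec : ∀ r ∈ Ioo 0 t,
      (fun s => Φ (s, r)) = (Ioi r).indicator
        fun s => ((t - s) ^ (α - 1) * (s - r) ^ (-α)) • v r := fun r _ => by
    ext s
    by_cases h : r < s
    · rw [hΦ, indicator_of_mem (show (s, r) ∈ S from h), indicator_of_mem (mem_Ioi.2 h)]
    · rw [hΦ, indicator_of_notMem (show (s, r) ∉ S from h),
        indicator_of_notMem (fun h' => h (mem_Ioi.1 h'))]
  have hinter : ∀ r ∈ Ioo 0 t, Ioi r ∩ Ioo 0 t = Ioo r t := fun r hr => by
    ext s; simp only [mem_inter_iff, mem_Ioi, mem_Ioo]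
    exact ⟨fun h => ⟨h.1, h.2.2⟩, fun h => ⟨h.1, hr.1.trans h.1, h.2⟩⟩
  have hint : ∀ r ∈ Ioo 0 t, Integrable (fun s => Φ (s, r)) μ := fun r hr => by
    rw [hsec r hr, integrable_indicator_iff measurableSet_Ioi, IntegrableOn, hμ,
      Measure.restrict_restrict measurableSet_Ioi, hinter r hr]
    exact (integrableOn_Ioo_beta hα hα1 hr.2).smul_const _
  have hval : ∀ r ∈ Ioo 0 t, ∫ s, Φ (s, r) ∂μ = betaConst α • v r := fun r hr => by
    rw [hsec r hr, integral_indicator measurableSet_Ioi, hμ,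
      Measure.restrict_restrict measurableSet_Ioi, hinter r hr, integral_smul_const,
      integral_Ioo_beta hr.2]
  have hnorm : ∀ r ∈ Ioo 0 t, ∫ s, ‖Φ (s, r)‖ ∂μ = betaConst α * ‖v r‖ := fun r hr => by
    have e : (fun s => ‖Φ (s, r)‖) = fun s => (Ioi r).indicator
        (fun s => ‖((t - s) ^ (α - 1) * (s - r) ^ (-α)) • v r‖) s := by
      ext s
      rw [← norm_indicator_eq_indicator_norm, ← hsec r hr]
    rw [e, integral_indicator measurableSet_Ioi, hμ,
      Measure.restrict_restrict measurableSet_Ioi, hinter r hr, ← integral_Ioo_beta hr.2,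
      ← integral_mul_const]
    refine setIntegral_congr_fun measurableSet_Ioo fun s hs => ?_
    rw [norm_smul, Real.norm_of_nonneg]
    exact mul_nonneg (Real.rpow_nonneg (by linarith [hs.2]) _)
      (Real.rpow_nonneg (by linarith [hs.1]) _)
  have hΦi : Integrable Φ (μ.prod μ) := by
    rw [integrable_prod_iff' hΦm]
    refine ⟨(ae_restrict_iff' measurableSet_Ioo).2 (ae_of_all _ hint), ?_⟩
    have : Integrable (fun r => betaConst α * ‖v r‖) μ := hv.norm.const_mul _
    refine this.congr ((ae_restrict_iff' measurableSet_Ioo).2 (ae_of_all _ fun r hr => ?_))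
    exact (hnorm r hr).symm
  have hswap := integral_integral_swap (μ := μ) (ν := μ) (f := fun s r => Φ (s, r)) hΦi
  have hleft : ∫ s, ∫ r, Φ (s, r) ∂μ ∂μ =
      ∫ s in Ioo 0 t, ((t - s) ^ (α - 1) : ℝ) • ∫ r in Ioo 0 s, ((s - r) ^ (-α) : ℝ) • v r := by
    refine setIntegral_congr_fun measurableSet_Ioo fun s hs => ?_
    have e : (fun r => Φ (s, r)) = (Iio s).indicator
        fun r => ((t - s) ^ (α - 1) : ℝ) • ((s - r) ^ (-α) : ℝ) • v r := by
      ext r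
      by_cases h : r < s
      · rw [hΦ, indicator_of_mem (show (s, r) ∈ S from h), indicator_of_mem (mem_Iio.2 h), smul_smul]
      · rw [hΦ, indicator_of_notMem (show (s, r) ∉ S from h),
          indicator_of_notMem (fun h' => h (mem_Iio.1 h'))]
    have hi : Iio s ∩ Ioo 0 t = Ioo 0 s := by
      ext r; simp only [mem_inter_iff, mem_Iio, mem_Ioo]
      exact ⟨fun h => ⟨h.2.1, h.1⟩, fun h => ⟨h.2, h.1, h.2.trans hs.2⟩⟩
    rw [e, integral_indicator measurableSet_Iio, hμ, Measure.restrict_restrict measurableSet_Iio, hi,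
      integral_smul]
  rw [← hleft, hswap, ← integral_smul]
  exact setIntegral_congr_fun measurableSet_Ioo hval

/-- A weakly singular Gronwall inequality with zero forcing. -/
lemma eq_zero_of_le_abel {α T C : ℝ} (hα : 0 < α) (hC : 0 ≤ C) {φ : ℝ → ℝ}
    (hφ : ContinuousOn φ (Icc 0 T)) (hφ0 : ∀ t ∈ Icc 0 T, 0 ≤ φ t)
    (hle : ∀ t ∈ Icc 0 T, φ t ≤ C * ∫ s in Ioo 0 t, (t - s) ^ (α - 1) * φ s) :
    ∀ t ∈ Icc 0 T, φ t = 0 := by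
  have hG : 0 < Real.Gamma α := Real.Gamma_pos_of_pos hα
  -- In the norm `sup e^{-kt} φ(t)` the Abel operator has size at most `C Γ(α) k^{-α}`. Once this is
  -- at most `1/2`, the maximum `N` satisfies `N ≤ N/2`.
  obtain ⟨k, hk0, hk⟩ : ∃ k : ℝ, 0 < k ∧ C * ((1 / k) ^ α * Real.Gamma α) ≤ 1 / 2 := by
    have h1 : Tendsto (fun k : ℝ => C * ((1 / k) ^ α * Real.Gamma α)) atTop (𝓝 0) := by
      have h := (tendsto_rpow_neg_atTop hα).mul_const (Real.Gamma α) |>.const_mul C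
      rw [zero_mul, mul_zero] at h
      refine h.congr' ?_
      filter_upwards [eventually_gt_atTop 0] with k hk
      rw [one_div, Real.inv_rpow hk.le, Real.rpow_neg hk.le]
    have h2 := h1.eventually (ge_mem_nhds (show (0 : ℝ) < 1 / 2 by norm_num))
    obtain ⟨k, h3, h4⟩ := (h2.and (eventually_gt_atTop 0)).exists
    exact ⟨k, h4, h3⟩
  intro t ht
  have hne : (Icc 0 T).Nonempty := ⟨t, ht⟩
  obtain ⟨t₀, ht₀, hmax⟩ := isCompact_Icc.exists_isMaxOn hne
    (f := fun s => Real.exp (-(k * s)) * φ s) (ContinuousOn.mul (by fun_prop) hφ)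
  set N := Real.exp (-(k * t₀)) * φ t₀ with hN
  have hN0 : 0 ≤ N := mul_nonneg (Real.exp_pos _).le (hφ0 _ ht₀)
  have hNle : ∀ s ∈ Icc 0 T, φ s ≤ Real.exp (k * s) * N := fun s hs => by
    have h1 : Real.exp (-(k * s)) * φ s ≤ N := hmax hs
    have h2 : Real.exp (k * s) * Real.exp (-(k * s)) = 1 := by rw [← Real.exp_add]; simp
    calc φ s = Real.exp (k * s) * (Real.exp (-(k * s)) * φ s) := by rw [← mul_assoc, h2, one_mul]
      _ ≤ _ := by gcongr
  have hint : IntegrableOn (fun x : ℝ => x ^ (α - 1) * Real.exp (-(k * x))) (Ioi 0) :=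
    integrableOn_rpow_mul_exp (by linarith) hk0
  have hrefl : ∫ s in Ioo 0 t₀, (t₀ - s) ^ (α - 1) * Real.exp (-(k * (t₀ - s))) ≤
      (1 / k) ^ α * Real.Gamma α := by
    rw [← Real.integral_rpow_mul_exp_neg_mul_Ioi hα hk0, ← integral_Ioc_eq_integral_Ioo,
      ← intervalIntegral.integral_of_le ht₀.1,
      intervalIntegral.integral_comp_sub_left (fun x => x ^ (α - 1) * Real.exp (-(k * x))) t₀,
      sub_self, sub_zero, intervalIntegral.integral_of_le ht₀.1]
    refine setIntegral_mono_set hint ?_ (ae_of_all _ Ioc_subset_Ioi_self)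
    exact (ae_restrict_iff' measurableSet_Ioi).2 (ae_of_all _ fun x hx =>
      mul_nonneg (Real.rpow_nonneg (le_of_lt hx) _) (Real.exp_pos _).le)
  have hbound : ∫ s in Ioo 0 t₀, (t₀ - s) ^ (α - 1) * φ s ≤
      Real.exp (k * t₀) * N * ∫ s in Ioo 0 t₀, (t₀ - s) ^ (α - 1) * Real.exp (-(k * (t₀ - s))) := by
    rw [← integral_const_mul]
    refine integral_mono_of_nonneg ?_ ?_ ?_
    · exact (ae_restrict_iff' measurableSet_Ioo).2 (ae_of_all _ fun s hs =>
        mul_nonneg (Real.rpow_nonneg (by linarith [hs.2]) _)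
          (hφ0 s ⟨hs.1.le, hs.2.le.trans ht₀.2⟩))
    · refine Integrable.const_mul ?_ _
      have h1 := integrableOn_Ioo_sub_rpow (a := α - 1) (t := t₀) (by linarith) ht₀.1
      refine Integrable.mul_bdd (c := 1) h1 (Continuous.aestronglyMeasurable (by fun_prop)) ?_
      refine (ae_restrict_iff' measurableSet_Ioo).2 (ae_of_all _ fun s hs => ?_)
      rw [Real.norm_of_nonneg (Real.exp_pos _).le]
      exact Real.exp_le_one_iff.2 (by nlinarith [hs.2])
    · refine (ae_restrict_iff' measurableSet_Ioo).2 (ae_of_all _ fun s hs => ?_)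
      have h1 := hNle s ⟨hs.1.le, hs.2.le.trans ht₀.2⟩
      have h2 : Real.exp (k * s) = Real.exp (k * t₀) * Real.exp (-(k * (t₀ - s))) := by
        rw [← Real.exp_add]; congr 1; ring
      rw [h2] at h1
      have h3 : 0 ≤ (t₀ - s) ^ (α - 1) := Real.rpow_nonneg (by linarith [hs.2]) _
      calc (t₀ - s) ^ (α - 1) * φ s ≤ (t₀ - s) ^ (α - 1) * _ := mul_le_mul_of_nonneg_left h1 h3
        _ = _ := by ring
  have hNhalf : N ≤ N / 2 := by
    have h1 := hle t₀ ht₀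
    have h2 : Real.exp (-(k * t₀)) * Real.exp (k * t₀) = 1 := by rw [← Real.exp_add]; simp
    calc N ≤ Real.exp (-(k * t₀)) * (C * (Real.exp (k * t₀) * N *
          ((1 / k) ^ α * Real.Gamma α))) := by
          rw [hN]
          refine mul_le_mul_of_nonneg_left (h1.trans ?_) (Real.exp_pos _).le
          refine mul_le_mul_of_nonneg_left (hbound.trans ?_) hC
          exact mul_le_mul_of_nonneg_left hrefl (by positivity)
      _ = (Real.exp (-(k * t₀)) * Real.exp (k * t₀)) * N *
          (C * ((1 / k) ^ α * Real.Gamma α)) := by ring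
      _ ≤ 1 * N * (1 / 2) := by rw [h2]; gcongr
      _ = N / 2 := by ring
  have hNz : N = 0 := by linarith
  have := hNle t ht
  rw [hNz, mul_zero] at this
  exact le_antisymm this (hφ0 t ht)

end

/-! ### Uniqueness for a bounded generator -/

section

variable {E : Type*} [NormedAddCommGroup E] [NormedSpace ℝ E]

/-- The kernel `(t - s)^{-α}` is bounded below by `t^{-α}`, so it can be removed; this controls `v`
up to time zero, where local integrability says nothing. -/
lemma integrableOn_of_abel {α : ℝ} (hα : 0 < α) {v : ℝ → E}
    (hv : LocallyIntegrableOn v (Ioi 0)) {t : ℝ}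
    (h : IntegrableOn (fun s => ((t - s) ^ (-α) : ℝ) • v s) (Ioo 0 t)) :
    IntegrableOn v (Ioo 0 t) := by
  refine Integrable.mono' (h.norm.const_mul (t ^ α))
    (hv.aestronglyMeasurable.mono_set Ioo_subset_Ioi_self) ?_
  refine (ae_restrict_iff' measurableSet_Ioo).2 (ae_of_all _ fun s hs => ?_)
  have h1 : 0 < t - s := sub_pos.2 hs.2
  have h2 : (t - s) ^ α ≤ t ^ α := Real.rpow_le_rpow h1.le (by linarith [hs.1]) hα.le
  have h3 := Real.rpow_pos_of_pos h1 (-α)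
  have h4 : (t - s) ^ α * (t - s) ^ (-α) = 1 := by
    rw [← Real.rpow_add h1, add_neg_cancel, Real.rpow_zero]
  rw [norm_smul, Real.norm_of_nonneg h3.le]
  calc ‖v s‖ = (t - s) ^ α * ((t - s) ^ (-α) * ‖v s‖) := by rw [← mul_assoc, h4, one_mul]
    _ ≤ _ := by gcongr

lemma integrableOn_Icc_of_locallyIntegrableOn {F : Type*} [NormedAddCommGroup F] {v : ℝ → F}
    (hv : LocallyIntegrableOn v (Ioi 0))
    {s t : ℝ} (hs : 0 < s) : IntegrableOn v (Icc s t) :=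
  hv.integrableOn_compact_subset (fun _ hx => hs.trans_le hx.1) isCompact_Icc

lemma exists_norm_le_of_primitive {y v : ℝ → E} (hv : LocallyIntegrableOn v (Ioi 0))
    (hyv : ∀ s t : ℝ, 0 < s → s ≤ t → y t - y s = ∫ r in s..t, v r)
    {y₀ : E} (hy0 : Tendsto y (𝓝[>] 0) (𝓝 y₀)) (T : ℝ) : ∃ M, ∀ t ∈ Ioo 0 T, ‖y t‖ ≤ M := by
  have h1 : ∀ᶠ t in 𝓝[>] (0 : ℝ), ‖y t‖ < ‖y₀‖ + 1 :=
    hy0.norm.eventually (gt_mem_nhds (by linarith))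
  obtain ⟨δ, hδ, hδb⟩ := (mem_nhdsGT_iff_exists_Ioo_subset).1 h1
  have hδ0 : (0 : ℝ) < δ := hδ
  set η := δ / 2 with hη
  have hη0 : 0 < η := by positivity
  refine ⟨max (‖y₀‖ + 1) (‖y η‖ + ∫ r in Icc η T, ‖v r‖), fun t ht => ?_⟩
  rcases lt_or_ge t η with h | h
  · exact le_max_of_le_left (le_of_lt (hδb ⟨ht.1, by linarith⟩))
  · refine le_max_of_le_right ?_
    have h2 : y t = y η + ∫ r in η..t, v r := by rw [← hyv η t hη0 h]; abel
    rw [h2]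
    refine (norm_add_le _ _).trans (add_le_add le_rfl ?_)
    refine (intervalIntegral.norm_integral_le_integral_norm h).trans ?_
    rw [intervalIntegral.integral_of_le h]
    refine setIntegral_mono_set
      (integrableOn_Icc_of_locallyIntegrableOn hv hη0).norm
      (ae_of_all _ fun _ => norm_nonneg _) (ae_of_all _ fun r hr => ⟨hr.1.le, hr.2.trans ht.2.le⟩)

lemma eq_integral_of_primitive {y v : ℝ → E}
    (hyv : ∀ s t : ℝ, 0 < s → s ≤ t → y t - y s = ∫ r in s..t, v r)
    (hy0 : Tendsto y (𝓝[>] 0) (𝓝 0)) {t : ℝ} (ht : 0 < t) (hvi : IntegrableOn v (Ioo 0 t)) :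
    y t = ∫ r in (0 : ℝ)..t, v r := by
  have hi : IntegrableOn v (uIcc 0 t) := by
    rw [uIcc_of_le ht.le, integrableOn_Icc_iff_integrableOn_Ioo]; exact hvi
  have hc := intervalIntegral.continuousOn_primitive_interval_left hi
  have h1 : Tendsto (fun s => ∫ r in s..t, v r) (𝓝[>] 0) (𝓝 (∫ r in (0 : ℝ)..t, v r)) := by
    have := hc 0 left_mem_uIcc
    refine this.mono_left (nhdsWithin_le_iff.2 ?_)
    rw [uIcc_of_le ht.le]
    exact Icc_mem_nhdsGT ht
  have h2 : Tendsto (fun s => y t - y s) (𝓝[>] 0) (𝓝 (y t - 0)) := hy0.const_sub _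
  rw [sub_zero] at h2
  refine tendsto_nhds_unique (h2.congr' ?_) h1
  filter_upwards [Ioo_mem_nhdsGT ht] with s hs
  exact hyv s t hs.1 hs.2.le

/-- Uniqueness for the fractional Cauchy problem with a bounded generator. -/
theorem eq_zero_of_abel_eq [CompleteSpace E] {α : ℝ} (hα : 0 < α) (hα1 : α ≤ 1) {y v : ℝ → E}
    (B : E →L[ℝ] E)
    (hv : LocallyIntegrableOn v (Ioi 0))
    (hyv : ∀ s t : ℝ, 0 < s → s ≤ t → y t - y s = ∫ r in s..t, v r)
    (hy0 : Tendsto y (𝓝[>] 0) (𝓝 0))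
    (heq : ∀ᵐ t : ℝ, 0 < t → if α = 1 then v t = B (y t) else
      IntegrableOn (fun s => ((t - s) ^ (-α) : ℝ) • v s) (Ioo 0 t) ∧
        ∫ s in Ioo 0 t, ((t - s) ^ (-α) : ℝ) • v s = B (y t)) :
    ∀ t : ℝ, 0 < t → y t = 0 := by
  have hvi : ∀ T : ℝ, 0 < T → IntegrableOn v (Ioo 0 T) := fun T hT => by
    by_cases h1 : α = 1
    · obtain ⟨M, hM⟩ := exists_norm_le_of_primitive hv hyv hy0 T
      refine IntegrableOn.of_bound (C := ‖B‖ * M) (by simp)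
        (hv.aestronglyMeasurable.mono_set Ioo_subset_Ioi_self) ?_
      rw [ae_restrict_iff' measurableSet_Ioo]
      filter_upwards [heq] with t ht htm
      have := ht htm.1
      rw [if_pos h1] at this
      rw [this]
      exact (B.le_opNorm _).trans (by gcongr; exact hM t htm)
    -- The equation may fail at `T` itself, but it holds at some later time, which suffices.
    · have hT' : ∀ᵐ t ∂(volume.restrict (Ioi T)), 0 < t → if α = 1 then v t = B (y t) else
          IntegrableOn (fun s => ((t - s) ^ (-α) : ℝ) • v s) (Ioo 0 t) ∧
          ∫ s in Ioo 0 t, ((t - s) ^ (-α) : ℝ) • v s = B (y t) := ae_restrict_of_ae heq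
      have : NeBot (ae (volume.restrict (Ioi T))) := by
        rw [ae_neBot, Ne, Measure.restrict_eq_zero]; simp
      obtain ⟨t, ht, htT⟩ := (hT'.and (ae_restrict_mem measurableSet_Ioi)).exists
      have htT' : T < t := htT
      have := ht (hT.trans htT')
      rw [if_neg h1] at this
      exact (integrableOn_of_abel hα hv this.1).mono_set (Ioo_subset_Ioo_right htT'.le)
  have hyi : ∀ t : ℝ, 0 < t → y t = ∫ r in (0 : ℝ)..t, v r := fun t ht =>
    eq_integral_of_primitive hyv hy0 ht (hvi t ht)
  obtain ⟨c, hc, hvol⟩ : ∃ c : ℝ, 0 ≤ c ∧ ∀ t : ℝ, 0 < t →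
      ∫ r in Ioo 0 t, v r = c • ∫ s in Ioo 0 t, ((t - s) ^ (α - 1) : ℝ) • B (y s) := by
    by_cases h1 : α = 1
    · refine ⟨1, zero_le_one, fun t ht => ?_⟩
      rw [one_smul]
      refine setIntegral_congr_ae measurableSet_Ioo ?_
      filter_upwards [heq] with s hs hst
      have := hs hst.1
      rw [if_pos h1] at this
      rw [this, h1, sub_self, Real.rpow_zero, one_smul]
    · have hlt : α < 1 := lt_of_le_of_ne hα1 h1
      have hb := betaConst_pos hα hlt
      refine ⟨(betaConst α)⁻¹, by positivity, fun t ht => ?_⟩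
      have h := integral_abel_inverse hα hlt (hvi t ht)
      have h2 : ∫ s in Ioo 0 t, ((t - s) ^ (α - 1) : ℝ) • B (y s) =
          ∫ s in Ioo 0 t, ((t - s) ^ (α - 1) : ℝ) • ∫ r in Ioo 0 s, ((s - r) ^ (-α) : ℝ) • v r := by
        refine setIntegral_congr_ae measurableSet_Ioo ?_
        filter_upwards [heq] with s hs hst
        have := hs hst.1
        rw [if_neg h1] at this
        rw [this.2]
      rw [h2, h, smul_smul, inv_mul_cancel₀ hb.ne', one_smul]
  intro t ht
  -- The value `y 0` is not prescribed, so the primitive replaces `y`: it agrees with `y` for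
  -- positive times and is continuous down to zero.
  set φ : ℝ → ℝ := fun s => ‖∫ r in (0 : ℝ)..s, v r‖ with hφ
  have hφc : ContinuousOn φ (Icc 0 t) := by
    have hi : IntegrableOn v (uIcc 0 t) := by
      rw [uIcc_of_le ht.le, integrableOn_Icc_iff_integrableOn_Ioo]; exact hvi t ht
    have := (intervalIntegral.continuousOn_primitive_interval hi).norm
    rwa [uIcc_of_le ht.le] at this
  have hle : ∀ s ∈ Icc 0 t, φ s ≤ (c * ‖B‖) * ∫ r in Ioo 0 s, (s - r) ^ (α - 1) * φ r := by
    intro s hs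
    rcases hs.1.eq_or_lt with h0 | h0
    · subst h0; simp [hφ]
    · have h1 : φ s = ‖c • ∫ r in Ioo 0 s, ((s - r) ^ (α - 1) : ℝ) • B (y r)‖ := by
        rw [← hvol s h0, hφ, ← integral_Ioc_eq_integral_Ioo, ← intervalIntegral.integral_of_le h0.le]
      rw [h1, norm_smul, Real.norm_of_nonneg hc, mul_assoc]
      refine mul_le_mul_of_nonneg_left ?_ hc
      rw [← integral_const_mul]
      have hbd : ∀ r ∈ Ioo 0 s, ‖((s - r) ^ (α - 1) : ℝ) • B (y r)‖ ≤
          ‖B‖ * ((s - r) ^ (α - 1) * φ r) := fun r hr => by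
        have hp : 0 ≤ (s - r) ^ (α - 1) := Real.rpow_nonneg (by linarith [hr.2]) _
        rw [norm_smul, Real.norm_of_nonneg hp]
        have hφr : φ r = ‖y r‖ := by rw [hyi r hr.1]
        rw [hφr]
        have := B.le_opNorm (y r)
        calc _ ≤ (s - r) ^ (α - 1) * (‖B‖ * ‖y r‖) := by gcongr
          _ = _ := by ring
      refine norm_integral_le_of_norm_le ?_
        ((ae_restrict_iff' measurableSet_Ioo).2 (ae_of_all _ hbd))
      refine Integrable.const_mul ?_ _
      obtain ⟨M, hM⟩ := isCompact_Icc.exists_bound_of_continuousOn hφc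
      refine Integrable.mul_bdd (c := M)
        (integrableOn_Ioo_sub_rpow (by linarith) hs.1) ?_ ?_
      · exact (hφc.mono fun r hr => ⟨hr.1.le, hr.2.le.trans hs.2⟩).aestronglyMeasurable
          measurableSet_Ioo
      · exact (ae_restrict_iff' measurableSet_Ioo).2
          (ae_of_all _ fun r hr => hM r ⟨hr.1.le, hr.2.le.trans hs.2⟩)
  have := eq_zero_of_le_abel hα (by positivity) hφc (fun _ _ => norm_nonneg _) hle t
    ⟨ht.le, le_rfl⟩
  rw [hyi t ht]
  exact norm_eq_zero.1 this

end

/-! ### Uniqueness of the solution -/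

section

open scoped FourierTransform

lemma exists_mulOp {d : ℕ} {m : Space d → ℂ} (hm : Measurable m) {C : ℝ} (hC : ∀ ξ, ‖m ξ‖ ≤ C) :
    ∃ B : L2 d →L[ℂ] L2 d, ∀ f : L2 d, (B f : Space d → ℂ) =ᵐ[volume] fun ξ => m ξ * f ξ := by
  have hmem : MemLp m ⊤ (volume : Measure (Space d)) :=
    memLp_top_of_bound hm.aestronglyMeasurable C (ae_of_all _ hC)
  refine ⟨(ContinuousLinearMap.mul ℂ ℂ).holderL volume ⊤ 2 2 (hmem.toLp m), fun f => ?_⟩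
  have h1 := ContinuousLinearMap.coeFn_holder (r := 2) (ContinuousLinearMap.mul ℂ ℂ)
    (hmem.toLp m) f
  filter_upwards [h1, hmem.coeFn_toLp] with ξ h1 h2
  rw [ContinuousLinearMap.holderL_apply_apply, h1, h2, ContinuousLinearMap.mul_apply']

lemma I_cpow_mul_phase (α : ℝ) : Complex.I ^ (α : ℂ) * phase α = 1 := by
  rw [Complex.cpow_def_of_ne_zero Complex.I_ne_zero, Complex.log_I, phase, ← Complex.exp_add,
    ← Complex.exp_zero]
  congr 1; push_cast; ring

/-- The principal value `i^α = e^{iπα/2}` is inverse to `phase α`, so the equation can be solved for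
the Caputo derivative. -/
lemma eq_phase_smul_iff {d : ℕ} (α : ℝ) (c w : L2 d) :
    -(Complex.I ^ (α : ℂ)) • c + w = 0 ↔ c = phase α • w := by
  have h := I_cpow_mul_phase α
  constructor
  · intro h1
    have h2 : w = Complex.I ^ (α : ℂ) • c := by
      rw [neg_smul, neg_add_eq_zero] at h1; exact h1.symm
    rw [h2, smul_smul, mul_comm, h, one_smul]
  · rintro rfl
    rw [neg_smul, smul_smul, h, one_smul, neg_add_cancel]

lemma locallyIntegrableOn_clm_comp {E F : Type*} [NormedAddCommGroup E] [NormedSpace ℝ E]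
    [NormedAddCommGroup F] [NormedSpace ℝ F] (P : E →L[ℝ] F) {v : ℝ → E} {s : Set ℝ}
    (hv : LocallyIntegrableOn v s) : LocallyIntegrableOn (fun t => P (v t)) s := fun x hx => by
  obtain ⟨S, hS, hi⟩ := hv x hx
  exact ⟨S, hS, P.integrable_comp hi⟩

/-- Cutting the Fourier transform off at `|ξ| ≤ R` makes the generator bounded. The cut-off
difference of two solutions then vanishes for every `R`. -/
theorem IsSolution.eqOn {d : ℕ} {α : ℝ} (hα : 0 < α) (hα1 : α ≤ 1) {u₀ : L2 d} {u u' : ℝ → L2 d}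
    (hu : IsSolution α α u₀ u) (hu' : IsSolution α α u₀ u') : EqOn u u' (Ioi 0) := by
  obtain ⟨v, w, -, -, hw, hv, huv, heq, hlim⟩ := hu
  obtain ⟨v', w', -, -, hw', hv', huv', heq', hlim'⟩ := hu'
  -- The Gamma factor of the Caputo derivative, moved to the generator because `eq_zero_of_abel_eq`
  -- uses the unnormalized Abel integral.
  set κ : ℝ := if α = 1 then 1 else Real.Gamma (1 - α) with hκ
  have hzero : ∀ R : ℕ, ∀ t : ℝ, 0 < t → ∀ᵐ ξ : Space d, ‖ξ‖ ≤ R →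
      (𝓕 (u t - u' t) : L2 d) ξ = 0 := by
    intro R
    set χ : Space d → ℂ := (Metric.closedBall (0 : Space d) R).indicator fun _ => 1 with hχ
    have hχm : Measurable χ := measurable_const.indicator Metric.isClosed_closedBall.measurableSet
    have hχ1 : ∀ ξ, ‖χ ξ‖ ≤ 1 := fun ξ => by
      rw [hχ, norm_indicator_eq_indicator_norm]
      exact indicator_le_self' (fun _ _ => by simp) ξ |>.trans (by simp)
    obtain ⟨P₀, hP₀⟩ := exists_mulOp hχm hχ1
    set b : Space d → ℂ := fun ξ => κ * phase α * (symbol ξ : ℂ) * χ ξ with hb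
    have hbm : Measurable b := by
      refine Measurable.mul (Measurable.mul measurable_const ?_) hχm
      exact (hasTemperateGrowth_symbol (d := d)).1.continuous.measurable
    have hbC : ∀ ξ, ‖b ξ‖ ≤ |κ| * (2 * Real.pi * R) ^ 2 := fun ξ => by
      by_cases h : ξ ∈ Metric.closedBall (0 : Space d) R
      · rw [mem_closedBall_zero_iff] at h
        rw [hb]
        simp only [norm_mul, norm_phase, mul_one, Complex.norm_real, Real.norm_eq_abs]
        have h1 : |symbol ξ| ≤ (2 * Real.pi * R) ^ 2 := by
          have := Real.pi_pos
          rw [symbol, abs_of_nonneg (by positivity)]; gcongr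
        calc |κ| * |symbol ξ| * ‖χ ξ‖ ≤ |κ| * (2 * Real.pi * R) ^ 2 * 1 := by
              gcongr; exact hχ1 ξ
          _ = _ := by ring
      · have : χ ξ = 0 := indicator_of_notMem h _
        rw [hb]; simp only [this, mul_zero, norm_zero]; positivity
    obtain ⟨B₀, hB₀⟩ := exists_mulOp hbm hbC
    set P : L2 d →L[ℝ] L2 d := (P₀ ∘L (Lp.fourierTransformₗᵢ (Space d) ℂ :
      L2 d →L[ℂ] L2 d)).restrictScalars ℝ with hP
    have hPa : ∀ f : L2 d, P f = P₀ (𝓕 f) := fun f => rfl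
    set B : L2 d →L[ℝ] L2 d := B₀.restrictScalars ℝ with hB
    have hBP : ∀ f g : L2 d, FreeHamiltonian f g → B (P f) = κ • P (phase α • g) := by
      intro f g hfg
      rw [freeHamiltonian_iff] at hfg
      rw [hPa, hPa]
      refine Lp.ext ?_
      have e1 : (𝓕 (phase α • g) : L2 d) = phase α • (𝓕 g : L2 d) :=
        FourierTransform.fourier_smul _ _
      rw [e1, map_smul]
      filter_upwards [hB₀ (P₀ (𝓕 f)), hP₀ (𝓕 f), hP₀ (𝓕 g), hfg,
        Lp.coeFn_smul κ (phase α • P₀ (𝓕 g)), Lp.coeFn_smul (phase α) (P₀ (𝓕 g))]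
        with ξ h1 h2 h3 h4 h5 h6
      rw [h5, Pi.smul_apply, h6, Pi.smul_apply, h3, h4, Complex.real_smul]
      change (B₀ (P₀ (𝓕 f)) : Space d → ℂ) ξ = _
      rw [h1, h2, hb, smul_eq_mul]
      have : χ ξ * χ ξ = χ ξ := by
        by_cases h : ξ ∈ Metric.closedBall (0 : Space d) R
        · rw [hχ, indicator_of_mem h, one_mul]
        · rw [hχ, indicator_of_notMem h, zero_mul]
      linear_combination (κ * phase α * symbol ξ * (𝓕 f : L2 d) ξ) * this
    have key := eq_zero_of_abel_eq hα hα1 (y := fun t => P (u t - u' t))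
      (v := fun t => P (v t - v' t)) B (locallyIntegrableOn_clm_comp P (hv.sub hv')) ?_ ?_ ?_
    · intro t ht
      have h1 := key t ht
      simp only [hPa] at h1
      have h2 := hP₀ (𝓕 (u t - u' t))
      rw [h1] at h2
      filter_upwards [h2, Lp.coeFn_zero ℂ 2 (volume : Measure (Space d))] with ξ h3 h4 hξ
      rw [h4, hχ, indicator_of_mem (by rwa [mem_closedBall_zero_iff]), one_mul] at h3
      exact h3.symm
    · intro s t hs hst
      have hi : IntervalIntegrable v volume s t := by
        rw [intervalIntegrable_iff_integrableOn_Icc_of_le hst]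
        exact integrableOn_Icc_of_locallyIntegrableOn hv hs
      have hi' : IntervalIntegrable v' volume s t := by
        rw [intervalIntegrable_iff_integrableOn_Icc_of_le hst]
        exact integrableOn_Icc_of_locallyIntegrableOn hv' hs
      rw [P.intervalIntegral_comp_comm (hi.sub hi'), intervalIntegral.integral_sub hi hi',
        ← huv s t hs hst, ← huv' s t hs hst, ← map_sub]
      congr 1; abel
    · have h1 : Tendsto (fun t => u t - u' t) (𝓝[>] 0) (𝓝 0) := by
        have h2 := tendsto_iff_norm_sub_tendsto_zero.2 hlim
        have h3 := tendsto_iff_norm_sub_tendsto_zero.2 hlim'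
        simpa using h2.sub h3
      have := (P.continuous.tendsto 0).comp h1
      rwa [map_zero] at this
    · filter_upwards [hw, hw', heq, heq'] with t h1 h2 h3 h4 ht
      obtain ⟨c, hc, hcw⟩ := h3 ht
      obtain ⟨c', hc', hcw'⟩ := h4 ht
      rw [eq_phase_smul_iff] at hcw hcw'
      have h5 := hBP _ _ (h1 ht)
      have h6 := hBP _ _ (h2 ht)
      rw [← hcw] at h5
      rw [← hcw'] at h6
      have h7 : B (P (u t - u' t)) = κ • P (c - c') := by
        rw [map_sub, map_sub, h5, h6, map_sub, smul_sub]
      by_cases h : α = 1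
      · rw [if_pos h, h7, hκ, if_pos h, one_smul]
        rw [HasCaputo, if_pos h] at hc hc'
        rw [hc, hc']
      · rw [if_neg h, h7, hκ, if_neg h]
        rw [HasCaputo, if_neg h] at hc hc'
        have hG : Real.Gamma (1 - α) ≠ 0 :=
          (Real.Gamma_pos_of_pos (sub_pos.2 (lt_of_le_of_ne hα1 h))).ne'
        have hi := hc.1.sub hc'.1
        have e : ∀ s : ℝ, ((t - s) ^ (-α) : ℝ) • P (v s - v' s) =
            P (((t - s) ^ (-α) : ℝ) • v s - ((t - s) ^ (-α) : ℝ) • v' s) := fun s => by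
          rw [← smul_sub, map_smul]
        simp_rw [e]
        refine ⟨P.integrable_comp hi, ?_⟩
        have hint := P.integral_comp_comm hi
        simp only [Pi.sub_apply] at hint
        rw [hint, integral_sub hc.1 hc'.1, ← hc.2, ← hc'.2, ← smul_sub,
          map_smul, smul_smul, mul_inv_cancel₀ hG, one_smul]
  intro t ht
  have hall : ∀ᵐ ξ : Space d, ∀ R : ℕ, ‖ξ‖ ≤ R → (𝓕 (u t - u' t) : L2 d) ξ = 0 :=
    ae_all_iff.2 fun R => hzero R t ht
  have h0 : (𝓕 (u t - u' t) : L2 d) = 0 := by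
    refine Lp.ext ?_
    filter_upwards [hall, Lp.coeFn_zero ℂ 2 (volume : Measure (Space d))] with ξ h1 h2
    obtain ⟨R, hR⟩ := exists_nat_ge ‖ξ‖
    rw [h1 R hR, h2]; rfl
  have h1 : ‖u t - u' t‖ = 0 := by rw [← Lp.norm_fourier_eq, h0, norm_zero]
  exact sub_eq_zero.1 (norm_eq_zero.1 h1)

end

/-! ### Families of square integrable functions depending on time -/

section

open scoped FourierTransform

lemma norm_sq_L2 {d : ℕ} (f : L2 d) : ‖f‖ ^ 2 = ∫ ξ : Space d, ‖f ξ‖ ^ 2 := by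
  have h := L2.inner_def (𝕜 := ℂ) f f
  rw [inner_self_eq_norm_sq_to_K] at h
  have h2 : (∫ ξ : Space d, inner ℂ (f ξ) (f ξ)) = ((∫ ξ : Space d, ‖f ξ‖ ^ 2 : ℝ) : ℂ) := by
    refine (integral_congr_ae (ae_of_all _ fun ξ => ?_)).trans integral_ofReal
    rw [inner_self_eq_norm_sq_to_K]; push_cast; rfl
  rw [h2, ← RCLike.ofReal_pow] at h
  exact Complex.ofReal_injective h

lemma integrable_norm_sq_L2 {d : ℕ} (f : L2 d) : Integrable fun ξ : Space d => ‖f ξ‖ ^ 2 :=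
  (memLp_two_iff_integrable_sq_norm (Lp.memLp f).1).1 (Lp.memLp f)

/-- The class in `L²` of a square integrable function, and zero for other functions. -/
def toL2 {d : ℕ} (f : Space d → ℂ) : L2 d :=
  open Classical in if h : MemLp f 2 volume then h.toLp f else 0

lemma coeFn_toL2 {d : ℕ} {f : Space d → ℂ} (hf : MemLp f 2 volume) :
    (toL2 f : Space d → ℂ) =ᵐ[volume] f := by
  rw [toL2, dif_pos hf]; exact hf.coeFn_toLp

lemma memLp_of_norm_le {d : ℕ} {f : Space d → ℂ} {h : Space d → ℝ} (hh : MemLp h 2 volume)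
    (hf : Measurable f) {b : ℝ} (hb : ∀ ξ, ‖f ξ‖ ≤ b * h ξ) : MemLp f 2 volume := by
  refine (hh.const_mul b).mono hf.aestronglyMeasurable (ae_of_all _ fun ξ => ?_)
  exact (hb ξ).trans (le_abs_self _)

/-- A pointwise continuous, locally dominated family is continuous in `L²`. -/
lemma continuousOn_toL2 {d : ℕ} {M : ℝ → Space d → ℂ} {h : Space d → ℝ} {b : ℝ → ℝ} {S : Set ℝ}
    (hh : MemLp h 2 volume) (hM : ∀ t, Measurable (M t)) (hb : ContinuousOn b S)
    (hMb : ∀ t ∈ S, ∀ ξ, ‖M t ξ‖ ≤ b t * h ξ) (hMc : ∀ ξ, ContinuousOn (fun t => M t ξ) S) :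
    ContinuousOn (fun t => toL2 (M t)) S := by
  intro t₀ ht₀
  have hmem : ∀ t ∈ S, MemLp (M t) 2 volume := fun t ht => memLp_of_norm_le hh (hM t) (hMb t ht)
  have hsq : Tendsto (fun t => ‖toL2 (M t) - toL2 (M t₀)‖ ^ 2) (𝓝[S] t₀) (𝓝 0) := by
    have key : Tendsto (fun t => ∫ ξ : Space d, ‖M t ξ - M t₀ ξ‖ ^ 2) (𝓝[S] t₀)
        (𝓝 (∫ _ : Space d, (0 : ℝ))) := by
      refine tendsto_integral_filter_of_dominated_convergence
        (fun ξ => ((|b t₀| + 1 + |b t₀|) * |h ξ|) ^ 2) ?_ ?_ ?_ ?_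
      · exact Eventually.of_forall fun t =>
          (((hM t).sub (hM t₀)).norm.pow_const 2).aestronglyMeasurable
      · have hev : ∀ᶠ t in 𝓝[S] t₀, |b t| < |b t₀| + 1 :=
          (hb t₀ ht₀).abs.eventually (gt_mem_nhds (by linarith))
        filter_upwards [hev, self_mem_nhdsWithin] with t h1 htS
        refine ae_of_all _ fun ξ => ?_
        rw [norm_pow, norm_norm]
        gcongr
        refine (norm_sub_le _ _).trans ?_
        rw [add_mul]
        have e1 : b t * h ξ ≤ |b t| * |h ξ| := by rw [← abs_mul]; exact le_abs_self _
        have e2 : b t₀ * h ξ ≤ |b t₀| * |h ξ| := by rw [← abs_mul]; exact le_abs_self _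
        refine add_le_add ((hMb t htS ξ).trans (e1.trans ?_)) ((hMb t₀ ht₀ ξ).trans e2)
        gcongr
      · have := (memLp_two_iff_integrable_sq hh.1).1 hh
        simp_rw [mul_pow, sq_abs]
        exact this.const_mul _
      · refine ae_of_all _ fun ξ => ?_
        have := ((hMc ξ t₀ ht₀).sub_const (M t₀ ξ)).norm.pow 2
        simpa using this
    rw [integral_zero] at key
    refine key.congr' ?_
    filter_upwards [self_mem_nhdsWithin] with t ht
    rw [norm_sq_L2]
    refine integral_congr_ae ?_
    filter_upwards [Lp.coeFn_sub (toL2 (M t)) (toL2 (M t₀)), coeFn_toL2 (hmem t ht),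
      coeFn_toL2 (hmem t₀ ht₀)] with ξ h1 h2 h3
    rw [h1, Pi.sub_apply, h2, h3]
  rw [ContinuousWithinAt, tendsto_iff_norm_sub_tendsto_zero]
  have := hsq.sqrt
  simpa [Real.sqrt_sq (norm_nonneg _)] using this

/-- The Bochner integral of a dominated family in `L²` is computed pointwise. -/
lemma integral_toL2 {d : ℕ} {M : ℝ → Space d → ℂ} {h : Space d → ℝ} {b : ℝ → ℝ} {A : Set ℝ}
    (hA : MeasurableSet A) (hh : MemLp h 2 volume) (hM : Measurable (Function.uncurry M))
    (hb : IntegrableOn b A) (hb0 : ∀ t ∈ A, 0 ≤ b t)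
    (hMb : ∀ t ∈ A, ∀ ξ, ‖M t ξ‖ ≤ b t * h ξ)
    (hU : AEStronglyMeasurable (fun t => toL2 (M t)) (volume.restrict A)) :
    IntegrableOn (fun t => toL2 (M t)) A ∧
      (∫ t in A, toL2 (M t)) = toL2 fun ξ => ∫ t in A, M t ξ := by
  have hMt : ∀ t, Measurable (M t) := fun t => hM.comp measurable_prodMk_left
  have hmem : ∀ t ∈ A, MemLp (M t) 2 volume := fun t ht => memLp_of_norm_le hh (hMt t) (hMb t ht)
  have hae : ∀ {p : ℝ → Prop}, (∀ t ∈ A, p t) → ∀ᵐ t ∂volume.restrict A, p t := fun hp =>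
    (ae_restrict_iff' hA).2 (ae_of_all _ hp)
  have hUb : ∀ t ∈ A, ‖toL2 (M t)‖ ≤ b t * ‖hh.toLp h‖ := fun t ht => by
    refine Lp.norm_le_mul_norm_of_ae_le_mul ?_
    filter_upwards [coeFn_toL2 (hmem t ht), hh.coeFn_toLp] with ξ h1 h2
    rw [h1, h2]
    exact (hMb t ht ξ).trans (mul_le_mul_of_nonneg_left (Real.le_norm_self _) (hb0 t ht))
  have hUi : IntegrableOn (fun t => toL2 (M t)) A :=
    Integrable.mono' (hb.mul_const _) hU (hae hUb)
  have hMi : ∀ ξ, IntegrableOn (fun t => M t ξ) A := fun ξ =>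
    Integrable.mono' (hb.mul_const (h ξ))
      (hM.comp measurable_prodMk_right).aestronglyMeasurable (hae fun t ht => hMb t ht ξ)
  have hVmem : MemLp (fun ξ => ∫ t in A, M t ξ) 2 volume := by
    refine memLp_of_norm_le hh
      hM.stronglyMeasurable.integral_prod_left.measurable (b := ∫ t in A, b t) fun ξ => ?_
    rw [← integral_mul_const]
    exact norm_integral_le_of_norm_le (hb.mul_const _) (hae fun t ht => hMb t ht ξ)
  -- The identity is checked weakly: pairing with `ψ` commutes with the Bochner integral, and Fubini
  -- exchanges time and frequency.
  refine ⟨hUi, ext_inner_left ℂ fun ψ => ?_⟩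
  have hψ : Integrable (fun ξ => ‖ψ ξ‖ * h ξ) (volume : Measure (Space d)) :=
    (Lp.memLp ψ).norm.integrable_mul hh
  have hprod : Integrable (Function.uncurry fun t ξ => inner ℂ (ψ ξ) (M t ξ))
      ((volume.restrict A).prod volume) := by
    refine Integrable.mono' (Integrable.mul_prod hb hψ) ?_ ?_
    · exact (Lp.memLp ψ).1.comp_snd.inner hM.aestronglyMeasurable
    · have h1 : ∀ᵐ p ∂((volume.restrict A).prod (volume : Measure (Space d))), p.1 ∈ A :=
        Measure.quasiMeasurePreserving_fst.ae (ae_restrict_mem hA)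
      filter_upwards [h1] with p hp
      refine (norm_inner_le_norm _ _).trans ?_
      calc ‖ψ p.2‖ * ‖M p.1 p.2‖ ≤ ‖ψ p.2‖ * (b p.1 * h p.2) := by gcongr; exact hMb _ hp _
        _ = _ := by ring
  have hswap := integral_integral_swap hprod
  rw [← integral_inner hUi ψ, L2.inner_def]
  calc ∫ t in A, inner ℂ ψ (toL2 (M t))
      = ∫ t in A, ∫ ξ, inner ℂ (ψ ξ) (M t ξ) := by
        refine setIntegral_congr_fun hA fun t ht => ?_
        rw [L2.inner_def]
        refine integral_congr_ae ?_
        filter_upwards [coeFn_toL2 (hmem t ht)] with ξ h1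
        rw [h1]
    _ = ∫ ξ, ∫ t in A, inner ℂ (ψ ξ) (M t ξ) := hswap
    _ = _ := by
        refine integral_congr_ae ?_
        filter_upwards [coeFn_toL2 hVmem] with ξ h1
        rw [h1, integral_inner (hMi ξ)]

end

/-! ### The propagator as a Fourier multiplier -/

section

open scoped FourierTransform

lemma measurable_kern (α : ℝ) : Measurable (kern α) := by
  unfold kern; fun_prop

lemma measurable_relaxRem (α : ℝ) : Measurable (relaxRem α) := by
  have h : Measurable (Function.uncurry fun (τ r : ℝ) =>
      (r : ℂ) * kern α r * Real.exp (-(r * τ))) := by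
    have : Measurable fun p : ℝ × ℝ => kern α p.2 := (measurable_kern α).comp measurable_snd
    exact Measurable.mul (Measurable.mul (by fun_prop) this) (by fun_prop)
  exact h.stronglyMeasurable.integral_prod_right.measurable

lemma measurable_relaxDeriv (α : ℝ) : Measurable (relaxDeriv α) :=
  Measurable.sub (by fun_prop) (measurable_relaxRem α)

lemma measurable_relax (α : ℝ) : Measurable (relax α) := by
  have h : Measurable (Function.uncurry fun (τ r : ℝ) => kern α r * Real.exp (-(r * τ))) := by
    have : Measurable fun p : ℝ × ℝ => kern α p.2 := (measurable_kern α).comp measurable_snd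
    exact Measurable.mul this (by fun_prop)
  exact Measurable.add (by fun_prop) h.stronglyMeasurable.integral_prod_right.measurable

variable {d : ℕ}

/-- The weight `(1 + |ξ|²)^p`. -/
def weight (p : ℝ) (ξ : Space d) : ℝ := (1 + ‖ξ‖ ^ 2) ^ p

lemma one_le_weight {p : ℝ} (hp : 0 ≤ p) (ξ : Space d) : 1 ≤ weight p ξ :=
  Real.one_le_rpow (by nlinarith [sq_nonneg ‖ξ‖]) hp

lemma weight_mono {p q : ℝ} (hpq : p ≤ q) (ξ : Space d) : weight p ξ ≤ weight q ξ :=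
  Real.rpow_le_rpow_of_exponent_le (by nlinarith [sq_nonneg ‖ξ‖]) hpq

lemma norm_rpow_le_weight {a p : ℝ} (ha : 0 ≤ a) (hap : a ≤ 2 * p) (ξ : Space d) :
    ‖ξ‖ ^ a ≤ weight p ξ := by
  have h1 : ‖ξ‖ ^ a = (‖ξ‖ ^ 2) ^ (a / 2) := by
    rw [← Real.rpow_natCast, ← Real.rpow_mul (norm_nonneg _)]; congr 1; push_cast; ring
  rw [h1]
  refine (Real.rpow_le_rpow (by positivity) (by linarith : ‖ξ‖ ^ 2 ≤ 1 + ‖ξ‖ ^ 2)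
    (by positivity)).trans ?_
  exact weight_mono (by linarith) ξ

lemma memLp_weight_mul (f : 𝓢(Space d, ℂ)) (p : ℝ) (q : ENNReal) :
    MemLp (fun ξ => weight p ξ * ‖f ξ‖) q volume := by
  have hW : (fun ξ : Space d => (weight p ξ : ℂ)).HasTemperateGrowth := by
    have := Function.hasTemperateGrowth_one_add_norm_sq_rpow (Space d) p
    unfold weight; fun_prop
  have h := ((SchwartzMap.smulLeftCLM ℂ (fun ξ : Space d => (weight p ξ : ℂ)) f).memLp q
    (volume : Measure (Space d))).norm
  convert h using 2 with ξ
  rw [SchwartzMap.smulLeftCLM_apply_apply hW, norm_smul, Complex.norm_real, Real.norm_of_nonneg]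
  exact Real.rpow_nonneg (by positivity) _

/-- The frequency `|2πξ|^{2/α}` of the oscillating part of the solution. -/
def freq (α : ℝ) (ξ : Space d) : ℝ := symbol ξ ^ (1 / α)

lemma symbol_nonneg (ξ : Space d) : 0 ≤ symbol ξ := sq_nonneg _

lemma freq_nonneg (α : ℝ) (ξ : Space d) : 0 ≤ freq α ξ := Real.rpow_nonneg (symbol_nonneg ξ) _

lemma continuous_symbol : Continuous (symbol : Space d → ℝ) := by
  unfold symbol; fun_prop

lemma continuous_freq {α : ℝ} (hα : 0 < α) : Continuous (freq α : Space d → ℝ) :=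
  continuous_symbol.rpow_const fun _ => Or.inr (by positivity)

lemma freq_rpow {α : ℝ} (hα : 0 < α) (ξ : Space d) : freq α ξ ^ α = symbol ξ := by
  rw [freq, ← Real.rpow_mul (symbol_nonneg ξ), one_div, inv_mul_cancel₀ hα.ne', Real.rpow_one]

/-- Because `1/α ≥ 1`, the single weight `(1 + |ξ|²)^{1/α}` dominates both growth rates; it is used
for all later estimates. -/
lemma exists_symbol_freq_le {α : ℝ} (hα : 0 < α) (hα1 : α ≤ 1) : ∃ C : ℝ, 1 ≤ C ∧
    ∀ ξ : Space d, symbol ξ ≤ C * weight (1 / α) ξ ∧ freq α ξ ≤ C * weight (1 / α) ξ := by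
  have hpi := Real.pi_gt_three
  have h1α : 1 ≤ 1 / α := (one_le_div hα).2 hα1
  have hC1 : (1 : ℝ) ≤ (2 * Real.pi) ^ 2 := by nlinarith
  have hC : (2 * Real.pi) ^ 2 ≤ ((2 * Real.pi) ^ 2) ^ (1 / α) :=
    Real.self_le_rpow_of_one_le hC1 h1α
  refine ⟨((2 * Real.pi) ^ 2) ^ (1 / α), hC1.trans hC, fun ξ => ?_⟩
  have hs : symbol ξ ≤ (2 * Real.pi) ^ 2 * (1 + ‖ξ‖ ^ 2) := by
    rw [symbol, mul_pow]; gcongr; linarith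
  constructor
  · refine hs.trans ?_
    have : 1 + ‖ξ‖ ^ 2 ≤ weight (1 / α) ξ :=
      Real.self_le_rpow_of_one_le (by nlinarith [sq_nonneg ‖ξ‖]) h1α
    gcongr
  · rw [freq, weight, ← Real.mul_rpow (by positivity) (by positivity)]
    exact Real.rpow_le_rpow (symbol_nonneg ξ) hs (by positivity)

/-- The multiplier of the solution operator. -/
def propagator (α t : ℝ) (ξ : Space d) : ℂ := relax α (freq α ξ * t)

/-- The time derivative of `propagator`. -/
def propagatorDeriv (α t : ℝ) (ξ : Space d) : ℂ := freq α ξ * relaxDeriv α (freq α ξ * t)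

lemma hasDerivAt_propagator {α : ℝ} (hα : 0 < α) (hα1 : α ≤ 1) (ξ : Space d) {t : ℝ} (ht : 0 < t) :
    HasDerivAt (fun t => propagator α t ξ) (propagatorDeriv α t ξ) t := by
  rcases (freq_nonneg α ξ).eq_or_lt with h | h
  · simp only [propagator, propagatorDeriv, ← h, zero_mul, Complex.ofReal_zero]
    exact hasDerivAt_const _ _
  · have h1 := (hasDerivAt_relax hα hα1 (mul_pos h ht)).scomp t
      ((hasDerivAt_id t).const_mul (freq α ξ))
    refine h1.congr_deriv ?_
    simp [propagatorDeriv]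

lemma continuousOn_propagator {α : ℝ} (hα : 0 < α) (hα1 : α ≤ 1) (ξ : Space d) :
    ContinuousOn (fun t => propagator α t ξ) (Ici 0) :=
  (continuousOn_relax hα hα1).comp (by fun_prop) fun _ ht => mul_nonneg (freq_nonneg α ξ) ht

lemma continuousOn_propagatorDeriv {α : ℝ} (hα : 0 < α) (hα1 : α ≤ 1) (ξ : Space d) :
    ContinuousOn (fun t => propagatorDeriv α t ξ) (Ioi 0) := by
  rcases (freq_nonneg α ξ).eq_or_lt with h | h
  · simp only [propagatorDeriv, ← h, Complex.ofReal_zero, zero_mul]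
    exact continuousOn_const
  · exact continuousOn_const.mul ((continuousOn_relaxDeriv hα hα1).comp (by fun_prop)
      fun _ ht => mul_pos h ht)

lemma measurable_propagator {α : ℝ} (hα : 0 < α) :
    Measurable (Function.uncurry (propagator α : ℝ → Space d → ℂ)) := by
  have := (continuous_freq (d := d) hα).measurable
  exact (measurable_relax α).comp (by fun_prop)

lemma measurable_propagatorDeriv {α : ℝ} (hα : 0 < α) :
    Measurable (Function.uncurry (propagatorDeriv α : ℝ → Space d → ℂ)) := by
  have := (continuous_freq (d := d) hα).measurable
  have h2 : Measurable fun p : ℝ × Space d => relaxDeriv α (freq α p.2 * p.1) :=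
    (measurable_relaxDeriv α).comp (by fun_prop)
  have h3 : Measurable fun p : ℝ × Space d => (freq α p.2 : ℂ) := by fun_prop
  exact h3.mul h2

lemma exists_norm_propagatorDeriv_le {α : ℝ} (hα : 0 < α) (hα1 : α ≤ 1) : ∃ C : ℝ, 0 < C ∧
    ∀ (t : ℝ) (ξ : Space d), 0 < t →
      ‖propagatorDeriv α t ξ‖ ≤ C * (1 + t ^ (α - 1)) * weight (1 / α) ξ := by
  obtain ⟨C, hC, hCb⟩ := exists_norm_relaxDeriv_le hα hα1
  obtain ⟨D, hD, hDb⟩ := exists_symbol_freq_le (d := d) hα hα1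
  refine ⟨C * D, by positivity, fun t ξ ht => ?_⟩
  obtain ⟨h1, h2⟩ := hDb ξ
  have hw : 0 < weight (1 / α) ξ := one_pos.trans_le (one_le_weight (by positivity) ξ)
  have htp := Real.rpow_pos_of_pos ht (α - 1)
  rw [propagatorDeriv, norm_mul, Complex.norm_real, Real.norm_of_nonneg (freq_nonneg α ξ)]
  rcases (freq_nonneg α ξ).eq_or_lt with h | h
  · rw [← h, zero_mul]; positivity
  -- The singularity at `τ = 0` separates: its frequency part becomes the harmless `symbol`, leaving
  -- the integrable `t^{α-1}` uniformly in `ξ`.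
  · have e : freq α ξ * (freq α ξ * t) ^ (α - 1) = symbol ξ * t ^ (α - 1) := by
      rw [Real.mul_rpow h.le ht.le, Real.rpow_sub_one h.ne', freq_rpow hα]
      field_simp
    calc freq α ξ * ‖relaxDeriv α (freq α ξ * t)‖
        ≤ freq α ξ * (C * (1 + (freq α ξ * t) ^ (α - 1))) := by
          gcongr; exact hCb _ (mul_pos h ht)
      _ = C * (freq α ξ + symbol ξ * t ^ (α - 1)) := by rw [← e]; ring
      _ ≤ C * (D * weight (1 / α) ξ + D * weight (1 / α) ξ * t ^ (α - 1)) := by gcongr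
      _ = _ := by ring

/-- Rescaling time by `k = freq α ξ` reduces this to the Abel equation of `relax` and produces the
factor `k^α = symbol ξ`. At zero frequency both sides vanish. -/
lemma integral_abel_propagatorDeriv {α : ℝ} (hα : 0 < α) (hα1 : α < 1) {t : ℝ} (ht : 0 < t)
    (ξ : Space d) :
    ∫ s in Ioo 0 t, ((t - s) ^ (-α) : ℝ) • propagatorDeriv α s ξ =
      Real.Gamma (1 - α) * (phase α * (symbol ξ * propagator α t ξ)) := by
  rcases (freq_nonneg α ξ).eq_or_lt with h | h
  · have hs : symbol ξ = 0 := by rw [← freq_rpow hα, ← h, Real.zero_rpow hα.ne']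
    simp [propagatorDeriv, ← h, hs]
  · set k := freq α ξ with hk
    have h1 := intervalIntegral.integral_comp_mul_left (a := 0) (b := t)
      (fun σ => ((k * t - σ) ^ (-α) : ℝ) • relaxDeriv α σ) h.ne'
    rw [mul_zero, intervalIntegral.integral_of_le ht.le,
      intervalIntegral.integral_of_le (by positivity), integral_Ioc_eq_integral_Ioo,
      integral_Ioc_eq_integral_Ioo] at h1
    have h2 := relaxAbel_eq_relax hα hα1 (mul_pos h ht)
    have h3 : ∀ s ∈ Ioo 0 t, ((t - s) ^ (-α) : ℝ) • propagatorDeriv α s ξ =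
        (k * k ^ α) • (((k * t - k * s) ^ (-α) : ℝ) • relaxDeriv α (k * s)) := fun s hs => by
      have e1 : k * t - k * s = k * (t - s) := by ring
      have e2 : k ^ α * k ^ (-α) = 1 := by rw [← Real.rpow_add h, add_neg_cancel, Real.rpow_zero]
      rw [e1, Real.mul_rpow h.le (by linarith [hs.2]), propagatorDeriv, ← hk, smul_smul]
      have e3 : k * k ^ α * (k ^ (-α) * (t - s) ^ (-α)) = (t - s) ^ (-α) * k := by
        calc _ = (k ^ α * k ^ (-α)) * ((t - s) ^ (-α) * k) := by ring
          _ = _ := by rw [e2, one_mul]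
      rw [e3, mul_smul]
      simp
    rw [setIntegral_congr_fun measurableSet_Ioo h3, integral_smul, h1, smul_smul]
    have e : k * k ^ α * k⁻¹ = symbol ξ := by
      rw [hk, freq_rpow hα, ← hk]; field_simp
    rw [e]
    change symbol ξ • relaxAbel α (k * t) = _
    rw [h2, propagator, ← hk, Complex.real_smul]
    ring

end

/-! ### Existence of the solution -/

section

open scoped FourierTransform

lemma ofReal_smul_L2 {d : ℕ} (r : ℝ) (f : L2 d) : (r : ℂ) • f = r • f := by
  refine Lp.ext ?_
  filter_upwards [Lp.coeFn_smul (r : ℂ) f, Lp.coeFn_smul r f] with ξ h1 h2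
  rw [h1, h2, Pi.smul_apply, Pi.smul_apply, Complex.coe_smul]

lemma toL2_const_mul {d : ℕ} {f : Space d → ℂ} (hf : MemLp f 2 volume) (c : ℂ) :
    toL2 (fun ξ => c * f ξ) = c • toL2 f := by
  refine Lp.ext ?_
  filter_upwards [coeFn_toL2 hf, coeFn_toL2 (hf.const_mul c), Lp.coeFn_smul c (toL2 f)]
    with ξ h1 h2 h3
  rw [h2, h3, Pi.smul_apply, h1, smul_eq_mul]

lemma toL2_sub {d : ℕ} {f g : Space d → ℂ} (hf : MemLp f 2 volume) (hg : MemLp g 2 volume) :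
    toL2 (fun ξ => f ξ - g ξ) = toL2 f - toL2 g := by
  refine Lp.ext ?_
  filter_upwards [coeFn_toL2 hf, coeFn_toL2 hg, coeFn_toL2 (hf.sub hg),
    Lp.coeFn_sub (toL2 f) (toL2 g)] with ξ h1 h2 h3 h4
  rw [h4, Pi.sub_apply, h1, h2]
  exact h3

variable {d : ℕ}

/-- The Fourier transform of the solution whose initial value has Fourier transform `f`. -/
def fourierSolution (α : ℝ) (f : 𝓢(Space d, ℂ)) (t : ℝ) (ξ : Space d) : ℂ :=
  propagator α t ξ * f ξ

/-- The time derivative of `fourierSolution`. -/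
def fourierSolutionDeriv (α : ℝ) (f : 𝓢(Space d, ℂ)) (t : ℝ) (ξ : Space d) : ℂ :=
  propagatorDeriv α t ξ * f ξ

/-- The solution with initial value `u₀`. -/
def solution (α : ℝ) (u₀ : 𝓢(Space d, ℂ)) (t : ℝ) : L2 d := 𝓕⁻ (toL2 (fourierSolution α (𝓕 u₀) t))

section

variable {α : ℝ}

lemma measurable_fourierSolution (hα : 0 < α) (f : 𝓢(Space d, ℂ)) :
    Measurable (Function.uncurry (fourierSolution α f)) :=
  (measurable_propagator hα).mul (f.continuous.measurable.comp measurable_snd)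

lemma measurable_fourierSolutionDeriv (hα : 0 < α) (f : 𝓢(Space d, ℂ)) :
    Measurable (Function.uncurry (fourierSolutionDeriv α f)) :=
  (measurable_propagatorDeriv hα).mul (f.continuous.measurable.comp measurable_snd)

lemma exists_norm_fourierSolution_le (hα : 0 < α) (hα1 : α ≤ 1) (f : 𝓢(Space d, ℂ)) : ∃ C : ℝ,
    0 < C ∧ ∀ t, 0 ≤ t → ∀ ξ,
    ‖fourierSolution α f t ξ‖ ≤ C * (weight (1 / α) ξ * ‖f ξ‖) ∧
    ‖symbol ξ * fourierSolution α f t ξ‖ ≤ C * (weight (1 / α) ξ * ‖f ξ‖) := by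
  obtain ⟨C, hC, hCb⟩ := exists_norm_relax_le hα hα1
  obtain ⟨D, hD, hDb⟩ := exists_symbol_freq_le (d := d) hα hα1
  refine ⟨D * C, by positivity, fun t ht ξ => ?_⟩
  have h1 : ‖propagator α t ξ‖ ≤ C := hCb _ (mul_nonneg (freq_nonneg α ξ) ht)
  have hw : 1 ≤ weight (1 / α) ξ := one_le_weight (by positivity) ξ
  simp only [fourierSolution, norm_mul, Complex.norm_real, Real.norm_of_nonneg (symbol_nonneg ξ)]
  constructor
  · calc ‖propagator α t ξ‖ * ‖f ξ‖ = 1 * ‖propagator α t ξ‖ * (1 * ‖f ξ‖) := by ring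
      _ ≤ D * C * (weight (1 / α) ξ * ‖f ξ‖) := by gcongr
  · calc symbol ξ * (‖propagator α t ξ‖ * ‖f ξ‖)
        ≤ (D * weight (1 / α) ξ) * (C * ‖f ξ‖) := by gcongr; exact (hDb ξ).1
      _ = _ := by ring

lemma exists_norm_fourierSolutionDeriv_le (hα : 0 < α) (hα1 : α ≤ 1) (f : 𝓢(Space d, ℂ)) : ∃ C : ℝ,
    0 < C ∧ ∀ t, 0 < t → ∀ ξ,
    ‖fourierSolutionDeriv α f t ξ‖ ≤
      C * (1 + t ^ (α - 1)) * (weight (1 / α) ξ * ‖f ξ‖) := by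
  obtain ⟨C, hC, hCb⟩ := exists_norm_propagatorDeriv_le (d := d) hα hα1
  refine ⟨C, hC, fun t ht ξ => ?_⟩
  rw [fourierSolutionDeriv, norm_mul, ← mul_assoc]
  gcongr
  exact hCb t ξ ht

lemma memLp_fourierSolution (hα : 0 < α) (hα1 : α ≤ 1) (f : 𝓢(Space d, ℂ)) {t : ℝ} (ht : 0 ≤ t) :
    MemLp (fourierSolution α f t) 2 volume := by
  obtain ⟨C, hC, hCb⟩ := exists_norm_fourierSolution_le hα hα1 f
  exact memLp_of_norm_le (memLp_weight_mul f (1 / α) 2)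
    (measurable_fourierSolution hα f).of_uncurry_left fun ξ => (hCb t ht ξ).1

lemma memLp_symbol_mul_fourierSolution (hα : 0 < α) (hα1 : α ≤ 1) (f : 𝓢(Space d, ℂ)) {t : ℝ}
    (ht : 0 ≤ t) :
    MemLp (fun ξ => symbol ξ * fourierSolution α f t ξ) 2 volume := by
  obtain ⟨C, hC, hCb⟩ := exists_norm_fourierSolution_le hα hα1 f
  exact memLp_of_norm_le (memLp_weight_mul f (1 / α) 2)
    ((Complex.measurable_ofReal.comp continuous_symbol.measurable).mul
      (measurable_fourierSolution hα f).of_uncurry_left) fun ξ => (hCb t ht ξ).2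

lemma memLp_fourierSolutionDeriv (hα : 0 < α) (hα1 : α ≤ 1) (f : 𝓢(Space d, ℂ)) {t : ℝ}
    (ht : 0 < t) :
    MemLp (fourierSolutionDeriv α f t) 2 volume := by
  obtain ⟨C, hC, hCb⟩ := exists_norm_fourierSolutionDeriv_le hα hα1 f
  exact memLp_of_norm_le (memLp_weight_mul f (1 / α) 2)
    (measurable_fourierSolutionDeriv hα f).of_uncurry_left (hCb t ht)

lemma continuousOn_toL2_fourierSolution (hα : 0 < α) (hα1 : α ≤ 1) (f : 𝓢(Space d, ℂ)) :
    ContinuousOn (fun t => toL2 (fourierSolution α f t)) (Ici 0) := by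
  obtain ⟨C, hC, hCb⟩ := exists_norm_fourierSolution_le hα hα1 f
  exact continuousOn_toL2 (memLp_weight_mul f (1 / α) 2)
    (fun t => (measurable_fourierSolution hα f).of_uncurry_left)
    (continuousOn_const (c := C)) (fun t ht ξ => (hCb t ht ξ).1)
    fun ξ => (continuousOn_propagator hα hα1 ξ).mul continuousOn_const

lemma continuousOn_toL2_symbol_mul_fourierSolution (hα : 0 < α) (hα1 : α ≤ 1) (f : 𝓢(Space d, ℂ)) :
    ContinuousOn (fun t => toL2 fun ξ => symbol ξ * fourierSolution α f t ξ) (Ici 0) := by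
  obtain ⟨C, hC, hCb⟩ := exists_norm_fourierSolution_le hα hα1 f
  exact continuousOn_toL2 (memLp_weight_mul f (1 / α) 2)
    (fun t => (Complex.measurable_ofReal.comp continuous_symbol.measurable).mul
      (measurable_fourierSolution hα f).of_uncurry_left)
    (continuousOn_const (c := C)) (fun t ht ξ => (hCb t ht ξ).2)
    fun ξ => continuousOn_const.mul ((continuousOn_propagator hα hα1 ξ).mul continuousOn_const)

lemma continuousOn_toL2_fourierSolutionDeriv (hα : 0 < α) (hα1 : α ≤ 1) (f : 𝓢(Space d, ℂ)) :
    ContinuousOn (fun t => toL2 (fourierSolutionDeriv α f t)) (Ioi 0) := by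
  obtain ⟨C, hC, hCb⟩ := exists_norm_fourierSolutionDeriv_le hα hα1 f
  refine continuousOn_toL2 (memLp_weight_mul f (1 / α) 2)
    (fun t => (measurable_fourierSolutionDeriv hα f).of_uncurry_left)
    (b := fun t => C * (1 + t ^ (α - 1))) ?_ (fun t ht ξ => hCb t ht ξ)
    fun ξ => (continuousOn_propagatorDeriv hα hα1 ξ).mul continuousOn_const
  exact continuousOn_const.mul (continuousOn_const.add
    (continuousOn_id.rpow_const fun x hx => Or.inl (ne_of_gt hx)))

lemma toL2_fourierSolution_sub (hα : 0 < α) (hα1 : α ≤ 1) (f : 𝓢(Space d, ℂ)) {s t : ℝ}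
    (hs : 0 < s) (hst : s ≤ t) :
    toL2 (fourierSolution α f t) - toL2 (fourierSolution α f s) =
      ∫ r in s..t, toL2 (fourierSolutionDeriv α f r) := by
  obtain ⟨C, hC, hCb⟩ := exists_norm_fourierSolutionDeriv_le hα hα1 f
  have hsub : Icc s t ⊆ Ioi 0 := fun r hr => hs.trans_le hr.1
  have hsub' : Ioc s t ⊆ Ioi 0 := fun r hr => hs.trans hr.1
  have hbc : ContinuousOn (fun r : ℝ => C * (1 + r ^ (α - 1))) (Ioi 0) :=
    continuousOn_const.mul (continuousOn_const.add
      (continuousOn_id.rpow_const fun x hx => Or.inl (ne_of_gt hx)))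
  have h := (integral_toL2 (A := Ioc s t) measurableSet_Ioc (memLp_weight_mul f (1 / α) 2)
    (measurable_fourierSolutionDeriv hα f)
    (((hbc.mono hsub).integrableOn_Icc).mono_set Ioc_subset_Icc_self)
    (fun r hr => by have := Real.rpow_nonneg (hsub' hr).le (α - 1); positivity)
    (fun r hr ξ => hCb r (hsub' hr) ξ)
    (((continuousOn_toL2_fourierSolutionDeriv hα hα1 f).mono hsub').aestronglyMeasurable
      measurableSet_Ioc)).2
  rw [intervalIntegral.integral_of_le hst, h,
    ← toL2_sub (memLp_fourierSolution hα hα1 f (hs.le.trans hst))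
      (memLp_fourierSolution hα hα1 f hs.le)]
  congr 1
  ext ξ
  rw [← intervalIntegral.integral_of_le hst]
  refine (intervalIntegral.integral_eq_sub_of_hasDerivAt
    (f := fun r => fourierSolution α f r ξ) (fun r hr => ?_) ?_).symm
  · rw [uIcc_of_le hst] at hr
    exact (hasDerivAt_propagator hα hα1 ξ (hsub hr)).mul_const _
  · refine ContinuousOn.intervalIntegrable ?_
    rw [uIcc_of_le hst]
    exact ((continuousOn_propagatorDeriv hα hα1 ξ).mul continuousOn_const).mono hsub

lemma abel_fourierSolutionDeriv (hα : 0 < α) (f : 𝓢(Space d, ℂ)) (hα1 : α < 1) {t : ℝ} (ht : 0 < t)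
    :
    IntegrableOn (fun s : ℝ => ((t - s) ^ (-α) : ℝ) • toL2 (fourierSolutionDeriv α f s))
        (Ioo 0 t) ∧
      (∫ s in Ioo 0 t, ((t - s) ^ (-α) : ℝ) • toL2 (fourierSolutionDeriv α f s)) =
        (Real.Gamma (1 - α) * phase α : ℂ) •
          toL2 fun ξ => symbol ξ * fourierSolution α f t ξ := by
  obtain ⟨C, hC, hCb⟩ := exists_norm_fourierSolutionDeriv_le hα hα1.le f
  set M : ℝ → Space d → ℂ := fun s ξ => ((t - s) ^ (-α) : ℝ) * fourierSolutionDeriv α f s ξ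
  have hMe : ∀ s ∈ Ioo 0 t,
      ((t - s) ^ (-α) : ℝ) • toL2 (fourierSolutionDeriv α f s) = toL2 (M s) := fun s hs => by
    rw [toL2_const_mul (memLp_fourierSolutionDeriv hα hα1.le f hs.1), ofReal_smul_L2]
  have hM : Measurable (Function.uncurry M) := by
    have h1 : Measurable fun p : ℝ × Space d => (((t - p.1) ^ (-α) : ℝ) : ℂ) := by fun_prop
    exact h1.mul (measurable_fourierSolutionDeriv hα f)
  have hb : IntegrableOn (fun s : ℝ => (t - s) ^ (-α) * (C * (1 + s ^ (α - 1)))) (Ioo 0 t) := by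
    have h1 := integrableOn_Ioo_sub_rpow_mul_rpow (a := -α) (b := 0) (by linarith) (by linarith)
      (by norm_num) le_rfl ht
    have h2 := integrableOn_Ioo_sub_rpow_mul_rpow (a := -α) (b := α - 1) (by linarith)
      (by linarith) (by linarith) (by linarith) ht
    refine ((h1.add h2).const_mul C).congr (ae_of_all _ fun s => ?_)
    simp only [Pi.add_apply, Real.rpow_zero]
    ring
  have hcont : ContinuousOn
      (fun s : ℝ => ((t - s) ^ (-α) : ℝ) • toL2 (fourierSolutionDeriv α f s)) (Ioo 0 t) :=
    ((continuousOn_const.sub continuousOn_id).rpow_const fun s hs =>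
      Or.inl (sub_pos.2 hs.2).ne').smul
      ((continuousOn_toL2_fourierSolutionDeriv hα hα1.le f).mono Ioo_subset_Ioi_self)
  obtain ⟨h1, h2⟩ := integral_toL2 (A := Ioo 0 t) measurableSet_Ioo
    (memLp_weight_mul f (1 / α) 2) hM hb
    (fun s hs => by
      have := Real.rpow_nonneg hs.1.le (α - 1)
      have := Real.rpow_nonneg (sub_pos.2 hs.2).le (-α)
      positivity)
    (fun s hs ξ => by
      rw [norm_mul, Complex.norm_real,
        Real.norm_of_nonneg (Real.rpow_nonneg (sub_pos.2 hs.2).le (-α)), mul_assoc]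
      gcongr
      · exact Real.rpow_nonneg (sub_pos.2 hs.2).le (-α)
      · exact hCb s hs.1 ξ)
    ((hcont.congr fun s hs => (hMe s hs).symm).aestronglyMeasurable measurableSet_Ioo)
  refine ⟨h1.congr_fun (fun s hs => (hMe s hs).symm) measurableSet_Ioo, ?_⟩
  rw [setIntegral_congr_fun measurableSet_Ioo hMe, h2,
    ← toL2_const_mul (memLp_symbol_mul_fourierSolution hα hα1.le f ht.le)]
  congr 1
  ext ξ
  have h3 := integral_abel_propagatorDeriv hα hα1 ht ξ
  have h4 : ∀ s, M s ξ = (((t - s) ^ (-α) : ℝ) • propagatorDeriv α s ξ) * f ξ := fun s => by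
    simp only [M, fourierSolutionDeriv, Complex.real_smul]; ring
  simp only [h4]
  rw [integral_mul_const, h3, fourierSolution]
  ring

/-- For `α = 1` the density vanishes, so the propagator is the Schrödinger phase `e^{-i symbol t}`.
-/
lemma propagatorDeriv_one (t : ℝ) (ξ : Space d) :
    propagatorDeriv 1 t ξ = phase 1 * (symbol ξ * propagator 1 t ξ) := by
  have h1 : phase 1 = -Complex.I := by
    rw [← exp_poleLog, phase, poleLog]; congr 1; push_cast; ring
  simp [propagatorDeriv, propagator, relaxDeriv, relax, relaxRem, kern_one, freq, h1]
  ring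

lemma toL2_fourierSolutionDeriv_one (f : 𝓢(Space d, ℂ)) {t : ℝ} (ht : 0 ≤ t) :
    toL2 (fourierSolutionDeriv 1 f t) =
      phase 1 • toL2 fun ξ => symbol ξ * fourierSolution 1 f t ξ := by
  rw [← toL2_const_mul (memLp_symbol_mul_fourierSolution one_pos le_rfl f ht)]
  congr 1
  ext ξ
  rw [fourierSolutionDeriv, propagatorDeriv_one, fourierSolution]
  ring

/-- The inverse transform is a continuous linear map and commutes with the time integrals, so each
requirement reduces to a statement about multipliers at fixed `ξ`. -/
theorem isSolution_solution (hα : 0 < α) (hα1 : α ≤ 1) (u₀ : 𝓢(Space d, ℂ)) :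
    IsSolution α α (u₀.toLp 2) (solution α u₀) := by
  set Φ : L2 d ≃L[ℂ] L2 d := (Lp.fourierTransformₗᵢ (Space d) ℂ).symm.toContinuousLinearEquiv
  have hΦ : ∀ f : L2 d, 𝓕⁻ f = Φ f := fun f => rfl
  have hcU : ContinuousOn (solution α u₀) (Ici 0) :=
    Φ.continuous.comp_continuousOn (continuousOn_toL2_fourierSolution hα hα1 (𝓕 u₀))
  refine ⟨fun t => Φ (toL2 (fourierSolutionDeriv α (𝓕 u₀) t)),
    fun t => Φ (toL2 fun ξ => symbol ξ * fourierSolution α (𝓕 u₀) t ξ), ?_, ?_, ?_, ?_, ?_, ?_, ?_⟩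
  · exact (hcU.mono Ioi_subset_Ici_self).locallyIntegrableOn measurableSet_Ioi
  · exact ((Φ.continuous.comp_continuousOn
      (continuousOn_toL2_symbol_mul_fourierSolution hα hα1 (𝓕 u₀))).mono
      Ioi_subset_Ici_self).locallyIntegrableOn measurableSet_Ioi
  · refine ae_of_all _ fun t ht => ?_
    beta_reduce
    rw [freeHamiltonian_iff, ← hΦ, solution, FourierTransform.fourier_fourierInv_eq,
      FourierTransform.fourier_fourierInv_eq]
    filter_upwards [coeFn_toL2 (memLp_fourierSolution hα hα1 (𝓕 u₀) ht.le),
      coeFn_toL2 (memLp_symbol_mul_fourierSolution hα hα1 (𝓕 u₀) ht.le)] with ξ h1 h2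
    rw [h1, h2]
  · exact (Φ.continuous.comp_continuousOn
      (continuousOn_toL2_fourierSolutionDeriv hα hα1 (𝓕 u₀))).locallyIntegrableOn measurableSet_Ioi
  · intro s t hs hst
    have h := congrArg Φ (toL2_fourierSolution_sub hα hα1 (𝓕 u₀) hs hst)
    rw [map_sub, intervalIntegral.integral_of_le hst, ← Φ.integral_comp_comm] at h
    rw [intervalIntegral.integral_of_le hst]
    exact h
  · refine ae_of_all _ fun t ht => ⟨phase α •
      Φ (toL2 fun ξ => symbol ξ * fourierSolution α (𝓕 u₀) t ξ),
      ?_, (eq_phase_smul_iff α _ _).2 rfl⟩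
    unfold HasCaputo
    split_ifs with h
    · subst h
      beta_reduce
      rw [toL2_fourierSolutionDeriv_one _ ht.le, map_smul]
    · obtain ⟨h1, h2⟩ := abel_fourierSolutionDeriv hα (𝓕 u₀) (lt_of_le_of_ne hα1 h) ht
      have h3 : ∀ s : ℝ, ((t - s) ^ (-α) : ℝ) • Φ (toL2 (fourierSolutionDeriv α (𝓕 u₀) s)) =
          Φ (((t - s) ^ (-α) : ℝ) • toL2 (fourierSolutionDeriv α (𝓕 u₀) s)) := fun s => by
        rw [← ofReal_smul_L2, ← ofReal_smul_L2, map_smul]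
      simp only [h3]
      refine ⟨(Φ : L2 d →L[ℂ] L2 d).integrable_comp h1, ?_⟩
      rw [Φ.integral_comp_comm, h2, map_smul, ← ofReal_smul_L2, smul_smul]
      congr 1
      have hG : (Real.Gamma (1 - α) : ℂ) ≠ 0 := by
        exact_mod_cast (Real.Gamma_pos_of_pos (by
          have := lt_of_le_of_ne hα1 h; linarith)).ne'
      push_cast
      rw [← mul_assoc, inv_mul_cancel₀ hG, one_mul]
  · have h0 : solution α u₀ 0 = u₀.toLp 2 := by
      have h1 : toL2 (fourierSolution α (𝓕 u₀) 0) = 𝓕 (u₀.toLp 2 : L2 d) := by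
        rw [SchwartzMap.toLp_fourier_eq]
        refine Lp.ext ?_
        filter_upwards [coeFn_toL2 (memLp_fourierSolution hα hα1 (𝓕 u₀) le_rfl),
          (𝓕 u₀).coeFn_toLp 2 (volume : Measure (Space d))] with ξ h1 h2
        rw [h1, h2, fourierSolution, propagator, mul_zero, relax_zero hα hα1, one_mul]
      rw [solution, h1, FourierTransform.fourierInv_fourier_eq]
    have h1 : Tendsto (solution α u₀) (𝓝[>] 0) (𝓝 (u₀.toLp 2)) := by
      have := (hcU 0 (mem_Ici.2 le_rfl)).mono Ioi_subset_Ici_self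
      rwa [ContinuousWithinAt, h0] at this
    exact tendsto_iff_norm_sub_tendsto_zero.1 h1

end

end

/-! ### The frequency gradient of the propagator -/

section

/-- Integrating the derivative bound `C(1 + σ^{α-1})` from `0` to `τ`; the constant `C / α` absorbs
the `1/α` of the power integral. -/
lemma exists_norm_relax_sub_one_le {α : ℝ} (hα : 0 < α) (hα1 : α ≤ 1) : ∃ C : ℝ, 0 < C ∧
    ∀ τ : ℝ, 0 ≤ τ → ‖relax α τ - 1‖ ≤ C * (τ + τ ^ α) := by
  obtain ⟨C, hC, hCb⟩ := exists_norm_relaxDeriv_le hα hα1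
  refine ⟨C / α, by positivity, fun τ hτ => ?_⟩
  have hint : IntervalIntegrable (fun σ : ℝ => C * (1 + σ ^ (α - 1))) volume 0 τ :=
    (intervalIntegrable_const.add (intervalIntegral.intervalIntegrable_rpow' (by linarith))).const_mul
      C
  have hint' : IntervalIntegrable (relaxDeriv α) volume 0 τ := by
    refine hint.mono_fun (measurable_relaxDeriv α).aestronglyMeasurable ?_
    rw [uIoc_of_le hτ]
    filter_upwards [ae_restrict_mem measurableSet_Ioc] with σ hσ
    exact (hCb σ hσ.1).trans (le_abs_self _)
  have h1 : ∫ σ in (0 : ℝ)..τ, relaxDeriv α σ = relax α τ - relax α 0 :=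
    intervalIntegral.integral_eq_sub_of_hasDerivAt_of_le hτ
      ((continuousOn_relax hα hα1).mono Icc_subset_Ici_self)
      (fun σ hσ => hasDerivAt_relax hα hα1 hσ.1) hint'
  rw [relax_zero hα hα1] at h1
  rw [← h1]
  refine (intervalIntegral.norm_integral_le_of_norm_le hτ
    (ae_of_all _ fun σ hσ => hCb σ hσ.1) hint).trans ?_
  rw [intervalIntegral.integral_const_mul, intervalIntegral.integral_add intervalIntegrable_const
    (intervalIntegral.intervalIntegrable_rpow' (by linarith)),
    integral_rpow (Or.inl (by linarith))]
  simp only [intervalIntegral.integral_const, sub_zero, smul_eq_mul, mul_one, sub_add_cancel,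
    Real.zero_rpow hα.ne']
  have h2 : τ ≤ τ / α := by rw [le_div_iff₀ hα]; nlinarith
  calc C * (τ + τ ^ α / α) ≤ C * (τ / α + τ ^ α / α) := by gcongr
    _ = _ := by ring

variable {d : ℕ}

/-- The derivative of `|2πξ|^{2/α}` is `growthCoeff α ξ * ⟨ξ, ·⟩`. -/
def growthCoeff (α : ℝ) (ξ : Space d) : ℝ :=
  2 / α * (2 * Real.pi) ^ (2 / α) * ‖ξ‖ ^ (2 / α - 2)

lemma growthCoeff_nonneg {α : ℝ} (hα : 0 < α) (ξ : Space d) : 0 ≤ growthCoeff α ξ := by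
  unfold growthCoeff; positivity

lemma freq_eq (α : ℝ) (ξ : Space d) : freq α ξ = (2 * Real.pi) ^ (2 / α) * ‖ξ‖ ^ (2 / α) := by
  rw [freq, symbol, ← Real.rpow_natCast, ← Real.rpow_mul (by positivity),
    ← Real.mul_rpow (by positivity) (norm_nonneg _)]
  congr 1
  push_cast; ring

lemma hasFDerivAt_freq {α : ℝ} (hα : 0 < α) (hα1 : α ≤ 1) (ξ : Space d) :
    HasFDerivAt (freq α) (growthCoeff α ξ • innerSL ℝ ξ) ξ := by
  have hp : 1 < 2 / α := by rw [lt_div_iff₀ hα]; linarith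
  have h := (hasFDerivAt_norm_rpow ξ hp).const_mul ((2 * Real.pi) ^ (2 / α))
  have e : freq α = fun ξ : Space d => (2 * Real.pi) ^ (2 / α) * ‖ξ‖ ^ (2 / α) :=
    funext (freq_eq α)
  rw [e]
  refine h.congr_fderiv ?_
  rw [smul_smul, growthCoeff]
  congr 1
  ring

/-- The oscillating part of the gradient of `propagator α t`, up to the factor `ξ`. -/
def mainGrad (α t : ℝ) (ξ : Space d) : ℂ :=
  (t * growthCoeff α ξ : ℝ) * (-(Complex.I / α) * Complex.exp (-((freq α ξ * t : ℝ) * Complex.I)))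

/-- The remaining part of the gradient of `propagator α t`, up to the factor `ξ`. -/
def remGrad (α t : ℝ) (ξ : Space d) : ℂ :=
  -((t * growthCoeff α ξ : ℝ) * relaxRem α (freq α ξ * t))

lemma mainGrad_add_remGrad (α t : ℝ) (ξ : Space d) :
    mainGrad α t ξ + remGrad α t ξ =
      (t * growthCoeff α ξ : ℝ) * relaxDeriv α (freq α ξ * t) := by
  rw [mainGrad, remGrad, relaxDeriv]; ring

lemma hasLineDerivAt_propagator {α : ℝ} (hα : 0 < α) (hα1 : α ≤ 1) {t : ℝ} (ht : 0 < t)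
    (ξ v : Space d) :
    HasLineDerivAt ℝ (propagator α t)
      ((mainGrad α t ξ + remGrad α t ξ) * (inner ℝ ξ v : ℝ)) ξ v := by
  rcases eq_or_ne ξ 0 with rfl | hξ
  -- At `ξ = 0` the chain rule is unavailable, since `hasDerivAt_relax` needs a positive argument.
  -- But `relax α τ - 1 = O(τ + τ^α)`, and both `freq` and `freq^α = symbol` are `O(|ξ|²)`, so the
  -- derivative is zero.
  · obtain ⟨C, hC, hCb⟩ := exists_norm_relax_sub_one_le hα hα1
    have hO : (fun ξ : Space d => propagator α t ξ - 1) =O[𝓝 0] fun ξ => ‖ξ - 0‖ ^ 2 := by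
      refine IsBigO.of_bound (C * ((2 * Real.pi) ^ (2 / α) * t + (2 * Real.pi) ^ 2 * t ^ α)) ?_
      filter_upwards [Metric.ball_mem_nhds (0 : Space d) one_pos] with ξ hξ
      rw [mem_ball_zero_iff] at hξ
      rw [sub_zero, norm_pow, norm_norm]
      have h1 := hCb (freq α ξ * t) (mul_nonneg (freq_nonneg α ξ) ht.le)
      rw [Real.mul_rpow (freq_nonneg α ξ) ht.le, freq_rpow hα] at h1
      have h2 : ‖ξ‖ ^ (2 / α) ≤ ‖ξ‖ ^ 2 := by
        rw [← Real.rpow_natCast]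
        refine Real.rpow_le_rpow_of_exponent_ge_of_imp (norm_nonneg _) hξ.le ?_ ?_
        · push_cast; rw [le_div_iff₀ hα]; linarith
        · intro _ h
          exact absurd h (by positivity)
      calc ‖propagator α t ξ - 1‖ ≤ C * (freq α ξ * t + symbol ξ * t ^ α) := h1
        _ = C * ((2 * Real.pi) ^ (2 / α) * ‖ξ‖ ^ (2 / α) * t +
            (2 * Real.pi) ^ 2 * ‖ξ‖ ^ 2 * t ^ α) := by rw [freq_eq, symbol, mul_pow]
        _ ≤ C * ((2 * Real.pi) ^ (2 / α) * ‖ξ‖ ^ 2 * t +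
            (2 * Real.pi) ^ 2 * ‖ξ‖ ^ 2 * t ^ α) := by gcongr
        _ = _ := by ring
    have h := (hO.hasFDerivAt (𝕜 := ℝ) one_lt_two).add_const 1
    simp only [sub_add_cancel] at h
    simpa using h.hasLineDerivAt v
  · have hk : 0 < freq α ξ := by
      rw [freq_eq]; have := norm_pos_iff.2 hξ; positivity
    have h := (hasDerivAt_relax hα hα1 (mul_pos hk ht)).hasFDerivAt.comp ξ
      ((hasFDerivAt_freq hα hα1 ξ).mul_const t)
    refine (h.hasLineDerivAt v).congr_deriv ?_
    rw [mainGrad_add_remGrad]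
    simp
    ring

/-- By homogeneity `growthCoeff · |ξ|² = (2/α) freq`, so `|remGrad| |ξ|²` equals `(2/α) τ |relaxRem
α τ|` at `τ = freq · t`. The two bounds on `relaxRem` give the two estimates; keeping the factor
`‖ξ‖` in the second makes `ξ = 0` trivial. -/
lemma exists_norm_remGrad_le {α : ℝ} (hα : 0 < α) (hα1 : α ≤ 1) : ∃ C : ℝ, 0 < C ∧
    ∀ (t : ℝ) (ξ : Space d), 0 < t →
      ‖remGrad α t ξ‖ * ‖ξ‖ ^ 2 ≤ C ∧ ‖remGrad α t ξ‖ * ‖ξ‖ ≤ C * t ^ α * ‖ξ‖ := by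
  obtain ⟨C, hC, hCb⟩ := exists_norm_relaxRem_le hα hα1
  have hpi := Real.pi_gt_three
  have h4 : (1 : ℝ) ≤ (2 * Real.pi) ^ 2 := by nlinarith
  refine ⟨2 / α * C * (2 * Real.pi) ^ 2, by positivity, fun t ξ ht => ?_⟩
  rcases eq_or_ne ξ 0 with rfl | hξ
  · simp; positivity
  have hρ : 0 < ‖ξ‖ := norm_pos_iff.2 hξ
  have hk : 0 < freq α ξ := by rw [freq_eq]; positivity
  obtain ⟨h1, h2⟩ := hCb _ (mul_pos hk ht)
  have hg : growthCoeff α ξ * ‖ξ‖ ^ 2 = 2 / α * freq α ξ := by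
    rw [growthCoeff, freq_eq, Real.rpow_sub hρ]
    norm_num
    field_simp
  have hg0 := growthCoeff_nonneg hα ξ
  have hn : ‖remGrad α t ξ‖ = t * growthCoeff α ξ * ‖relaxRem α (freq α ξ * t)‖ := by
    rw [remGrad, norm_neg, norm_mul, Complex.norm_real, Real.norm_of_nonneg (by positivity)]
  constructor
  · calc ‖remGrad α t ξ‖ * ‖ξ‖ ^ 2
        = 2 / α * (freq α ξ * t) * ‖relaxRem α (freq α ξ * t)‖ := by
          rw [hn]; linear_combination t * ‖relaxRem α (freq α ξ * t)‖ * hg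
      _ ≤ 2 / α * (freq α ξ * t) * (C * (freq α ξ * t)⁻¹) := by gcongr
      _ = 2 / α * C * 1 := by field_simp
      _ ≤ _ := by gcongr
  · gcongr
    refine le_of_mul_le_mul_right ?_ (by positivity : 0 < ‖ξ‖ ^ 2)
    have e : freq α ξ * t * (freq α ξ * t) ^ (α - 1) = symbol ξ * t ^ α := by
      rw [Real.rpow_sub_one (mul_pos hk ht).ne', Real.mul_rpow hk.le ht.le, freq_rpow hα]
      field_simp
    calc ‖remGrad α t ξ‖ * ‖ξ‖ ^ 2
        = 2 / α * (freq α ξ * t) * ‖relaxRem α (freq α ξ * t)‖ := by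
          rw [hn]; linear_combination t * ‖relaxRem α (freq α ξ * t)‖ * hg
      _ ≤ 2 / α * (freq α ξ * t) * (C * (freq α ξ * t) ^ (α - 1)) := by gcongr
      _ = 2 / α * C * (symbol ξ * t ^ α) := by rw [← e]; ring
      _ = _ := by rw [symbol]; ring

lemma norm_mainGrad {α : ℝ} (hα : 0 < α) {t : ℝ} (ht : 0 < t) (ξ : Space d) :
    ‖mainGrad α t ξ‖ = t * growthCoeff α ξ / α := by
  rw [mainGrad, norm_mul, norm_mul, norm_exp_neg_mul_I, Complex.norm_real,
    Real.norm_of_nonneg (mul_nonneg ht.le (growthCoeff_nonneg hα ξ)), norm_neg, norm_div,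
    Complex.norm_I, Complex.norm_real, Real.norm_of_nonneg hα.le]
  ring

lemma exists_growthCoeff_le {α : ℝ} (hα : 0 < α) (hα1 : α ≤ 1) : ∃ C : ℝ, 0 < C ∧
    ∀ ξ : Space d, growthCoeff α ξ ≤ C * weight (1 / α) ξ ∧
      growthCoeff α ξ * ‖ξ‖ ≤ C * weight (1 / α) ξ := by
  have hp : 2 ≤ 2 / α := by rw [le_div_iff₀ hα]; linarith
  have e : 2 * (1 / α) = 2 / α := by ring
  refine ⟨2 / α * (2 * Real.pi) ^ (2 / α), by positivity, fun ξ => ⟨?_, ?_⟩⟩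
  · rw [growthCoeff]
    gcongr
    exact norm_rpow_le_weight (by linarith) (by linarith) ξ
  · rw [growthCoeff, mul_assoc]
    gcongr
    have h1 : ‖ξ‖ ^ (2 / α - 2) * ‖ξ‖ = ‖ξ‖ ^ (2 / α - 1) := by
      rw [← Real.rpow_add_one' (norm_nonneg _) (by linarith)]; congr 1; ring
    rw [h1]
    exact norm_rpow_le_weight (by linarith) (by linarith) ξ

end

/-! ### Main and error terms of the gradient -/

section

open scoped FourierTransform LineDeriv

variable {d : ℕ}

/-- The oscillating part of the derivative of `fourierSolution α f t` in the direction `v`. -/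
def mainTerm (α : ℝ) (f : 𝓢(Space d, ℂ)) (v : Space d) (t : ℝ) (ξ : Space d) : ℂ :=
  mainGrad α t ξ * (inner ℝ ξ v : ℝ) * f ξ

/-- The remaining part of the derivative of `fourierSolution α f t` in the direction `v`. -/
def errTerm (α : ℝ) (f : 𝓢(Space d, ℂ)) (v : Space d) (t : ℝ) (ξ : Space d) : ℂ :=
  remGrad α t ξ * (inner ℝ ξ v : ℝ) * f ξ + propagator α t ξ * (∂_{v} f) ξ

/-- The derivative of `fourierSolution α f t` in the direction `v`. -/
def gradTerm (α : ℝ) (f : 𝓢(Space d, ℂ)) (v : Space d) (t : ℝ) (ξ : Space d) : ℂ :=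
  mainTerm α f v t ξ + errTerm α f v t ξ

section

variable {α : ℝ}

lemma measurable_growthCoeff (α : ℝ) : Measurable (growthCoeff α : Space d → ℝ) := by
  unfold growthCoeff; fun_prop

lemma measurable_mainTerm (hα : 0 < α) (f : 𝓢(Space d, ℂ)) (v : Space d) (t : ℝ) :
    Measurable (mainTerm α f v t) := by
  have h1 := (continuous_freq (d := d) hα).measurable
  have h2 := measurable_growthCoeff (d := d) α
  have h3 := f.continuous.measurable
  unfold mainTerm mainGrad
  fun_prop

lemma measurable_errTerm (hα : 0 < α) (f : 𝓢(Space d, ℂ)) (v : Space d) (t : ℝ) :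
    Measurable (errTerm α f v t) := by
  have h1 := (continuous_freq (d := d) hα).measurable
  have h2 := measurable_growthCoeff (d := d) α
  have h3 := f.continuous.measurable
  have h4 := (∂_{v} f).continuous.measurable
  have h5 : Measurable fun ξ : Space d => relaxRem α (freq α ξ * t) :=
    (measurable_relaxRem α).comp (by fun_prop)
  have h6 : Measurable (propagator α t : Space d → ℂ) :=
    (measurable_propagator hα).of_uncurry_left
  unfold errTerm remGrad
  fun_prop

lemma hasLineDerivAt_fourierSolution (hα : 0 < α) (hα1 : α ≤ 1) (f : 𝓢(Space d, ℂ)) {t : ℝ}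
    (ht : 0 < t) (ξ v : Space d) :
    HasLineDerivAt ℝ (fourierSolution α f t) (gradTerm α f v t ξ) ξ v := by
  have h1 := hasLineDerivAt_propagator hα hα1 ht ξ v
  have h2 : HasLineDerivAt ℝ f ((∂_{v} f) ξ) ξ v := by
    rw [SchwartzMap.lineDerivOp_apply_eq_fderiv]
    exact f.differentiableAt.hasFDerivAt.hasLineDerivAt v
  have h3 := HasDerivAt.mul h1 h2
  simp only [zero_smul, add_zero] at h3
  refine HasDerivAt.congr_deriv h3 ?_
  rw [gradTerm, mainTerm, errTerm]
  ring

lemma abs_inner_le_norm_of_norm_le_one {ξ v : Space d} (hv : ‖v‖ ≤ 1) :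
    ‖((inner ℝ ξ v : ℝ) : ℂ)‖ ≤ ‖ξ‖ := by
  rw [Complex.norm_real]
  exact (norm_inner_le_norm ξ v).trans (mul_le_of_le_one_right (norm_nonneg _) hv)

lemma exists_norm_mainTerm_le (hα : 0 < α) (hα1 : α ≤ 1) (f : 𝓢(Space d, ℂ)) : ∃ C : ℝ,
    0 < C ∧ ∀ (t : ℝ) (ξ v : Space d), 0 < t → ‖v‖ ≤ 1 →
    ‖mainTerm α f v t ξ‖ ≤ C * t * (weight (1 / α) ξ * ‖f ξ‖) := by
  obtain ⟨C, hC, hCb⟩ := exists_growthCoeff_le (d := d) hα hα1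
  refine ⟨C / α, by positivity, fun t ξ v ht hv => ?_⟩
  rw [mainTerm, norm_mul, norm_mul, norm_mainGrad hα ht]
  have hg := growthCoeff_nonneg hα ξ
  calc t * growthCoeff α ξ / α * ‖((inner ℝ ξ v : ℝ) : ℂ)‖ * ‖f ξ‖
      ≤ t * growthCoeff α ξ / α * ‖ξ‖ * ‖f ξ‖ := by
        gcongr; exact abs_inner_le_norm_of_norm_le_one hv
    _ = t / α * (growthCoeff α ξ * ‖ξ‖) * ‖f ξ‖ := by ring
    _ ≤ t / α * (C * weight (1 / α) ξ) * ‖f ξ‖ := by have := (hCb ξ).2; gcongr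
    _ = _ := by ring

lemma exists_norm_errTerm_le (hα : 0 < α) (hα1 : α ≤ 1) (f : 𝓢(Space d, ℂ)) : ∃ C : ℝ,
    0 < C ∧ ∀ (t : ℝ) (ξ v : Space d), 0 < t → ‖v‖ ≤ 1 →
    ‖errTerm α f v t ξ‖ ≤ ‖remGrad α t ξ‖ * ‖ξ‖ * ‖f ξ‖ + C * ‖(∂_{v} f) ξ‖ := by
  obtain ⟨C, hC, hCb⟩ := exists_norm_relax_le hα hα1
  refine ⟨C, hC, fun t ξ v ht hv => (norm_add_le _ _).trans ?_⟩
  rw [norm_mul, norm_mul, norm_mul]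
  gcongr
  · exact abs_inner_le_norm_of_norm_le_one hv
  · exact hCb _ (mul_nonneg (freq_nonneg α ξ) ht.le)

lemma memLp_mainTerm (hα : 0 < α) (hα1 : α ≤ 1) (f : 𝓢(Space d, ℂ)) {v : Space d} (hv : ‖v‖ ≤ 1)
    {t : ℝ} (ht : 0 < t) :
    MemLp (mainTerm α f v t) 2 volume := by
  obtain ⟨C, -, hCb⟩ := exists_norm_mainTerm_le hα hα1 f
  exact memLp_of_norm_le (memLp_weight_mul f (1 / α) 2) (measurable_mainTerm hα f v t)
    fun ξ => hCb t ξ v ht hv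

lemma memLp_errTerm (hα : 0 < α) (hα1 : α ≤ 1) (f : 𝓢(Space d, ℂ)) {v : Space d} (hv : ‖v‖ ≤ 1)
    {t : ℝ} (ht : 0 < t) :
    MemLp (errTerm α f v t) 2 volume := by
  obtain ⟨C, hC, hCb⟩ := exists_norm_errTerm_le hα hα1 f
  obtain ⟨D, hD, hDb⟩ := exists_norm_remGrad_le (d := d) hα hα1
  have h1α : 1 ≤ 1 / α := (one_le_div hα).2 hα1
  refine memLp_of_norm_le (b := D * t ^ α + C)
    ((memLp_weight_mul f (1 / α) 2).add (memLp_weight_mul (∂_{v} f) (1 / α) 2))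
    (measurable_errTerm hα f v t) fun ξ => (hCb t ξ v ht hv).trans ?_
  have h1 : ‖ξ‖ ≤ weight (1 / α) ξ := by
    simpa using norm_rpow_le_weight zero_le_one (by linarith : 1 ≤ 2 * (1 / α)) ξ
  have h2 := one_le_weight (by linarith : 0 ≤ 1 / α) ξ
  -- The bound growing in `t` is the one used here, since `1/|ξ|` need not be square integrable at
  -- the origin.
  have h3 := (hDb t ξ ht).2
  have h4 := Real.rpow_pos_of_pos ht α
  rw [Pi.add_apply]
  calc ‖remGrad α t ξ‖ * ‖ξ‖ * ‖f ξ‖ + C * ‖(∂_{v} f) ξ‖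
      ≤ D * t ^ α * weight (1 / α) ξ * ‖f ξ‖ + C * (weight (1 / α) ξ * ‖(∂_{v} f) ξ‖) := by
        have h5 := h3.trans (by gcongr : D * t ^ α * ‖ξ‖ ≤ D * t ^ α * weight (1 / α) ξ)
        gcongr ?_ * _ + C * ?_
        exact le_mul_of_one_le_left (norm_nonneg _) h2
    _ ≤ (D * t ^ α + C) * (weight (1 / α) ξ * ‖f ξ‖) +
        (D * t ^ α + C) * (weight (1 / α) ξ * ‖(∂_{v} f) ξ‖) := by
        rw [mul_assoc (D * t ^ α)]
        gcongr <;> linarith [mul_pos hD h4]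
    _ = _ := by ring

lemma memLp_gradTerm (hα : 0 < α) (hα1 : α ≤ 1) (f : 𝓢(Space d, ℂ)) {v : Space d} (hv : ‖v‖ ≤ 1)
    {t : ℝ} (ht : 0 < t) :
    MemLp (gradTerm α f v t) 2 volume :=
  (memLp_mainTerm hα hα1 f hv ht).add (memLp_errTerm hα hα1 f hv ht)

lemma abs_norm_add_sq_sub_le (z w : ℂ) :
    |‖z + w‖ ^ 2 - ‖z‖ ^ 2| ≤ 2 * (‖z‖ * ‖w‖) + ‖w‖ ^ 2 := by
  have h1 : |‖z + w‖ - ‖z‖| ≤ ‖w‖ := by simpa using abs_norm_sub_norm_le (z + w) z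
  have h2 := norm_add_le z w
  calc |‖z + w‖ ^ 2 - ‖z‖ ^ 2| = |‖z + w‖ - ‖z‖| * (‖z + w‖ + ‖z‖) := by
        rw [← abs_of_nonneg (by positivity : 0 ≤ ‖z + w‖ + ‖z‖), ← abs_mul]; congr 1; ring
    _ ≤ ‖w‖ * (‖z‖ + ‖w‖ + ‖z‖) := by gcongr
    _ = _ := by ring

/-- The analytic heart of the asymptotics: replacing the gradient by its oscillating part costs
`O(t)` pointwise, with an integrable density. The constant is twice that of the cross term plus that
of the squared error. -/
lemma exists_abs_norm_gradTerm_sq_sub_le (hα : 0 < α) (hα1 : α ≤ 1) (f : 𝓢(Space d, ℂ)) : ∃ K : ℝ,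
    0 < K ∧
    ∀ (t : ℝ) (ξ v : Space d), 1 ≤ t → ‖v‖ ≤ 1 →
      |‖gradTerm α f v t ξ‖ ^ 2 - ‖mainTerm α f v t ξ‖ ^ 2| ≤
        K * t * ((weight (1 / α) ξ * ‖f ξ‖) ^ 2 + (weight (1 / α) ξ * ‖(∂_{v} f) ξ‖) ^ 2) := by
  obtain ⟨M, hM, hMb⟩ := exists_norm_errTerm_le hα hα1 f
  obtain ⟨C, hC, hCb⟩ := exists_norm_remGrad_le (d := d) hα hα1
  obtain ⟨B, hB, hBb⟩ := exists_growthCoeff_le (d := d) hα hα1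
  refine ⟨2 / α * B * (C + M) + 2 * (C ^ 2 + M ^ 2), by positivity, fun t ξ v ht hv => ?_⟩
  have ht0 : 0 < t := one_pos.trans_le ht
  obtain ⟨hR1, hR2⟩ := hCb t ξ ht0
  obtain ⟨hG1, hG2⟩ := hBb ξ
  have hG0 := growthCoeff_nonneg hα ξ
  have hE := hMb t ξ v ht0 hv
  have hA : ‖mainTerm α f v t ξ‖ ≤ t * growthCoeff α ξ / α * ‖ξ‖ * ‖f ξ‖ := by
    rw [mainTerm, norm_mul, norm_mul, norm_mainGrad hα ht0]
    gcongr
    exact abs_inner_le_norm_of_norm_le_one hv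
  have hW := one_le_weight (by positivity : 0 ≤ 1 / α) ξ
  refine (abs_norm_add_sq_sub_le _ _).trans ?_
  set A := ‖mainTerm α f v t ξ‖
  set E := ‖errTerm α f v t ξ‖
  set R := ‖remGrad α t ξ‖
  set G := growthCoeff α ξ
  set W := weight (1 / α) ξ
  set x := ‖f ξ‖
  set y := ‖(∂_{v} f) ξ‖
  set ρ := ‖ξ‖
  have hR : 0 ≤ R := norm_nonneg _
  have hx : 0 ≤ x := norm_nonneg _
  have hy : 0 ≤ y := norm_nonneg _
  have hρ : 0 ≤ ρ := norm_nonneg _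
  have hWW : W ≤ W ^ 2 := by nlinarith
  have hxy : x * y ≤ x ^ 2 + y ^ 2 := by nlinarith [sq_nonneg (x - y)]
  -- The main term supplies the extra factor `ρ` that completes `R ρ` to the bounded quantity `R
  -- ρ²`.
  have hAE : A * E ≤ 1 / α * B * (C + M) * t * (W ^ 2 * (x ^ 2 + y ^ 2)) :=
    calc A * E ≤ (t * G / α * ρ * x) * (R * ρ * x + M * y) := by gcongr
      _ = t / α * (G * (R * ρ ^ 2) * x ^ 2 + M * (G * ρ) * (x * y)) := by ring
      _ ≤ t / α * ((B * W) * C * (x ^ 2 + y ^ 2) + M * (B * W) * (x ^ 2 + y ^ 2)) := by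
          gcongr
          linarith [sq_nonneg y]
      _ = 1 / α * B * (C + M) * t * (W * (x ^ 2 + y ^ 2)) := by ring
      _ ≤ _ := by gcongr
  -- No spare `ρ` is available here. One factor is estimated by `C t^α ρ`, whose `ρ` completes the
  -- other to `R ρ² ≤ C`; then `t^α ≤ t` for `t ≥ 1`.
  have hRR : (R * ρ) ^ 2 ≤ C ^ 2 * t :=
    calc (R * ρ) ^ 2 = (R * ρ) * (R * ρ) := by ring
      _ ≤ (C * t ^ α * ρ) * (R * ρ) := by gcongr
      _ = C * t ^ α * (R * ρ ^ 2) := by ring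
      _ ≤ C * t * C := by
          gcongr
          exact Real.rpow_le_self_of_one_le ht hα1
      _ = _ := by ring
  have hW2 : 1 ≤ W ^ 2 := hW.trans hWW
  have hEE : E ^ 2 ≤ 2 * (C ^ 2 + M ^ 2) * t * (W ^ 2 * (x ^ 2 + y ^ 2)) :=
    calc E ^ 2 ≤ (R * ρ * x + M * y) ^ 2 := by gcongr
      _ ≤ 2 * ((R * ρ * x) ^ 2 + (M * y) ^ 2) := by nlinarith [sq_nonneg (R * ρ * x - M * y)]
      _ = 2 * ((R * ρ) ^ 2 * x ^ 2 + M ^ 2 * 1 * y ^ 2) := by ring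
      _ ≤ 2 * (C ^ 2 * t * (x ^ 2 + y ^ 2) + M ^ 2 * t * (x ^ 2 + y ^ 2)) := by
          gcongr <;> linarith [sq_nonneg x, sq_nonneg y]
      _ = 2 * (C ^ 2 + M ^ 2) * t * (1 * (x ^ 2 + y ^ 2)) := by ring
      _ ≤ _ := by gcongr
  calc 2 * (A * E) + E ^ 2 ≤ 2 * (1 / α * B * (C + M) * t * (W ^ 2 * (x ^ 2 + y ^ 2))) +
        2 * (C ^ 2 + M ^ 2) * t * (W ^ 2 * (x ^ 2 + y ^ 2)) := by gcongr
    _ = _ := by ring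

end

end

/-! ### Mean-square displacement through Plancherel -/

section

open scoped FourierTransform LineDeriv

variable {d : ℕ}

/-- Integration by parts against a Schwartz function; a line derivative existing at every point,
together with integrability of the products, leaves no boundary or singular contribution. -/
lemma lineDeriv_toL2 {g g' : Space d → ℂ} {v : Space d} (hg : MemLp g 2 volume)
    (hg' : MemLp g' 2 volume) (h : ∀ ξ, HasLineDerivAt ℝ g (g' ξ) ξ v) :
    ∂_{v} (Lp.toTemperedDistribution (toL2 g)) = Lp.toTemperedDistribution (toL2 g') := by
  ext φ
  have h1 : Integrable fun x => (∂_{v} φ) x * g x :=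
    ((∂_{v} φ).memLp 2 volume).integrable_mul hg
  have h2 : Integrable fun x => φ x * g' x := (φ.memLp 2 volume).integrable_mul hg'
  have h3 : Integrable fun x => φ x * g x := (φ.memLp 2 volume).integrable_mul hg
  have h4 := integral_bilinear_hasLineDerivAt_right_eq_neg_left_of_integrable
    (μ := (volume : Measure (Space d))) (B := ContinuousLinearMap.mul ℝ ℂ) (f := φ)
    (f' := fun x => (∂_{v} φ) x) (g := g) (g' := g') (v := v) h1 h2 h3
    (fun x _ => by
      rw [SchwartzMap.lineDerivOp_apply_eq_fderiv]
      exact φ.differentiableAt.hasFDerivAt.hasLineDerivAt v) (fun x _ => h x)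
  simp only [ContinuousLinearMap.mul_apply'] at h4
  rw [TemperedDistribution.lineDerivOp_apply_apply, Lp.toTemperedDistribution_apply,
    Lp.toTemperedDistribution_apply]
  have h5 : ∫ x, φ x • (toL2 g' : Space d → ℂ) x = ∫ x, φ x * g' x :=
    integral_congr_ae (by filter_upwards [coeFn_toL2 hg'] with x hx; rw [hx, smul_eq_mul])
  have h6 : ∫ x, (-∂_{v} φ) x • (toL2 g : Space d → ℂ) x = ∫ x, -((∂_{v} φ) x * g x) :=
    integral_congr_ae (by
      filter_upwards [coeFn_toL2 hg] with x hx
      rw [hx, smul_eq_mul, neg_apply, neg_mul])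
  rw [h5, h6, h4, integral_neg]

lemma inner_single_one (x : Space d) (j : Fin d) :
    inner ℝ x (EuclideanSpace.single j (1 : ℝ)) = x j := by
  simp [EuclideanSpace.inner_single_right]

lemma sum_norm_inner_single_sq (x : Space d) (c z : ℂ) :
    ∑ j, ‖c * ((inner ℝ x (EuclideanSpace.single j (1 : ℝ)) : ℝ) : ℂ) * z‖ ^ 2 =
      ‖c‖ ^ 2 * (‖x‖ ^ 2 * ‖z‖ ^ 2) := by
  rw [EuclideanSpace.real_norm_sq_eq, Finset.sum_mul, Finset.mul_sum]
  refine Finset.sum_congr rfl fun j _ => ?_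
  rw [inner_single_one, norm_mul, norm_mul, Complex.norm_real, mul_pow, mul_pow, Real.norm_eq_abs,
    sq_abs, mul_assoc]

lemma finiteMSD_and_msd_eq {f : L2 d} {F : Fin d → L2 d}
    (h : ∀ j, (F j : Space d → ℂ) =ᵐ[volume] fun x =>
      (-(2 * Real.pi * Complex.I) * (inner ℝ x (EuclideanSpace.single j (1 : ℝ)) : ℝ)) * f x) :
    FiniteMSD f ∧ msd f = ((2 * Real.pi) ^ 2)⁻¹ * ∑ j, ‖F j‖ ^ 2 := by
  have hc : ‖-(2 * Real.pi * Complex.I)‖ = 2 * Real.pi := by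
    simp [abs_of_pos Real.pi_pos]
  have hae : (fun x : Space d => ‖x‖ ^ 2 * ‖f x‖ ^ 2) =ᵐ[volume]
      fun x => ((2 * Real.pi) ^ 2)⁻¹ * ∑ j, ‖F j x‖ ^ 2 := by
    filter_upwards [eventually_all.2 h] with x hx
    simp only [hx]
    rw [sum_norm_inner_single_sq, hc, inv_mul_cancel_left₀ (by positivity)]
  have hi : ∀ j ∈ Finset.univ, Integrable fun x : Space d => ‖F j x‖ ^ 2 :=
    fun j _ => integrable_norm_sq_L2 (F j)
  refine ⟨((integrable_finsetSum _ hi).const_mul _).congr hae.symm, ?_⟩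
  rw [msd, integral_congr_ae hae, integral_const_mul, integral_finsetSum _ hi]
  simp only [norm_sq_L2]

section

variable {α : ℝ}

lemma finiteMSD_and_msd_solution (hα : 0 < α) (hα1 : α ≤ 1) (u₀ : 𝓢(Space d, ℂ)) {t : ℝ}
    (ht : 0 < t) :
    FiniteMSD (solution α u₀ t) ∧ msd (solution α u₀ t) = ((2 * Real.pi) ^ 2)⁻¹ *
      ∑ j, ∫ ξ, ‖gradTerm α (𝓕 u₀) (EuclideanSpace.single j (1 : ℝ)) t ξ‖ ^ 2 := by
  have hv : ∀ j : Fin d, ‖(EuclideanSpace.single j (1 : ℝ) : Space d)‖ ≤ 1 := fun j => by simp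
  have hg := fun j => memLp_gradTerm hα hα1 (𝓕 u₀) (hv j) ht
  obtain ⟨h1, h2⟩ := finiteMSD_and_msd_eq
    (F := fun j => 𝓕⁻ (toL2 (gradTerm α (𝓕 u₀) (EuclideanSpace.single j (1 : ℝ)) t)))
    fun j => fourierInv_lineDeriv_ae (lineDeriv_toL2
      (memLp_fourierSolution hα hα1 (𝓕 u₀) ht.le) (hg j)
      fun ξ => hasLineDerivAt_fourierSolution hα hα1 (𝓕 u₀) ht ξ _)
  refine ⟨h1, ?_⟩
  have hn : ∀ f : L2 d, ‖(𝓕⁻ f : L2 d)‖ = ‖f‖ := fun f => by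
    rw [← Lp.norm_fourier_eq, FourierTransform.fourier_fourierInv_eq]
  simp only [solution, h2, hn, norm_sq_L2]
  congr 1
  refine Finset.sum_congr rfl fun j _ => integral_congr_ae ?_
  filter_upwards [coeFn_toL2 (hg j)] with ξ hξ
  rw [hξ]

/-- The phase has modulus one, so the density is an exact multiple of `t²`. One `2/α` comes from
differentiating `freq` and one `1/α` from the residue, squared to `4/α⁴`. -/
lemma sum_norm_mainTerm_sq (hα : 0 < α) (hα1 : α ≤ 1) (f : 𝓢(Space d, ℂ)) {t : ℝ} (ht : 0 < t)
    (ξ : Space d) :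
    ((2 * Real.pi) ^ 2)⁻¹ * ∑ j, ‖mainTerm α f (EuclideanSpace.single j (1 : ℝ)) t ξ‖ ^ 2 =
      t ^ 2 * (4 / α ^ 4 * ((2 * Real.pi * ‖ξ‖) ^ ((2 - α) / α) * ‖f ξ‖) ^ 2) := by
  have hp : 0 < (2 - α) / α := div_pos (by linarith) hα
  have e1 : 2 / α - 2 + 1 = (2 - α) / α := by field_simp; ring
  have e2 : (2 - α) / α + 1 = 2 / α := by field_simp; ring
  have key : growthCoeff α ξ * ‖ξ‖ =
      2 / α * (2 * Real.pi) * (2 * Real.pi * ‖ξ‖) ^ ((2 - α) / α) := by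
    rw [growthCoeff, mul_assoc, ← Real.rpow_add_one' (norm_nonneg _) (by rw [e1]; exact hp.ne'),
      e1, Real.mul_rpow (by positivity) (norm_nonneg _), ← e2,
      Real.rpow_add_one (by positivity)]
    ring
  unfold mainTerm
  rw [sum_norm_inner_single_sq, norm_mainGrad hα ht]
  calc ((2 * Real.pi) ^ 2)⁻¹ * ((t * growthCoeff α ξ / α) ^ 2 * (‖ξ‖ ^ 2 * ‖f ξ‖ ^ 2))
      = ((2 * Real.pi) ^ 2)⁻¹ * (t / α) ^ 2 * (growthCoeff α ξ * ‖ξ‖) ^ 2 * ‖f ξ‖ ^ 2 := by ring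
    _ = _ := by rw [key]; field_simp; ring

lemma exists_abs_msd_solution_sub_le (hα : 0 < α) (hα1 : α ≤ 1) (u₀ : 𝓢(Space d, ℂ)) : ∃ K : ℝ,
    ∀ t : ℝ, 1 ≤ t →
    |msd (solution α u₀ t) - 4 / α ^ 4 *
      (∫ ξ : Space d, ((2 * Real.pi * ‖ξ‖) ^ ((2 - α) / α) * ‖𝓕 u₀ ξ‖) ^ 2) * t ^ 2| ≤ K * t := by
  obtain ⟨K, hK, hKb⟩ := exists_abs_norm_gradTerm_sq_sub_le hα hα1 (𝓕 u₀)
  set e : Fin d → Space d := fun j => EuclideanSpace.single j (1 : ℝ) with he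
  have hv : ∀ j, ‖e j‖ ≤ 1 := fun j => by simp [he]
  set H : Fin d → Space d → ℝ := fun j ξ =>
    (weight (1 / α) ξ * ‖𝓕 u₀ ξ‖) ^ 2 + (weight (1 / α) ξ * ‖(∂_{e j} (𝓕 u₀)) ξ‖) ^ 2
  have hH : ∀ j, Integrable (H j) := fun j =>
    (memLp_weight_mul (𝓕 u₀) (1 / α) 2).integrable_sq.add
      (memLp_weight_mul (∂_{e j} (𝓕 u₀)) (1 / α) 2).integrable_sq
  refine ⟨((2 * Real.pi) ^ 2)⁻¹ * ∑ j, K * ∫ ξ, H j ξ, fun t ht => ?_⟩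
  have ht0 : 0 < t := one_pos.trans_le ht
  have hsq : ∀ {g : Space d → ℂ}, MemLp g 2 volume → Integrable fun ξ => ‖g ξ‖ ^ 2 :=
    fun hg => (memLp_two_iff_integrable_sq_norm hg.1).1 hg
  have hmain : 4 / α ^ 4 *
      (∫ ξ : Space d, ((2 * Real.pi * ‖ξ‖) ^ ((2 - α) / α) * ‖𝓕 u₀ ξ‖) ^ 2) * t ^ 2 =
      ((2 * Real.pi) ^ 2)⁻¹ * ∑ j, ∫ ξ, ‖mainTerm α (𝓕 u₀) (e j) t ξ‖ ^ 2 := by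
    rw [← integral_finsetSum _ fun j _ => hsq (memLp_mainTerm hα hα1 (𝓕 u₀) (hv j) ht0),
      ← integral_const_mul, ← integral_const_mul, ← integral_mul_const]
    congr 1
    ext ξ
    rw [sum_norm_mainTerm_sq hα hα1 (𝓕 u₀) ht0]
    ring
  rw [hmain, (finiteMSD_and_msd_solution hα hα1 u₀ ht0).2, ← mul_sub, ← Finset.sum_sub_distrib,
    abs_mul, abs_of_nonneg (by positivity), mul_assoc, Finset.sum_mul]
  gcongr
  refine (Finset.abs_sum_le_sum_abs _ _).trans (Finset.sum_le_sum fun j _ => ?_)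
  rw [← integral_sub (hsq (memLp_gradTerm hα hα1 (𝓕 u₀) (hv j) ht0))
    (hsq (memLp_mainTerm hα hα1 (𝓕 u₀) (hv j) ht0)), ← Real.norm_eq_abs]
  refine (norm_integral_le_of_norm_le ((hH j).const_mul (K * t))
    (ae_of_all _ fun ξ => hKb t ξ (e j) ht (hv j))).trans_eq ?_
  rw [integral_const_mul]
  ring

end

end

/-! ### The ballistic coefficient -/

section

open scoped FourierTransform

variable {d : ℕ}

lemma fourier_two_pi_smul (u₀ : 𝓢(Space d, ℂ)) (ξ : Space d) :
    fourier u₀ ((2 * Real.pi) • ξ) = (((2 * Real.pi) ^ (-(d : ℝ) / 2) : ℝ) : ℂ) * 𝓕 u₀ ξ := by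
  rw [fourier, SchwartzMap.fourier_coe, Real.fourier_eq']
  congr 2
  ext x
  rw [smul_eq_mul, inner_smul_right]
  congr 2
  push_cast
  ring

/-- The substitution `ξ ↦ 2πξ` passes between the two Fourier conventions; the squared normalization
`(2π)^{-d}` matches the Jacobian. -/
lemma ballisticCoeff_eq (α : ℝ) (u₀ : 𝓢(Space d, ℂ)) :
    ballisticCoeff α u₀ = 4 / α ^ 4 *
      ∫ ξ : Space d, ((2 * Real.pi * ‖ξ‖) ^ ((2 - α) / α) * ‖𝓕 u₀ ξ‖) ^ 2 := by
  have hpi : 0 < 2 * Real.pi := by positivity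
  have h := Measure.integral_comp_smul (volume : Measure (Space d))
    (fun ξ => (‖ξ‖ ^ ((2 - α) / α) * ‖fourier u₀ ξ‖) ^ 2) (2 * Real.pi)
  have e : ((2 * Real.pi) ^ (-(d : ℝ) / 2)) ^ 2 = ((2 * Real.pi) ^ d)⁻¹ := by
    rw [← Real.rpow_natCast, ← Real.rpow_mul hpi.le, ← Real.rpow_natCast, ← Real.rpow_neg hpi.le]
    congr 1; push_cast; ring
  have hc : ∀ ξ : Space d,
      (‖(2 * Real.pi) • ξ‖ ^ ((2 - α) / α) * ‖fourier u₀ ((2 * Real.pi) • ξ)‖) ^ 2 =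
      ((2 * Real.pi) ^ d)⁻¹ * ((2 * Real.pi * ‖ξ‖) ^ ((2 - α) / α) * ‖𝓕 u₀ ξ‖) ^ 2 := fun ξ => by
    rw [fourier_two_pi_smul, norm_smul, Real.norm_of_nonneg hpi.le, norm_mul, Complex.norm_real,
      Real.norm_of_nonneg (Real.rpow_nonneg hpi.le _), ← e]
    ring
  simp only [hc] at h
  rw [integral_const_mul, finrank_euclideanSpace_fin, abs_of_pos (by positivity), smul_eq_mul] at h
  rw [ballisticCoeff, mul_left_cancel₀ (by positivity) h]

lemma ballisticCoeff_pos (hd : 1 ≤ d) {α : ℝ} (hα : 0 < α) (hα1 : α ≤ 1) {u₀ : 𝓢(Space d, ℂ)}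
    (hu : u₀ ≠ 0) : 0 < ballisticCoeff α u₀ := by
  have hp : 0 < (2 - α) / α := div_pos (by linarith) hα
  have hF : (𝓕 u₀ : 𝓢(Space d, ℂ)) ≠ 0 := fun h => hu (by
    have h1 : (𝓕⁻ (𝓕 u₀ : 𝓢(Space d, ℂ)) : 𝓢(Space d, ℂ)) = u₀ :=
      FourierTransform.fourierInv_fourier_eq u₀
    rw [← h1, h, FourierTransform.fourierInv_zero])
  obtain ⟨ξ₀, hξ₀⟩ : ∃ ξ, 𝓕 u₀ ξ ≠ 0 := by
    by_contra! h
    exact hF (by ext ξ; exact h ξ)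
  have : Nonempty (Fin d) := ⟨⟨0, hd⟩⟩
  set g : Space d → ℝ := fun ξ =>
    4 / α ^ 4 * ((2 * Real.pi * ‖ξ‖) ^ ((2 - α) / α) * ‖𝓕 u₀ ξ‖) ^ 2 with hg
  have hgc : Continuous g := by
    have h1 : Continuous fun ξ : Space d => (2 * Real.pi * ‖ξ‖) ^ ((2 - α) / α) :=
      (by fun_prop : Continuous fun ξ : Space d => 2 * Real.pi * ‖ξ‖).rpow_const
        fun _ => Or.inr hp.le
    have h2 := (𝓕 u₀).continuous
    fun_prop
  -- At `t = 1` the density of the main term is exactly `g`, so integrability is inherited from the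
  -- main terms.
  have hgi : Integrable g := by
    refine Integrable.congr (((integrable_finsetSum Finset.univ fun j _ =>
      (memLp_two_iff_integrable_sq_norm (memLp_mainTerm hα hα1 (𝓕 u₀)
        (v := EuclideanSpace.single j (1 : ℝ)) (by simp) one_pos).1).1
      (memLp_mainTerm hα hα1 (𝓕 u₀) (by simp) one_pos))).const_mul ((2 * Real.pi) ^ 2)⁻¹)
      (ae_of_all _ fun ξ => ?_)
    beta_reduce
    rw [sum_norm_mainTerm_sq hα hα1 (𝓕 u₀) one_pos, one_pow, one_mul]
  rw [ballisticCoeff_eq, ← integral_const_mul,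
    integral_pos_iff_support_of_nonneg (fun ξ => by positivity) hgi]
  refine hgc.isOpen_support.measure_pos _ ?_
  have hopen : IsOpen {ξ : Space d | 𝓕 u₀ ξ ≠ 0} := (𝓕 u₀).continuous.isOpen_support
  -- The factor `|ξ|` vanishes at the origin, so a nonzero frequency is needed; it exists because `d
  -- ≥ 1` makes the origin non-isolated.
  obtain ⟨ξ, h1, h2⟩ := (dense_compl_singleton (0 : Space d)).inter_open_nonempty _ hopen ⟨ξ₀, hξ₀⟩
  refine ⟨ξ, ?_⟩
  have h3 : 0 < ‖ξ‖ := norm_pos_iff.2 h2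
  have h4 : 0 < ‖𝓕 u₀ ξ‖ := norm_pos_iff.2 h1
  exact ne_of_gt (by rw [hg]; positivity)

end

end TFSE

end

theorem mainTheorem1 (d : ℕ) (hd : 1 ≤ d) (α β : ℝ) (hα : 0 < α) (hα1 : α ≤ 1) (hαβ : α = β)
    (u₀ : 𝓢(TFSE.Space d, ℂ)) :
    ∃ u : ℝ → TFSE.L2 d,
      TFSE.IsSolution α β (u₀.toLp 2) u ∧
      (∀ u' : ℝ → TFSE.L2 d, TFSE.IsSolution α β (u₀.toLp 2) u' → EqOn u' u (Ioi 0)) ∧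
      (∀ t : ℝ, 0 < t → TFSE.FiniteMSD (u t)) ∧
      (fun t : ℝ => TFSE.msd (u t) - TFSE.ballisticCoeff α u₀ * t ^ 2) =O[atTop]
        (fun t : ℝ => t) ∧
      (u₀ ≠ 0 → 0 < TFSE.ballisticCoeff α u₀) := by
  subst hαβ
  have hsol := TFSE.isSolution_solution hα hα1 u₀
  refine ⟨TFSE.solution α u₀, hsol, fun u' hu' => TFSE.IsSolution.eqOn hα hα1 hu' hsol,
    fun t ht => (TFSE.finiteMSD_and_msd_solution hα hα1 u₀ ht).1, ?_,
    TFSE.ballisticCoeff_pos hd hα hα1⟩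
  obtain ⟨K, hK⟩ := TFSE.exists_abs_msd_solution_sub_le hα hα1 u₀
  refine IsBigO.of_bound K ?_
  filter_upwards [eventually_ge_atTop 1] with t ht
  rw [TFSE.ballisticCoeff_eq, Real.norm_eq_abs, Real.norm_of_nonneg (zero_le_one.trans ht)]
  exact hK t ht
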